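/- Let $L>0$, and let $b=1$ (Neumann boundary conditions) or $b=2$ (periodic boundary conditions) on $[0,L]$. Put $\nu_k=(b\pi k/L)^2$ and $\lambda_k=\nu_k-1$ for $k\in\mathbb Z$. For a sequence $z=(z_k)_{k\in\mathbb Z}$ of complex numbers let $\|z\|_{H^s}^2=\sum_k(1+k^2)^s|z_k|^2$, and let $H^s$ be the set of sequences for which this is finite. Call $z$ admissible if $z_{-k}=\overline{z_k}$ for all $k$ and, in the Neumann case, also $z_{-k}=z_k$ for all $k$. For admissible $z\in H^1$ and $U:\mathbb R\to\mathbb R$ of class $C^5$ put $$u_z(x)=\sum_{k\in\mathbb Z} z_k\frac{e^{\mathrm i b k\pi x/L}}{\sqrt L},\qquad \hat V(z)=\frac12\sum_{k}\nu_k|z_k|^2+\int_0^L U(u_z(x))\,dx,\qquad \hat V_2(z)=\frac12\sum_k\lambda_k z_kz_{-k}.$$ Assume that $\lambda_k$ is bounded away from $0$ for $k\neq\pm1$. Then there is a family of maps $g=g_{a_3,a_4}$ ($a_3,a_4\in\mathbb R$) on complex sequences with the following properties, for all $5/12<s<1/2$. 1. For $z\in H^s$: if $z$ is real then so is $g(z)$;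 if $z_{-k}=z_k$ for all $k$ then $g(z)_{-k}=g(z)_k$; if $z_{-k}=\overline{z_k}$ for all $k$ then $g(z)_{-k}=\overline{g(z)_k}$; and if $z\in H^1$ then $g(z)\in H^1$. 2. (Normal form.) Let $U$ be of class $C^5$ with $$U(u)=-\tfrac12u^2+\tfrac{a_3\sqrt L}{3}u^3+\tfrac{a_4L}{4}u^4+O(u^5)\qquad(u\to0),$$ let $g=g_{a_3,a_4}$, and for admissible $z\in H^1$ define $R_1(z)$ by $$\hat V(z+g(z))=\hat V_2(z)+C_4\,z_1^2z_{-1}^2+R_1(z),\qquad C_4=\frac32a_4+2a_3^2\Bigl(\frac1{|\lambda_0|}-\frac1{2\lambda_2}\Bigr).$$ Then $R_1(z)=O(\|z\|_{H^s}^5)$ in the following sense. (a) For every $M$ there are $C,\delta>0$ such that $|R_1(z)|\le C\|z\|_{H^s}^5$ for all admissible $z\in H^1$ with $\|z\|_{H^s}\le\delta$ and $\sup_{[0,L]}|u_z|\le M$. (b) If $|U(u)|\le M_0(1+|u|^{2p_0})$ for all $u\in\mathbb R$, with $p_0\ge2$ and $s>\frac12-\frac1{2p_0}$ (which holds automatically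 if $p_0\le6$), then there are $C,\delta>0$ such that $|R_1(z)|\le C\|z\|_{H^s}^5$ for all admissible $z\in H^1$ with $\|z\|_{H^s}\le\delta$. 3. For all $a_3,a_4$ and all $t<2s-\frac12$ there are $C,\delta>0$ such that $g(z)\in H^t$ and $\|g(z)\|_{H^t}\le C\|z\|_{H^s}^2$ for all $z\in H^s$ with $\|z\|_{H^s}\le\delta$. 4. There are $C,\delta>0$, independent of $a_3,a_4$, such that for all $a_3,a_4\in\mathbb R$ and all $z\in H^s$ with $|a_3|\|z\|_{H^s}\le\delta$ and $|a_4|\|z\|_{H^s}^2\le\delta$ (in particular for those with $z_k=z_{-k}$) the matrix $\partial_zg(z)=(\partial g_k/\partial z_l)_{k,l\in\mathbb Z}$ of partial derivatives exists, the infinite determinant $\det(\mathbf 1+\partial_zg(z))$ exists as the limit of the determinants of the restrictions to finite index sets $F\subset\mathbb Z$ (along the directed set of all such $F$), and $$\bigl|\det(\mathbf 1+\partial_zg(z))-1\bigr|\le C\bigl(|a_3|\,\|z\|_{H^s}+|a_4|\,\|z\|_{H^s}^2\bigr).$$ -/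

import Mathlib

open Filter Topology Asymptotics

namespace NormalForm

/-- The two boundary conditions on the interval `[0, L]`. -/
inductive BoundaryCondition
  | neumann
  | periodic

/-- The factor `b` in the Fourier modes `exp (i b k π x / L)`. -/
def BoundaryCondition.b : BoundaryCondition → ℝ
  | .neumann => 1
  | .periodic => 2

/-- Eigenvalues `ν_k = (b π k / L)²` of minus the Laplacian. -/
noncomputable def nu (bc : BoundaryCondition) (L : ℝ) (k : ℤ) : ℝ :=
  (bc.b * Real.pi * k / L) ^ 2

/-- `λ_k = ν_k - 1`. -/
noncomputable def lam (bc : BoundaryCondition) (L : ℝ) (k : ℤ) : ℝ :=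
  nu bc L k - 1

/-- Fourier sequences of real functions obeying the boundary condition:
`z_{-k}` is the conjugate of `z_k`, and moreover `z_{-k} = z_k` for Neumann. -/
def Admissible (bc : BoundaryCondition) (z : ℤ → ℂ) : Prop :=
  (∀ k, z (-k) = (starRingEnd ℂ) (z k)) ∧
    (bc = BoundaryCondition.neumann → ∀ k, z (-k) = z k)

/-- `z ∈ H^s`. -/
def MemH (s : ℝ) (z : ℤ → ℂ) : Prop :=
  Summable fun k : ℤ => (1 + (k : ℝ) ^ 2) ^ s * ‖z k‖ ^ 2

/-- The norm of `H^s`, for sequences `z` with `MemH s z`. -/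
noncomputable def normH (s : ℝ) (z : ℤ → ℂ) : ℝ :=
  Real.sqrt (∑' k : ℤ, (1 + (k : ℝ) ^ 2) ^ s * ‖z k‖ ^ 2)

/-- The complex Fourier series with coefficients `z`. -/
noncomputable def fourierSeries (bc : BoundaryCondition) (L : ℝ) (z : ℤ → ℂ) (x : ℝ) : ℂ :=
  ∑' k : ℤ, z k * Complex.exp (Complex.I * ((bc.b * k * Real.pi * x / L : ℝ) : ℂ)) /
    ((Real.sqrt L : ℝ) : ℂ)

/-- The function `u` with Fourier coefficients `z`. For an admissible `z ∈ H^1` the series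
converges absolutely to a real number, and taking the real part changes nothing. -/
noncomputable def fourierFun (bc : BoundaryCondition) (L : ℝ) (z : ℤ → ℂ) (x : ℝ) : ℝ :=
  (fourierSeries bc L z x).re

/-- The potential energy `V[u] = ∫₀ᴸ (u'² / 2 + U(u))` in Fourier variables. It is used for
admissible `z ∈ H^1` only, where `u` is continuous and the series converges. -/
noncomputable def potential (bc : BoundaryCondition) (L : ℝ) (U : ℝ → ℝ) (z : ℤ → ℂ) : ℝ :=
  (1 / 2) * ∑' k : ℤ, nu bc L k * ‖z k‖ ^ 2 + ∫ x in (0 : ℝ)..L, U (fourierFun bc L z x)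

/-- The quadratic part of the potential. -/
noncomputable def potentialTwo (bc : BoundaryCondition) (L : ℝ) (z : ℤ → ℂ) : ℂ :=
  (1 / 2) * ∑' k : ℤ, (lam bc L k : ℂ) * z k * z (-k)

/-- The coefficient `C₄` of the resonant term. -/
noncomputable def coeffFour (bc : BoundaryCondition) (L a₃ a₄ : ℝ) : ℝ :=
  (3 / 2) * a₄ + 2 * a₃ ^ 2 * (1 / |lam bc L 0| - 1 / (2 * lam bc L 2))

/-- `J` is the matrix of partial derivatives `∂ g_k / ∂ z_l` at `z`. -/
def HasJacobianMatrix (g : (ℤ → ℂ) → (ℤ → ℂ)) (J : ℤ → ℤ → ℂ) (z : ℤ → ℂ) : Prop :=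
  ∀ k l : ℤ, HasDerivAt (fun w : ℂ => g (z + Pi.single l w) k) (J k l) 0

/-- `det (1 + A) = D` for an infinite matrix `A`: the determinants of `1 + A` restricted to
finite index sets `F ⊆ ℤ` converge to `D` along the directed set of all such `F`. -/
def HasDetOneAdd (A : ℤ → ℤ → ℂ) (D : ℂ) : Prop :=
  Tendsto (fun F : Finset ℤ => Matrix.det (1 + Matrix.of fun i j : F => A i j))
    atTop (𝓝 D)

/-- Up to a constant `C`, in a ball of `H^s`, the potential after the change of variables
`z ↦ z + g z` agrees with `V₂(z) + C₄ z₁² z₋₁²` to fifth order, for all `z` satisfying `P`. -/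
def NormalFormOn (bc : BoundaryCondition) (L : ℝ) (U : ℝ → ℝ) (a₃ a₄ s : ℝ)
    (g : (ℤ → ℂ) → (ℤ → ℂ)) (P : (ℤ → ℂ) → Prop) : Prop :=
  ∃ C > 0, ∃ δ > 0, ∀ z : ℤ → ℂ, Admissible bc z → MemH 1 z → normH s z ≤ δ → P z →
    ‖(potential bc L U (z + g z) : ℂ) -
        (potentialTwo bc L z + (coeffFour bc L a₃ a₄ : ℂ) * z 1 ^ 2 * z (-1) ^ 2)‖
      ≤ C * normH s z ^ 5

end NormalForm

/-! ### Infinite determinants by expansion into principal minors. -/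

namespace NormalForm

/-! Take `g = g₂ + g₃` (`nfTwo`, `nfThree`), homogeneous of degrees two and three, and sort the
potential at `z + g z` by degree. The cubic part is `(a₃/3) (z*z*z)₀ + ∑ λ_k (g₂)_k z_{-k}`. The
quartic part is `½ ∑ λ_k (g₂)_k (g₂)_{-k} + a₃ (z*z*g₂)₀ + (a₄/4) (z*z*z*z)₀ + ∑ λ_k (g₃)_k z_{-k}`.
So `g₂` must cancel the cubic form and `g₃` the quartic one, without dividing by `λ_{±1}`, which may
vanish. Each monomial is therefore shared equally among its indices other than `±1`. Three indices
from `±1` never have sum zero, so every cubic monomial can be removed (`cubic_identity`). Among the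
quartic ones exactly the arrangements of `(1, 1, -1, -1)` survive, and their coefficients add up to
`C₄` (`quarticForm_resonant`, `quartic_identity`).

The estimates rest on the factor `1/λ_k = O(1/(1 + k²))` in `g_k`. The convolutions behind it are
merely bounded in `k`: by Cauchy-Schwarz in the bilinear case, and in the trilinear case by Young's
inequality in `ℓ^{3/2}`, which contains `H^s` for `s > 1/6`. Hence `g z` is bounded in every `H^t`
with `t < 3/2`, and its Fourier series is bounded uniformly in `x`. The same argument bounds row `k`
of the Jacobian by a small multiple of `1/(1 + k²)`, uniformly in the column, and
`exists_hasDetOneAdd` turns such row bounds into convergence of the determinant.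

What remains after the two cancellations (`potential_sub_normalForm`) has degree at least five:
quadratic terms containing `g₃`, the rest of the cubic and quartic expansions, and the Taylor
remainder of `U`. Since `g` is uniformly small, only the integrals of powers of `|u_z|` matter, and
these are controlled by the embedding of `H^s` into `L^q` (`exists_integral_rpow_le`), proved with
dyadic blocks. -/

/-- By multilinearity in the rows, each row is taken either from the matrix or from the identity,
and the identity rows reduce the determinant to a principal minor. The summands no longer depend on
`F`, so the limit over `F` becomes an unconditional sum over finite sets. -/
theorem det_one_add_eq_sum_minors (A : ℤ → ℤ → ℂ) (F : Finset ℤ) :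
    Matrix.det (1 + Matrix.of fun i j : F => A i j) =
      ∑ S ∈ F.powerset, Matrix.det (Matrix.of fun i j : S => A i j) := by
  classical
  set M : Matrix F F ℂ := Matrix.of fun i j : F => A i j with hM
  have h1 : Matrix.det (1 + M) = ∑ s : Finset F, (M.submatrix (fun i : s => i.1) (fun i : s => i.1)).det := by
    rw [add_comm]
    have h := (Matrix.detRowAlternating (R := ℂ) (n := F)).map_add_univ M.row (1 : Matrix F F ℂ).row
    have h0 : Matrix.detRowAlternating (R := ℂ) (n := F) (M.row + (1 : Matrix F F ℂ).row)
      = Matrix.det (M + 1) := rfl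
    rw [← h0, h]
    exact Finset.sum_congr rfl fun s _ => Matrix.det_piecewise_one_eq_submatrix_det M s
  rw [h1]
  refine Finset.sum_bij (fun s _ => s.map (Function.Embedding.subtype _)) ?_ ?_ ?_ ?_
  · intro s _
    rw [Finset.mem_powerset]
    intro x hx
    simp only [Finset.mem_map, Function.Embedding.coe_subtype] at hx
    obtain ⟨y, _, rfl⟩ := hx
    exact y.2
  · intro s _ t _ h
    exact Finset.map_injective _ h
  · intro S hS
    refine ⟨S.subtype (· ∈ F), Finset.mem_univ _, ?_⟩
    rw [Finset.subtype_map]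
    exact Finset.filter_true_of_mem fun x hx => Finset.mem_powerset.1 hS hx
  · intro s _
    let e : s ≃ (s.map (Function.Embedding.subtype (· ∈ F)) : Finset ℤ) :=
      Equiv.ofBijective (fun i => ⟨i.1.1, Finset.mem_map_of_mem _ i.2⟩) (by
        refine ⟨fun i j h => ?_, ?_⟩
        · have h' : i.1.1 = j.1.1 := Subtype.mk.inj h
          exact Subtype.ext (Subtype.ext h')
        · rintro ⟨x, hx⟩
          obtain ⟨y, hy, rfl⟩ := Finset.mem_map.1 hx
          exact ⟨⟨y, hy⟩, rfl⟩)
    rw [← Matrix.det_submatrix_equiv_self e]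
    rfl

theorem norm_det_le_factorial_mul_prod (A : ℤ → ℤ → ℂ) (r : ℤ → ℝ)
    (hA : ∀ k l, ‖A k l‖ ≤ r k) (S : Finset ℤ) :
    ‖Matrix.det (Matrix.of fun i j : S => A i j)‖ ≤ (S.card.factorial : ℝ) * ∏ k ∈ S, r k := by
  classical
  -- After transposing, each Leibniz product contains one entry from every row `i`, which is where
  -- the row bound applies.
  rw [← Matrix.det_transpose, Matrix.det_apply]
  refine (norm_sum_le _ _).trans ?_
  have : ∀ σ ∈ (Finset.univ : Finset (Equiv.Perm S)),
      ‖Equiv.Perm.sign σ • ∏ i, (Matrix.of fun i j : S => A i j).transpose (σ i) i‖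
        ≤ ∏ k ∈ S, r k := by
    intro σ _
    have h1 : ‖Equiv.Perm.sign σ • ∏ i, (Matrix.of fun i j : S => A i j).transpose (σ i) i‖
        = ∏ i : S, ‖A i (σ i)‖ := by
      rcases Int.units_eq_one_or (Equiv.Perm.sign σ) with h | h <;> rw [h] <;>
        simp [Matrix.transpose_apply]
    rw [h1, ← Finset.prod_coe_sort S]
    exact Finset.prod_le_prod (fun _ _ => norm_nonneg _) fun i _ => hA _ _
  refine (Finset.sum_le_sum this).trans (le_of_eq ?_)
  simp [Fintype.card_perm]

/-- Only `m = 0` is wanted, where the weight is `S.card !` and the bound is the geometric series.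
Adding an element to `S` turns the rising factorial from `m + 1` into `m + 1` times the one from `m
+ 2`, so the induction needs all `m` at once. -/
theorem sum_powerset_ascFactorial_mul_prod_le (r : ℤ → ℝ) (hr : ∀ k, 0 ≤ r k) (F : Finset ℤ) :
    ∑ k ∈ F, r k < 1 → ∀ m : ℕ,
    ∑ S ∈ F.powerset, ((m + 1).ascFactorial S.card : ℝ) * ∏ k ∈ S, r k
      ≤ (1 / (1 - ∑ k ∈ F, r k)) ^ (m + 1) := by
  classical
  induction F using Finset.induction_on with
  | empty => intro _ m; simp
  | insert a F ha ih =>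
    intro h m
    rw [Finset.sum_insert ha] at h
    have hR : ∑ k ∈ F, r k < 1 := by linarith [hr a]
    have hR0 : 0 ≤ ∑ k ∈ F, r k := Finset.sum_nonneg fun k _ => hr k
    rw [Finset.sum_powerset_insert ha, Finset.sum_insert ha]
    have h2 : ∑ S ∈ F.powerset, ((m + 1).ascFactorial (insert a S).card : ℝ) * ∏ k ∈ insert a S, r k
        = r a * (m + 1) * ∑ S ∈ F.powerset, ((m + 1 + 1).ascFactorial S.card : ℝ) * ∏ k ∈ S, r k := by
      rw [Finset.mul_sum]
      refine Finset.sum_congr rfl fun S hS => ?_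
      have haS : a ∉ S := fun h => ha (Finset.mem_powerset.1 hS h)
      rw [Finset.card_insert_of_notMem haS, Finset.prod_insert haS]
      have := Nat.succ_ascFactorial (m + 1) S.card
      have h3 : (m + 1).ascFactorial (S.card + 1) = (m + 1) * (m + 1 + 1).ascFactorial S.card := by
        rw [Nat.ascFactorial_succ]
        simpa using this.symm
      rw [h3]; push_cast; ring
    rw [h2]
    have i1 := ih hR m
    have i2 := ih hR (m + 1)
    set R := ∑ k ∈ F, r k
    set x := 1 / (1 - R) with hx
    have hx0 : 0 < x := by rw [hx]; apply one_div_pos.2; linarith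
    -- With `y = r a * x` this is `(1 + y) (1 - y) ≤ 1`; Bernoulli's inequality then supplies the
    -- power `m + 1`.
    have hy : x * (1 + r a * x) ≤ 1 / (1 - (r a + R)) := by
      have e1 : 1 - (r a + R) > 0 := by linarith
      rw [le_div_iff₀ e1]
      have e3 : x * (1 - (r a + R)) = 1 - r a * x := by
        have : x * (1 - R) = 1 := by rw [hx]; exact one_div_mul_cancel (by linarith)
        nlinarith
      calc x * (1 + r a * x) * (1 - (r a + R)) = (1 + r a * x) * (x * (1 - (r a + R))) := by ring
        _ = 1 - (r a * x) ^ 2 := by rw [e3]; ring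
        _ ≤ 1 := by nlinarith [sq_nonneg (r a * x)]
    have hra : 0 ≤ r a * x := mul_nonneg (hr a) hx0.le
    calc _ ≤ x ^ (m + 1) + r a * (m + 1) * x ^ (m + 1 + 1) := by
            gcongr
            exact mul_nonneg (hr a) (by positivity)
      _ = x ^ (m + 1) * (1 + ((m + 1 : ℕ) : ℝ) * (r a * x)) := by push_cast; ring
      _ ≤ x ^ (m + 1) * (1 + r a * x) ^ (m + 1) := by
            gcongr
            exact one_add_mul_le_pow (by linarith) _
      _ = (x * (1 + r a * x)) ^ (m + 1) := by rw [mul_pow]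
      _ ≤ _ := by gcongr

/-- The infinite determinant of `1 + A` exists when the rows of `A` are bounded by the entries of
a small summable sequence. -/
theorem exists_hasDetOneAdd (A : ℤ → ℤ → ℂ) (r : ℤ → ℝ) (hA : ∀ k l, ‖A k l‖ ≤ r k)
    (hs : Summable r) (hsmall : ∑' k, r k ≤ 1 / 2) :
    ∃ D : ℂ, HasDetOneAdd A D ∧ ‖D - 1‖ ≤ 2 * ∑' k, r k := by
  classical
  have hr : ∀ k, 0 ≤ r k := fun k => (norm_nonneg _).trans (hA k 0)
  set R := ∑' k, r k with hRdef
  have hR0 : 0 ≤ R := tsum_nonneg hr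
  set d : Finset ℤ → ℂ := fun S => Matrix.det (Matrix.of fun i j : S => A i j) with hd
  set w : Finset ℤ → ℝ := fun S => (S.card.factorial : ℝ) * ∏ k ∈ S, r k with hw
  have hw0 : ∀ S, 0 ≤ w S := fun S => mul_nonneg (by positivity) (Finset.prod_nonneg fun k _ => hr k)
  have hdw : ∀ S, ‖d S‖ ≤ w S := norm_det_le_factorial_mul_prod A r hA
  have hpow : ∀ F : Finset ℤ, ∑ S ∈ F.powerset, w S ≤ 1 + 2 * R := by
    intro F
    have hF : ∑ k ∈ F, r k ≤ R := hs.sum_le_tsum F fun k _ => hr k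
    have h := sum_powerset_ascFactorial_mul_prod_le r hr F (by linarith) 0
    simp only [zero_add, Nat.one_ascFactorial, pow_one] at h
    refine h.trans ?_
    have hpos : 0 < 1 - ∑ k ∈ F, r k := by linarith
    -- The inequality `1 / (1 - x) ≤ 1 + 2 x` for `0 ≤ x ≤ 1/2`; here `hsmall` enters.
    rw [div_le_iff₀ hpos]
    nlinarith [Finset.sum_nonneg fun k (_ : k ∈ F) => hr k]
  have hwsum : Summable w := by
    refine summable_of_sum_le hw0 (c := 1 + 2 * R) fun T => ?_
    -- A finite family of finite sets lies in the power set of its union, so bounds over power sets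
    -- suffice.
    refine (Finset.sum_le_sum_of_subset_of_nonneg (t := (T.biUnion id).powerset) ?_ ?_).trans
      (hpow _)
    · intro S hS
      exact Finset.mem_powerset.2 (Finset.subset_biUnion_of_mem id hS)
    · intro S _ _; exact hw0 S
  have hdsum : Summable d := Summable.of_norm_bounded hwsum hdw
  have hdet : ∀ F : Finset ℤ, Matrix.det (1 + Matrix.of fun i j : F => A i j)
      = ∑ S ∈ F.powerset, d S := det_one_add_eq_sum_minors A
  have hlim : HasDetOneAdd A (∑' S, d S) := by
    unfold HasDetOneAdd
    simp_rw [hdet]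
    exact hdsum.hasSum.comp tendsto_finset_powerset_atTop_atTop
  refine ⟨_, hlim, ?_⟩
  refine le_of_tendsto' ((hlim.sub_const 1).norm) fun F => ?_
  rw [hdet]
  have hempty : (∅ : Finset ℤ) ∈ F.powerset := Finset.empty_mem_powerset F
  have hd0 : d ∅ = 1 := by simp [hd]
  have hw0' : w ∅ = 1 := by simp [hw]
  rw [← Finset.add_sum_erase _ _ hempty, hd0, add_sub_cancel_left]
  have h := hpow F
  rw [← Finset.add_sum_erase _ _ hempty, hw0'] at h
  exact (norm_sum_le _ _).trans ((Finset.sum_le_sum fun S _ => hdw S).trans (by linarith))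

end NormalForm

/-! ### The weighted sequence spaces `H^s`. -/

namespace NormalForm

theorem one_add_sq_pos (k : ℤ) : (0 : ℝ) < 1 + (k : ℝ) ^ 2 := by positivity

theorem one_le_one_add_sq (k : ℤ) : (1 : ℝ) ≤ 1 + (k : ℝ) ^ 2 := by nlinarith [sq_nonneg (k : ℝ)]

/-- The weight `(1 + k²)⁻¹`, which is comparable to `1 / λ_k`. -/
noncomputable def rho (k : ℤ) : ℝ := (1 + (k : ℝ) ^ 2)⁻¹

theorem rho_pos (k : ℤ) : 0 < rho k := inv_pos.2 (one_add_sq_pos k)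

theorem rho_le_one (k : ℤ) : rho k ≤ 1 := inv_le_one_of_one_le₀ (one_le_one_add_sq k)

theorem summable_one_add_sq_rpow {p : ℝ} (hp : p < -(1 / 2)) :
    Summable fun k : ℤ => (1 + (k : ℝ) ^ 2) ^ p := by
  have h := Real.summable_abs_int_rpow (b := -(2 * p)) (by linarith)
  refine Summable.of_norm_bounded_eventually (g := fun n : ℤ => |(n : ℝ)| ^ (-(-(2 * p)))) h ?_
  have : ({0}ᶜ : Set ℤ) ∈ cofinite := (Set.finite_singleton 0).compl_mem_cofinite
  filter_upwards [this] with k hk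
  have hk0 : (0 : ℝ) < |(k : ℝ)| := abs_pos.2 (by exact_mod_cast hk)
  rw [Real.norm_of_nonneg (Real.rpow_nonneg (one_add_sq_pos k).le _), neg_neg,
    Real.rpow_mul hk0.le, Real.rpow_two, sq_abs]
  exact Real.rpow_le_rpow_of_nonpos (by rw [← sq_abs]; positivity) (by linarith) (by linarith)

theorem summable_rho : Summable rho := by
  refine (summable_one_add_sq_rpow (p := -1) (by norm_num)).congr fun k => ?_
  rw [Real.rpow_neg_one]; rfl

section Norms

variable {s t : ℝ} {z : ℤ → ℂ}

theorem normH_nonneg (s : ℝ) (z : ℤ → ℂ) : 0 ≤ normH s z := Real.sqrt_nonneg _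

theorem weight_nonneg (s : ℝ) (z : ℤ → ℂ) (k : ℤ) : 0 ≤ (1 + (k : ℝ) ^ 2) ^ s * ‖z k‖ ^ 2 :=
  mul_nonneg (Real.rpow_nonneg (one_add_sq_pos k).le _) (sq_nonneg _)

theorem normH_sq (s : ℝ) (z : ℤ → ℂ) :
    normH s z ^ 2 = ∑' k : ℤ, (1 + (k : ℝ) ^ 2) ^ s * ‖z k‖ ^ 2 :=
  Real.sq_sqrt (tsum_nonneg (weight_nonneg s z))

theorem MemH.mono (h : MemH s z) (hts : t ≤ s) : MemH t z := by
  refine Summable.of_nonneg_of_le (weight_nonneg t z) (fun k => ?_) h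
  gcongr
  exact one_le_one_add_sq k

theorem sq_le_weight (hs : 0 ≤ s) (k : ℤ) : ‖z k‖ ^ 2 ≤ (1 + (k : ℝ) ^ 2) ^ s * ‖z k‖ ^ 2 :=
  le_mul_of_one_le_left (sq_nonneg _) (Real.one_le_rpow (one_le_one_add_sq k) hs)

theorem MemH.summable_sq (hs : 0 ≤ s) (h : MemH s z) : Summable fun k => ‖z k‖ ^ 2 :=
  Summable.of_nonneg_of_le (fun _ => sq_nonneg _) (sq_le_weight hs) h

theorem MemH.tsum_sq_le (hs : 0 ≤ s) (h : MemH s z) : ∑' k, ‖z k‖ ^ 2 ≤ normH s z ^ 2 := by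
  rw [normH_sq]
  exact (h.summable_sq hs).tsum_le_tsum (sq_le_weight hs) h

theorem MemH.norm_le (hs : 0 ≤ s) (h : MemH s z) (k : ℤ) : ‖z k‖ ≤ normH s z := by
  refine (sq_le_sq₀ (norm_nonneg _) (normH_nonneg _ _)).1 ?_
  exact ((h.summable_sq hs).le_tsum k fun _ _ => sq_nonneg _).trans (h.tsum_sq_le hs)

theorem MemH.eq_zero_of_normH_eq_zero (hs : 0 ≤ s) (h : MemH s z) (h0 : normH s z = 0) (k : ℤ) :
    z k = 0 := norm_le_zero_iff.1 (h0 ▸ h.norm_le hs k)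

/-- A pointwise form of Hölder's inequality for the embedding of `H^s` into `ℓ^{3/2}`: it is `b³ ≤
b⁴ + 1` with `b = W √‖z k‖ / √N`, where `W` is the weight and `N` the norm. The last term is
summable in `k` exactly when `s > 1/6`. -/
theorem sqrt_cube_le (hs : 0 ≤ s) (h : MemH s z) (k : ℤ) :
    Real.sqrt ‖z k‖ ^ 3 ≤ Real.sqrt (normH s z) ^ 3 *
      ((1 + (k : ℝ) ^ 2) ^ s * ‖z k‖ ^ 2 / normH s z ^ 2 + (1 + (k : ℝ) ^ 2) ^ (-(3 * s))) := by
  have hW : 0 < (1 + (k : ℝ) ^ 2) ^ s := Real.rpow_pos_of_pos (one_add_sq_pos k) _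
  have hW3 : (1 + (k : ℝ) ^ 2) ^ (-(3 * s)) = (((1 + (k : ℝ) ^ 2) ^ s) ^ 3)⁻¹ := by
    rw [Real.rpow_neg (one_add_sq_pos k).le, mul_comm 3 s, Real.rpow_mul (one_add_sq_pos k).le]
    norm_num
  rw [hW3]
  set W := (1 + (k : ℝ) ^ 2) ^ s
  rcases eq_or_lt_of_le (normH_nonneg s z) with h0 | h0
  · rw [h.eq_zero_of_normH_eq_zero hs h0.symm]
    simp [← h0]
  set N := normH s z
  obtain ⟨n, hn, hN⟩ : ∃ n, 0 < n ∧ N = n ^ 2 := ⟨√N, Real.sqrt_pos.2 h0, (Real.sq_sqrt h0.le).symm⟩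
  obtain ⟨a, ha, hA⟩ : ∃ a, 0 ≤ a ∧ ‖z k‖ = a ^ 2 :=
    ⟨√‖z k‖, Real.sqrt_nonneg _, (Real.sq_sqrt (norm_nonneg _)).symm⟩
  rw [hA, hN, Real.sqrt_sq ha, Real.sqrt_sq hn.le]
  have key : ∀ b : ℝ, 0 ≤ b → b ^ 3 ≤ b ^ 4 + 1 := fun b hb => by
    nlinarith [sq_nonneg (b ^ 2 - b / 2), sq_nonneg (b / 2 - 1), sq_nonneg b]
  have hk := key (W * a / n) (by positivity)
  have e1 : a ^ 3 = n ^ 3 * (W ^ 3)⁻¹ * (W * a / n) ^ 3 := by field_simp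
  have e2 : n ^ 3 * (W * (a ^ 2) ^ 2 / (n ^ 2) ^ 2 + (W ^ 3)⁻¹)
      = n ^ 3 * (W ^ 3)⁻¹ * ((W * a / n) ^ 4 + 1) := by field_simp
  rw [e1, e2]
  exact mul_le_mul_of_nonneg_left hk (by positivity)

theorem MemH.summable_sqrt_cube (hs : 1 / 6 < s) (h : MemH s z) :
    Summable fun k => Real.sqrt ‖z k‖ ^ 3 :=
  Summable.of_nonneg_of_le (fun _ => by positivity) (sqrt_cube_le (by linarith) h)
    (((Summable.div_const h _).add (summable_one_add_sq_rpow (by linarith))).mul_left _)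

theorem MemH.sq_tsum_sqrt_cube_le (hs : 1 / 6 < s) (h : MemH s z) :
    (∑' k, Real.sqrt ‖z k‖ ^ 3) ^ 2
      ≤ (1 + ∑' k : ℤ, (1 + (k : ℝ) ^ 2) ^ (-(3 * s))) ^ 2 * normH s z ^ 3 := by
  have hsum := summable_one_add_sq_rpow (p := -(3 * s)) (by linarith)
  have h1 : ∑' k, Real.sqrt ‖z k‖ ^ 3
      ≤ Real.sqrt (normH s z) ^ 3 * (1 + ∑' k : ℤ, (1 + (k : ℝ) ^ 2) ^ (-(3 * s))) := by
    refine ((h.summable_sqrt_cube hs).tsum_le_tsum (sqrt_cube_le (by linarith) h)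
      (((Summable.div_const h _).add hsum).mul_left _)).trans ?_
    rw [tsum_mul_left, (Summable.div_const h _).tsum_add hsum, tsum_div_const, ← normH_sq]
    gcongr
    -- The inequality also covers norm zero, where the quotient is `0`.
    exact div_self_le_one _
  have h0 : 0 ≤ ∑' k, Real.sqrt ‖z k‖ ^ 3 := tsum_nonneg fun _ => by positivity
  refine (pow_le_pow_left₀ h0 h1 2).trans (le_of_eq ?_)
  have : normH s z = √(normH s z) ^ 2 := (Real.sq_sqrt (normH_nonneg _ _)).symm
  rw [mul_pow]
  nth_rewrite 2 [this]
  ring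

theorem MemH.summable_norm (hs : 1 / 2 < s) (h : MemH s z) : Summable fun k => ‖z k‖ := by
  refine Summable.of_nonneg_of_le (fun _ => norm_nonneg _) (fun k => ?_)
    (Summable.add h (summable_one_add_sq_rpow (p := -s) (by linarith)))
  have hW : 0 < (1 + (k : ℝ) ^ 2) ^ s := Real.rpow_pos_of_pos (one_add_sq_pos k) _
  rw [Real.rpow_neg (one_add_sq_pos k).le]
  set W := (1 + (k : ℝ) ^ 2) ^ s
  have e : W * ‖z k‖ ^ 2 + W⁻¹ = W⁻¹ * ((W * ‖z k‖) ^ 2 + 1) := by field_simp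
  have e1 : ‖z k‖ = W⁻¹ * (W * ‖z k‖) := by field_simp
  rw [e]
  nth_rewrite 1 [e1]
  exact mul_le_mul_of_nonneg_left (by nlinarith [sq_nonneg (W * ‖z k‖ - 1)]) (by positivity)

theorem weight_le_of_norm_le_rho {g : ℤ → ℂ} {B : ℝ} (hg : ∀ k, ‖g k‖ ≤ B * rho k) (k : ℤ) :
    (1 + (k : ℝ) ^ 2) ^ t * ‖g k‖ ^ 2 ≤ B ^ 2 * (1 + (k : ℝ) ^ 2) ^ (t - 2) := by
  have e : (1 + (k : ℝ) ^ 2) ^ (t - 2) = (1 + (k : ℝ) ^ 2) ^ t * rho k ^ 2 := by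
    rw [Real.rpow_sub (one_add_sq_pos k), Real.rpow_two, rho, div_eq_mul_inv, inv_pow]
  rw [e]
  calc _ ≤ (1 + (k : ℝ) ^ 2) ^ t * (B * rho k) ^ 2 :=
        mul_le_mul_of_nonneg_left (pow_le_pow_left₀ (norm_nonneg _) (hg k) 2)
          (Real.rpow_nonneg (one_add_sq_pos k).le _)
    _ = _ := by ring

/-- The exponent `t - 2` is summable below `-1/2`. All bounds on the transformation have this form,
so this is the source of its smoothing. -/
theorem memH_of_norm_le_rho {g : ℤ → ℂ} {B : ℝ} (hg : ∀ k, ‖g k‖ ≤ B * rho k) (ht : t < 3 / 2) :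
    MemH t g :=
  Summable.of_nonneg_of_le (weight_nonneg t g) (weight_le_of_norm_le_rho hg)
    ((summable_one_add_sq_rpow (by linarith)).mul_left _)

theorem normH_le_of_norm_le_rho {g : ℤ → ℂ} {B : ℝ} (hB : 0 ≤ B) (hg : ∀ k, ‖g k‖ ≤ B * rho k)
    (ht : t < 3 / 2) :
    normH t g ≤ B * √(∑' k : ℤ, (1 + (k : ℝ) ^ 2) ^ (t - 2)) := by
  rw [normH]
  refine Real.sqrt_le_iff.2 ⟨by positivity, ?_⟩
  rw [mul_pow, Real.sq_sqrt (tsum_nonneg fun k => Real.rpow_nonneg (one_add_sq_pos k).le _),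
    ← tsum_mul_left]
  exact (memH_of_norm_le_rho hg ht).tsum_le_tsum (weight_le_of_norm_le_rho hg)
    ((summable_one_add_sq_rpow (by linarith)).mul_left _)

end Norms

/-- The cyclic permutation of the triples of integers with sum `k`. -/
@[simps]
def rotTwo (k : ℤ) : ℤ × ℤ ≃ ℤ × ℤ where
  toFun p := (p.2, k - p.1 - p.2)
  invFun p := (k - p.1 - p.2, p.1)
  left_inv p := by ext <;> simp
  right_inv p := by ext <;> simp; ring

/-! ### Bilinear and trilinear convolutions and their derivatives. -/

section Convolutions

/-- Sequences for which all bilinear and trilinear convolutions converge absolutely. -/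
structure Tame (z : ℤ → ℂ) : Prop where
  sq : Summable fun k => ‖z k‖ ^ 2
  cube : Summable fun k => Real.sqrt ‖z k‖ ^ 3

theorem MemH.tame {s : ℝ} {z : ℤ → ℂ} (hs : 1 / 6 < s) (h : MemH s z) : Tame z :=
  ⟨h.summable_sq (by linarith), h.summable_sqrt_cube hs⟩

theorem tame_single (l : ℤ) : Tame (Pi.single l 1) := by
  constructor
  · refine summable_of_ne_finset_zero (s := {l}) fun k hk => ?_
    simp [Finset.mem_singleton.not.1 hk]
  · refine summable_of_ne_finset_zero (s := {l}) fun k hk => ?_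
    simp [Finset.mem_singleton.not.1 hk]

variable {x y w z : ℤ → ℂ}

theorem summable_mul_norm (hx : Summable fun k => ‖x k‖ ^ 2) (hy : Summable fun k => ‖y k‖ ^ 2)
    (k : ℤ) : Summable fun j => ‖x j‖ * ‖y (k - j)‖ := by
  have hy' : Summable fun j => ‖y (k - j)‖ ^ 2 := hy.comp_injective (Equiv.subLeft k).injective
  refine Summable.of_nonneg_of_le (fun _ => by positivity) (fun j => ?_) (hx.add hy')
  nlinarith [sq_nonneg (‖x j‖ - ‖y (k - j)‖), sq_nonneg (‖x j‖), sq_nonneg ‖y (k - j)‖]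

theorem tsum_mul_norm_le (hz : Summable fun k => ‖z k‖ ^ 2) (k : ℤ) :
    ∑' j, ‖z j‖ * ‖z (k - j)‖ ≤ ∑' j, ‖z j‖ ^ 2 := by
  have hz' : Summable fun j => ‖z (k - j)‖ ^ 2 := hz.comp_injective (Equiv.subLeft k).injective
  have e : ∑' j, ‖z (k - j)‖ ^ 2 = ∑' j, ‖z j‖ ^ 2 :=
    (Equiv.subLeft k).tsum_eq fun j => ‖z j‖ ^ 2
  calc ∑' j, ‖z j‖ * ‖z (k - j)‖ ≤ ∑' j, (‖z j‖ ^ 2 + ‖z (k - j)‖ ^ 2) / 2 :=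
        (summable_mul_norm hz hz k).tsum_le_tsum
          (fun j => by nlinarith [sq_nonneg (‖z j‖ - ‖z (k - j)‖)]) ((hz.add hz').div_const 2)
    _ = _ := by rw [tsum_div_const, hz.tsum_add hz', e]; ring

/-- The arithmetic-geometric mean inequality for `√a√b`, `√b√c`, `√c√a`. It bounds a trilinear term
by products of two `3/2` powers, and so yields Young's inequality from `ℓ^{3/2}` to `ℓ^∞`. -/
theorem mul_le_sqrt_cube {a b c : ℝ} (ha : 0 ≤ a) (hb : 0 ≤ b) (hc : 0 ≤ c) :
    a * b * c ≤ (√a ^ 3 * √b ^ 3 + √b ^ 3 * √c ^ 3 + √c ^ 3 * √a ^ 3) / 3 := by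
  obtain ⟨α, hα, rfl⟩ : ∃ α, 0 ≤ α ∧ a = α ^ 2 := ⟨√a, Real.sqrt_nonneg _, (Real.sq_sqrt ha).symm⟩
  obtain ⟨β, hβ, rfl⟩ : ∃ α, 0 ≤ α ∧ b = α ^ 2 := ⟨√b, Real.sqrt_nonneg _, (Real.sq_sqrt hb).symm⟩
  obtain ⟨γ, hγ, rfl⟩ : ∃ α, 0 ≤ α ∧ c = α ^ 2 := ⟨√c, Real.sqrt_nonneg _, (Real.sq_sqrt hc).symm⟩
  rw [Real.sqrt_sq hα, Real.sqrt_sq hβ, Real.sqrt_sq hγ]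
  have key : ∀ p q r : ℝ, 0 ≤ p → 0 ≤ q → 0 ≤ r → p * q * r ≤ (p ^ 3 + q ^ 3 + r ^ 3) / 3 := by
    intro p q r hp hq hr
    nlinarith [mul_nonneg (add_nonneg (add_nonneg hp hq) hr)
      (add_nonneg (add_nonneg (sq_nonneg (p - q)) (sq_nonneg (q - r))) (sq_nonneg (r - p)))]
  have := key (α * β) (β * γ) (γ * α) (by positivity) (by positivity) (by positivity)
  calc α ^ 2 * β ^ 2 * γ ^ 2 = α * β * (β * γ) * (γ * α) := by ring
    _ ≤ _ := this
    _ = _ := by ring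

theorem summable_sqrt_cube_mul (hx : Tame x) (hy : Tame y) :
    Summable fun p : ℤ × ℤ => √‖x p.1‖ ^ 3 * √‖y p.2‖ ^ 3 := by
  have h := Summable.mul_of_nonneg hx.cube hy.cube (fun k => pow_nonneg (Real.sqrt_nonneg _) 3)
    (fun k => pow_nonneg (Real.sqrt_nonneg _) 3)
  exact h

theorem summable_triple (hx : Tame x) (hy : Tame y) (hw : Tame w) (k : ℤ) :
    Summable fun p : ℤ × ℤ => ‖x p.1‖ * ‖y p.2‖ * ‖w (k - p.1 - p.2)‖ := by
  have h : ∀ {u v : ℤ → ℂ}, Tame u → Tame v →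
      Summable fun p : ℤ × ℤ => √‖u p.1‖ ^ 3 * √‖v p.2‖ ^ 3 := fun hu hv =>
    summable_sqrt_cube_mul hu hv
  have h1 := h hx hy
  have h2 := (h hy hw).comp_injective (rotTwo k).injective
  have h3 := (h hw hx).comp_injective ((rotTwo k).trans (rotTwo k)).injective
  refine Summable.of_nonneg_of_le (fun _ => by positivity) (fun p => ?_)
    (((h1.add h2).add h3).div_const 3)
  have := mul_le_sqrt_cube (norm_nonneg (x p.1)) (norm_nonneg (y p.2))
    (norm_nonneg (w (k - p.1 - p.2)))
  simpa using this

/-- After `mul_le_sqrt_cube` each of the three sums involves only two of the three indices, and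
`rotTwo` makes these two independent summation variables; each sum then factors into a square. -/
theorem tsum_triple_le (hz : Tame z) (k : ℤ) :
    ∑' p : ℤ × ℤ, ‖z p.1‖ * ‖z p.2‖ * ‖z (k - p.1 - p.2)‖ ≤ (∑' j, √‖z j‖ ^ 3) ^ 2 := by
  set f : ℤ × ℤ → ℝ := fun p => √‖z p.1‖ ^ 3 * √‖z p.2‖ ^ 3 with hf
  have hfs : Summable f := summable_sqrt_cube_mul hz hz
  have h1 : Summable fun p => f (rotTwo k p) := hfs.comp_injective (rotTwo k).injective
  have h2 : Summable fun p => f (((rotTwo k).trans (rotTwo k)) p) :=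
    hfs.comp_injective ((rotTwo k).trans (rotTwo k)).injective
  have e : ∑' p, f p = (∑' j, √‖z j‖ ^ 3) ^ 2 := by
    rw [sq]
    exact (hz.cube.tsum_mul_tsum hz.cube hfs).symm
  calc _ ≤ ∑' p, (f p + f (rotTwo k p) + f ((rotTwo k).trans (rotTwo k) p)) / 3 := by
        refine (summable_triple hz hz hz k).tsum_le_tsum (fun p => ?_)
          (((hfs.add h1).add h2).div_const 3)
        simpa [hf] using mul_le_sqrt_cube (norm_nonneg (z p.1)) (norm_nonneg (z p.2))
          (norm_nonneg (z (k - p.1 - p.2)))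
    _ = _ := by
        rw [tsum_div_const, Summable.tsum_add (hfs.add h1) h2, Summable.tsum_add hfs h1,
          Equiv.tsum_eq (rotTwo k) f, Equiv.tsum_eq ((rotTwo k).trans (rotTwo k)) f, e]
        ring

/-- Convolution with a kernel. -/
noncomputable def biConv (K : ℤ → ℤ → ℝ) (x y : ℤ → ℂ) (k : ℤ) : ℂ :=
  ∑' j, (K j (k - j) : ℂ) * x j * y (k - j)

/-- Threefold convolution with a kernel. -/
noncomputable def triConv (K : ℤ → ℤ → ℤ → ℝ) (x y w : ℤ → ℂ) (k : ℤ) : ℂ :=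
  ∑' p : ℤ × ℤ, (K p.1 p.2 (k - p.1 - p.2) : ℂ) * x p.1 * y p.2 * w (k - p.1 - p.2)

variable {K : ℤ → ℤ → ℝ} {T : ℤ → ℤ → ℤ → ℝ} {M : ℝ}

theorem norm_biConv_term_le (hK : ∀ i j, |K i j| ≤ M) (x y : ℤ → ℂ) (k j : ℤ) :
    ‖(K j (k - j) : ℂ) * x j * y (k - j)‖ ≤ M * (‖x j‖ * ‖y (k - j)‖) := by
  rw [norm_mul, norm_mul, Complex.norm_real, Real.norm_eq_abs, mul_assoc]
  exact mul_le_mul_of_nonneg_right (hK _ _) (by positivity)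

theorem norm_triConv_term_le (hT : ∀ i j l, |T i j l| ≤ M) (x y w : ℤ → ℂ) (k : ℤ) (p : ℤ × ℤ) :
    ‖(T p.1 p.2 (k - p.1 - p.2) : ℂ) * x p.1 * y p.2 * w (k - p.1 - p.2)‖
      ≤ M * (‖x p.1‖ * ‖y p.2‖ * ‖w (k - p.1 - p.2)‖) := by
  rw [norm_mul, norm_mul, norm_mul, Complex.norm_real, Real.norm_eq_abs, mul_assoc, mul_assoc,
    mul_assoc]
  exact mul_le_mul_of_nonneg_right (hT _ _ _) (by positivity)

theorem summable_biConv (hK : ∀ i j, |K i j| ≤ M) (hx : Tame x) (hy : Tame y) (k : ℤ) :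
    Summable fun j => (K j (k - j) : ℂ) * x j * y (k - j) :=
  Summable.of_norm_bounded ((summable_mul_norm hx.sq hy.sq k).mul_left M)
    (norm_biConv_term_le hK x y k)

theorem summable_triConv (hT : ∀ i j l, |T i j l| ≤ M) (hx : Tame x) (hy : Tame y) (hw : Tame w)
    (k : ℤ) :
    Summable fun p : ℤ × ℤ => (T p.1 p.2 (k - p.1 - p.2) : ℂ) * x p.1 * y p.2 *
      w (k - p.1 - p.2) :=
  Summable.of_norm_bounded ((summable_triple hx hy hw k).mul_left M)
    (norm_triConv_term_le hT x y w k)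

theorem norm_biConv_le (hK : ∀ i j, |K i j| ≤ M) (hz : Tame z) (k : ℤ) :
    ‖biConv K z z k‖ ≤ M * ∑' j, ‖z j‖ ^ 2 := by
  have hM : 0 ≤ M := (abs_nonneg _).trans (hK 0 0)
  refine (tsum_of_norm_bounded ((summable_mul_norm hz.sq hz.sq k).mul_left M).hasSum
    (norm_biConv_term_le hK z z k)).trans ?_
  rw [tsum_mul_left]
  exact mul_le_mul_of_nonneg_left (tsum_mul_norm_le hz.sq k) hM

theorem norm_triConv_le (hT : ∀ i j l, |T i j l| ≤ M) (hz : Tame z) (k : ℤ) :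
    ‖triConv T z z z k‖ ≤ M * (∑' j, √‖z j‖ ^ 3) ^ 2 := by
  have hM : 0 ≤ M := (abs_nonneg _).trans (hT 0 0 0)
  refine (tsum_of_norm_bounded ((summable_triple hz hz hz k).mul_left M).hasSum
    (norm_triConv_term_le hT z z z k)).trans ?_
  rw [tsum_mul_left]
  exact mul_le_mul_of_nonneg_left (tsum_triple_le hz k) hM

theorem hasDerivAt_cubic_zero (a b c d : ℂ) :
    HasDerivAt (fun w : ℂ => a + w * b + w ^ 2 * c + w ^ 3 * d) b 0 := by
  have h := ((((hasDerivAt_id' (0 : ℂ)).mul_const b).const_add a).fun_add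
    ((hasDerivAt_pow 2 (0 : ℂ)).mul_const c)).fun_add ((hasDerivAt_pow 3 (0 : ℂ)).mul_const d)
  simpa using h

/-- Along a line the convolution is a polynomial in `c`, by splitting absolutely convergent sums;
the derivative is its linear coefficient. -/
theorem hasDerivAt_biConv (hK : ∀ i j, |K i j| ≤ M) (hz : Tame z) (hx : Tame x) (k : ℤ) :
    HasDerivAt (fun c : ℂ => biConv K (z + c • x) (z + c • x) k)
      (biConv K x z k + biConv K z x k) 0 := by
  have e : (fun c : ℂ => biConv K (z + c • x) (z + c • x) k) = fun c =>
      biConv K z z k + c * (biConv K x z k + biConv K z x k) + c ^ 2 * biConv K x x k := by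
    funext c
    have h1 := summable_biConv hK hz hz k
    have h2 := summable_biConv hK hx hz k
    have h3 := summable_biConv hK hz hx k
    have h4 := summable_biConv hK hx hx k
    unfold biConv
    rw [← h2.tsum_add h3, ← tsum_mul_left, ← tsum_mul_left,
      ← h1.tsum_add ((h2.add h3).mul_left c),
      ← (h1.add ((h2.add h3).mul_left c)).tsum_add (h4.mul_left (c ^ 2))]
    refine tsum_congr fun j => ?_
    simp only [Pi.add_apply, Pi.smul_apply, smul_eq_mul]
    ring
  rw [e]
  simpa using hasDerivAt_cubic_zero (biConv K z z k) _ (biConv K x x k) 0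

theorem hasDerivAt_triConv (hT : ∀ i j l, |T i j l| ≤ M) (hz : Tame z) (hx : Tame x) (k : ℤ) :
    HasDerivAt (fun c : ℂ => triConv T (z + c • x) (z + c • x) (z + c • x) k)
      (triConv T x z z k + triConv T z x z k + triConv T z z x k) 0 := by
  have e : (fun c : ℂ => triConv T (z + c • x) (z + c • x) (z + c • x) k) = fun c =>
      triConv T z z z k + c * (triConv T x z z k + triConv T z x z k + triConv T z z x k)
      + c ^ 2 * (triConv T z x x k + triConv T x z x k + triConv T x x z k)
      + c ^ 3 * triConv T x x x k := by
    funext c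
    have h0 := summable_triConv hT hz hz hz k
    have h1 := summable_triConv hT hx hz hz k
    have h2 := summable_triConv hT hz hx hz k
    have h3 := summable_triConv hT hz hz hx k
    have h4 := summable_triConv hT hz hx hx k
    have h5 := summable_triConv hT hx hz hx k
    have h6 := summable_triConv hT hx hx hz k
    have h7 := summable_triConv hT hx hx hx k
    have i1 := ((h1.add h2).add h3).mul_left c
    have i2 := ((h4.add h5).add h6).mul_left (c ^ 2)
    have i3 := h7.mul_left (c ^ 3)
    unfold triConv
    rw [← h1.tsum_add h2, ← (h1.add h2).tsum_add h3, ← h4.tsum_add h5, ← (h4.add h5).tsum_add h6,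
      ← tsum_mul_left, ← tsum_mul_left, ← tsum_mul_left, ← h0.tsum_add i1,
      ← (h0.add i1).tsum_add i2, ← ((h0.add i1).add i2).tsum_add i3]
    refine tsum_congr fun j => ?_
    simp only [Pi.add_apply, Pi.smul_apply, smul_eq_mul]
    ring
  rw [e]
  exact hasDerivAt_cubic_zero _ _ _ _

theorem norm_biConv_single_left_le (hK : ∀ i j, |K i j| ≤ M) {N : ℝ} (hN : ∀ j, ‖z j‖ ≤ N)
    (k l : ℤ) : ‖biConv K (Pi.single l 1) z k‖ ≤ M * N := by
  unfold biConv
  rw [tsum_eq_single l fun j hj => by simp [hj]]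
  refine (norm_biConv_term_le hK _ _ _ _).trans ?_
  have hM : 0 ≤ M := (abs_nonneg _).trans (hK 0 0)
  simpa using mul_le_mul_of_nonneg_left (hN (k - l)) hM

theorem norm_biConv_single_right_le (hK : ∀ i j, |K i j| ≤ M) {N : ℝ} (hN : ∀ j, ‖z j‖ ≤ N)
    (k l : ℤ) : ‖biConv K z (Pi.single l 1) k‖ ≤ M * N := by
  unfold biConv
  rw [tsum_eq_single (k - l) fun j hj => by
    have : k - j ≠ l := fun h => hj (by omega)
    simp [this]]
  refine (norm_biConv_term_le hK _ _ _ _).trans ?_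
  have hM : 0 ≤ M := (abs_nonneg _).trans (hK 0 0)
  simpa using mul_le_mul_of_nonneg_left (hN (k - l)) hM

theorem tsum_triple_single_le (hz : Tame z) (k l : ℤ) :
    ∑' p : ℤ × ℤ, ‖(Pi.single l 1 : ℤ → ℂ) p.1‖ * ‖z p.2‖ * ‖z (k - p.1 - p.2)‖
      ≤ ∑' j, ‖z j‖ ^ 2 := by
  have hs := summable_triple (tame_single l) hz hz k
  rw [hs.tsum_prod' fun i => hs.prod_factor i, tsum_eq_single l fun j hj => by
    simp [hj]]
  simpa using tsum_mul_norm_le hz.sq (k - l)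

theorem tsum_triple_rot (x y w : ℤ → ℂ) (k : ℤ) :
    ∑' p : ℤ × ℤ, ‖x p.1‖ * ‖y p.2‖ * ‖w (k - p.1 - p.2)‖
      = ∑' p : ℤ × ℤ, ‖w p.1‖ * ‖x p.2‖ * ‖y (k - p.1 - p.2)‖ := by
  rw [← (rotTwo k).tsum_eq]
  refine tsum_congr fun p => ?_
  have : k - p.2 - (k - p.1 - p.2) = p.1 := by ring
  simp only [rotTwo_apply, this]
  ring

theorem norm_triConv_le_tsum (hT : ∀ i j l, |T i j l| ≤ M) (hx : Tame x) (hy : Tame y)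
    (hw : Tame w) (k : ℤ) : ‖triConv T x y w k‖
      ≤ M * ∑' p : ℤ × ℤ, ‖x p.1‖ * ‖y p.2‖ * ‖w (k - p.1 - p.2)‖ := by
  rw [← tsum_mul_left]
  exact tsum_of_norm_bounded ((summable_triple hx hy hw k).mul_left M).hasSum
    (norm_triConv_term_le hT x y w k)

/-- A unit vector in one slot removes one summation and leaves a bilinear convolution, bounded by
Cauchy-Schwarz. The bound is uniform in `k` and `l`. -/
theorem norm_triConv_single_le (hT : ∀ i j l, |T i j l| ≤ M) (hz : Tame z) (k l : ℤ) :
    ‖triConv T (Pi.single l 1) z z k + triConv T z (Pi.single l 1) z k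
      + triConv T z z (Pi.single l 1) k‖ ≤ 3 * (M * ∑' j, ‖z j‖ ^ 2) := by
  have hM : 0 ≤ M := (abs_nonneg _).trans (hT 0 0 0)
  have he := tame_single l
  have b := mul_le_mul_of_nonneg_left (tsum_triple_single_le hz k l) hM
  have h1 := norm_triConv_le_tsum hT he hz hz k
  have h2 := norm_triConv_le_tsum hT hz he hz k
  have h3 := norm_triConv_le_tsum hT hz hz he k
  -- One rotation brings the unit vector from the third slot to the first, two bring it from the
  -- second.
  rw [tsum_triple_rot] at h3
  rw [tsum_triple_rot, tsum_triple_rot] at h2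
  refine (norm_add₃_le).trans ?_
  linarith

end Convolutions

end NormalForm

/-! ### The kernels of the transformation and their bounds. -/

namespace NormalForm

/-- `0` for the modes `±1` and `1` for all others. -/
noncomputable def nres (k : ℤ) : ℝ := if k = 1 ∨ k = -1 then 0 else 1

/-- The inverse of `λ_k`, set to `0` for the modes `±1`. -/
noncomputable def mu (bc : BoundaryCondition) (L : ℝ) (k : ℤ) : ℝ := nres k / lam bc L k

/-- The weight of a cubic monomial, one over the number of indices other than `±1`. -/
noncomputable def cThree (i j k : ℤ) : ℝ := 1 / (nres i + nres j + nres k)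

/-- The weight of a quartic monomial, one over the number of indices other than `±1`. -/
noncomputable def cFour (i j k l : ℤ) : ℝ := 1 / (nres i + nres j + nres k + nres l)

/-- The kernel of the quadratic part of the normal form transformation. -/
noncomputable def kernelTwo (i j : ℤ) : ℝ := cThree i j (i + j)

/-- The coefficients of the quartic part of the potential after the quadratic change of
variables. -/
noncomputable def quarticCoeff (bc : BoundaryCondition) (L a₃ a₄ : ℝ) (i j k l : ℤ) : ℝ :=
  a₃ ^ 2 * (mu bc L (i + j) * (kernelTwo i j * kernelTwo k l / 2 - kernelTwo i j)) + a₄ / 4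

/-- The sum of `quarticCoeff` over the cyclic permutations of the indices. -/
noncomputable def quarticSum (bc : BoundaryCondition) (L a₃ a₄ : ℝ) (i j k l : ℤ) : ℝ :=
  quarticCoeff bc L a₃ a₄ i j k l + quarticCoeff bc L a₃ a₄ j k l i +
    quarticCoeff bc L a₃ a₄ k l i j + quarticCoeff bc L a₃ a₄ l i j k

/-- The kernel of the cubic part of the normal form transformation. -/
noncomputable def kernelThree (bc : BoundaryCondition) (L a₃ a₄ : ℝ) (i j k : ℤ) : ℝ :=
  cFour i j k (-(i + j + k)) * quarticSum bc L a₃ a₄ i j k (-(i + j + k))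

/-- The quadratic part of the normal form transformation. -/
noncomputable def nfTwo (bc : BoundaryCondition) (L a₃ : ℝ) (z : ℤ → ℂ) (k : ℤ) : ℂ :=
  -((a₃ * mu bc L k : ℝ) : ℂ) * biConv kernelTwo z z k

/-- The cubic part of the normal form transformation. -/
noncomputable def nfThree (bc : BoundaryCondition) (L a₃ a₄ : ℝ) (z : ℤ → ℂ) (k : ℤ) : ℂ :=
  -(mu bc L k : ℂ) * triConv (kernelThree bc L a₃ a₄) z z z k

/-- The map `g` of the normal form transformation `z ↦ z + g z`. -/
noncomputable def nfMap (bc : BoundaryCondition) (L a₃ a₄ : ℝ) (z : ℤ → ℂ) : ℤ → ℂ :=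
  nfTwo bc L a₃ z + nfThree bc L a₃ a₄ z

section Coefficients

theorem nres_zero_or_one (k : ℤ) : nres k = 0 ∨ nres k = 1 := by
  unfold nres; split_ifs <;> simp

theorem nres_nonneg (k : ℤ) : 0 ≤ nres k := by
  rcases nres_zero_or_one k with h | h <;> simp [h]

@[simp] theorem nres_neg (k : ℤ) : nres (-k) = nres k := by
  have : (-k = 1 ∨ -k = -1) ↔ (k = 1 ∨ k = -1) := by omega
  simp only [nres, this]

@[simp] theorem nres_mul_self (k : ℤ) : nres k * nres k = nres k := by
  rcases nres_zero_or_one k with h | h <;> simp [h]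

theorem abs_cThree_le (i j k : ℤ) : |cThree i j k| ≤ 1 := by
  unfold cThree
  rcases nres_zero_or_one i with h | h <;> rcases nres_zero_or_one j with h' | h' <;>
    rcases nres_zero_or_one k with h'' | h'' <;> rw [h, h', h''] <;> norm_num

/-- If all four indices are `±1` the weight is `1 / 0 = 0`: the transformation leaves the resonant
monomials alone. -/
theorem abs_cFour_le (i j k l : ℤ) : |cFour i j k l| ≤ 1 := by
  unfold cFour
  rcases nres_zero_or_one i with h | h <;> rcases nres_zero_or_one j with h' | h' <;>
    rcases nres_zero_or_one k with h'' | h'' <;> rcases nres_zero_or_one l with h₃ | h₃ <;>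
    rw [h, h', h'', h₃] <;> norm_num

theorem abs_kernelTwo_le (i j : ℤ) : |kernelTwo i j| ≤ 1 := abs_cThree_le _ _ _

variable {bc : BoundaryCondition} {L a₃ a₄ : ℝ}

@[simp] theorem lam_neg (bc : BoundaryCondition) (L : ℝ) (k : ℤ) : lam bc L (-k) = lam bc L k := by
  unfold lam nu; push_cast; ring

@[simp] theorem mu_neg (bc : BoundaryCondition) (L : ℝ) (k : ℤ) : mu bc L (-k) = mu bc L k := by
  unfold mu; simp

theorem kernelTwo_neg (i j : ℤ) : kernelTwo (-i) (-j) = kernelTwo i j := by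
  have : -i + -j = -(i + j) := by ring
  simp only [kernelTwo, cThree, this, nres_neg]

theorem quarticCoeff_neg (i j k l : ℤ) :
    quarticCoeff bc L a₃ a₄ (-i) (-j) (-k) (-l) = quarticCoeff bc L a₃ a₄ i j k l := by
  have : -i + -j = -(i + j) := by ring
  simp only [quarticCoeff, kernelTwo_neg, this, mu_neg]

theorem kernelThree_neg (i j k : ℤ) :
    kernelThree bc L a₃ a₄ (-i) (-j) (-k) = kernelThree bc L a₃ a₄ i j k := by
  have : -i + -j + -k = -(i + j + k) := by ring
  simp only [kernelThree, this, quarticSum, quarticCoeff_neg, cFour, nres_neg]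

theorem b_pos (bc : BoundaryCondition) : 0 < bc.b := by cases bc <;> simp [BoundaryCondition.b]

theorem exists_abs_mu_le (hL : 0 < L)
    (hlam : ∃ c > 0, ∀ k : ℤ, k ≠ 1 → k ≠ -1 → c ≤ |lam bc L k|) :
    ∃ C > 0, ∀ k, |mu bc L k| ≤ C * rho k := by
  obtain ⟨c, hc, h⟩ := hlam
  have hβ : 0 < (bc.b * Real.pi / L) ^ 2 := by have := b_pos bc; have := Real.pi_pos; positivity
  set β := (bc.b * Real.pi / L) ^ 2 with hβdef
  -- Off `±1`, `1 ≤ |λ_k| / c`, and `β k² ≤ |λ_k| + 1 ≤ (1 + 1/c) |λ_k|`; the two are added.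
  refine ⟨1 / c + (1 + 1 / c) / β, by positivity, fun k => ?_⟩
  unfold mu nres
  split_ifs with hk
  · simp only [zero_div, abs_zero]
    exact mul_nonneg (by positivity) (rho_pos k).le
  · push Not at hk
    have h1 := h k hk.1 hk.2
    have h2 : lam bc L k = β * (k : ℝ) ^ 2 - 1 := by
      rw [lam, nu, hβdef]; ring
    have hl : 0 < |lam bc L k| := by linarith
    rw [abs_div, abs_one, rho, ← div_eq_mul_inv, div_le_div_iff₀ hl (one_add_sq_pos k), one_mul]
    have h3 : β * (k : ℝ) ^ 2 ≤ |lam bc L k| + 1 := by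
      have := le_abs_self (lam bc L k); linarith
    have h4 : 1 ≤ 1 / c * |lam bc L k| := by
      rw [one_div, inv_mul_eq_div, one_le_div hc]; exact h1
    have h5 : (k : ℝ) ^ 2 ≤ (1 + 1 / c) * |lam bc L k| / β := by
      rw [le_div_iff₀ hβ]; nlinarith
    calc 1 + (k : ℝ) ^ 2 ≤ 1 / c * |lam bc L k| + (1 + 1 / c) * |lam bc L k| / β := by linarith
      _ = _ := by ring

variable {C : ℝ}

theorem abs_quarticCoeff_le (hμ : ∀ k, |mu bc L k| ≤ C * rho k) (i j k l : ℤ) :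
    |quarticCoeff bc L a₃ a₄ i j k l| ≤ (2 * C + 1) / 4 * (4 * (a₃ ^ 2 + |a₄|)) := by
  have hC : 0 ≤ C := nonneg_of_mul_nonneg_left ((abs_nonneg _).trans (hμ 0)) (rho_pos 0)
  have h1 : |mu bc L (i + j)| ≤ C := (hμ _).trans (mul_le_of_le_one_right hC (rho_le_one _))
  have h2 : |kernelTwo i j * kernelTwo k l / 2 - kernelTwo i j| ≤ 2 := by
    have e1 := abs_kernelTwo_le i j
    have e2 := abs_kernelTwo_le k l
    have e3 : |kernelTwo i j * kernelTwo k l| ≤ 1 := by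
      rw [abs_mul]; exact mul_le_one₀ e1 (abs_nonneg _) e2
    rw [abs_le] at e1 e3 ⊢
    constructor <;> linarith [e1.1, e1.2, e3.1, e3.2]
  have h3 : |mu bc L (i + j) * (kernelTwo i j * kernelTwo k l / 2 - kernelTwo i j)| ≤ C * 2 := by
    rw [abs_mul]; exact mul_le_mul h1 h2 (abs_nonneg _) hC
  unfold quarticCoeff
  refine (abs_add_le _ _).trans ?_
  rw [abs_mul, abs_div, abs_of_nonneg (sq_nonneg a₃), abs_of_pos (by norm_num : (0 : ℝ) < 4)]
  have h4 := mul_le_mul_of_nonneg_left h3 (sq_nonneg a₃)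
  nlinarith [mul_nonneg hC (abs_nonneg a₄), sq_nonneg a₃, abs_nonneg a₄]

/-- The dependence on `a₃`, `a₄` is kept explicit because the constants in the determinant estimate
must not depend on them. -/
theorem abs_kernelThree_le (hμ : ∀ k, |mu bc L k| ≤ C * rho k) (i j k : ℤ) :
    |kernelThree bc L a₃ a₄ i j k| ≤ 4 * (2 * C + 1) * (a₃ ^ 2 + |a₄|) := by
  unfold kernelThree quarticSum
  set l := -(i + j + k)
  rw [abs_mul]
  have h1 := abs_quarticCoeff_le (a₃ := a₃) (a₄ := a₄) hμ i j k l
  have h2 := abs_quarticCoeff_le (a₃ := a₃) (a₄ := a₄) hμ j k l i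
  have h3 := abs_quarticCoeff_le (a₃ := a₃) (a₄ := a₄) hμ k l i j
  have h4 := abs_quarticCoeff_le (a₃ := a₃) (a₄ := a₄) hμ l i j k
  refine (mul_le_of_le_one_left (abs_nonneg _) (abs_cFour_le i j k l)).trans ?_
  rw [abs_le] at h1 h2 h3 h4 ⊢
  constructor <;> linarith [h1.1, h2.1, h3.1, h4.1, h1.2, h2.2, h3.2, h4.2]

end Coefficients

/-! ### Compatibility with reflection and complex conjugation. -/

section Symmetry

/-- Even kernels give convolutions that commute with reflection, real kernels give ones that commute
with conjugation. All symmetries of the transformation follow from these two facts. -/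
theorem biConv_comp_neg {K : ℤ → ℤ → ℝ} (hK : ∀ i j, K (-i) (-j) = K i j) (x y : ℤ → ℂ) (k : ℤ) :
    biConv K (fun j => x (-j)) (fun j => y (-j)) k = biConv K x y (-k) := by
  unfold biConv
  rw [← (Equiv.neg ℤ).tsum_eq]
  refine tsum_congr fun j => ?_
  have e : k - -j = -(-k - j) := by ring
  simp only [Equiv.neg_apply, e, hK, neg_neg]

theorem triConv_comp_neg {K : ℤ → ℤ → ℤ → ℝ} (hK : ∀ i j l, K (-i) (-j) (-l) = K i j l)
    (x y w : ℤ → ℂ) (k : ℤ) :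
    triConv K (fun j => x (-j)) (fun j => y (-j)) (fun j => w (-j)) k = triConv K x y w (-k) := by
  unfold triConv
  rw [← (Equiv.neg (ℤ × ℤ)).tsum_eq]
  refine tsum_congr fun p => ?_
  have e : k - -p.1 - -p.2 = -(-k - p.1 - p.2) := by ring
  simp only [Equiv.neg_apply, Prod.fst_neg, Prod.snd_neg, e, hK, neg_neg]

theorem biConv_conj (K : ℤ → ℤ → ℝ) (x y : ℤ → ℂ) (k : ℤ) :
    biConv K (fun j => (starRingEnd ℂ) (x j)) (fun j => (starRingEnd ℂ) (y j)) k
      = (starRingEnd ℂ) (biConv K x y k) := by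
  unfold biConv
  rw [Complex.conj_tsum]
  exact tsum_congr fun j => by simp

theorem triConv_conj (K : ℤ → ℤ → ℤ → ℝ) (x y w : ℤ → ℂ) (k : ℤ) :
    triConv K (fun j => (starRingEnd ℂ) (x j)) (fun j => (starRingEnd ℂ) (y j))
      (fun j => (starRingEnd ℂ) (w j)) k = (starRingEnd ℂ) (triConv K x y w k) := by
  unfold triConv
  rw [Complex.conj_tsum]
  exact tsum_congr fun j => by simp

variable (bc : BoundaryCondition) (L a₃ a₄ : ℝ) (z : ℤ → ℂ) (k : ℤ)

theorem nfTwo_comp_neg : nfTwo bc L a₃ (fun j => z (-j)) k = nfTwo bc L a₃ z (-k) := by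
  simp only [nfTwo, biConv_comp_neg kernelTwo_neg, mu_neg]

theorem nfThree_comp_neg :
    nfThree bc L a₃ a₄ (fun j => z (-j)) k = nfThree bc L a₃ a₄ z (-k) := by
  simp only [nfThree, triConv_comp_neg kernelThree_neg, mu_neg]

theorem nfTwo_conj : nfTwo bc L a₃ (fun j => (starRingEnd ℂ) (z j)) k
    = (starRingEnd ℂ) (nfTwo bc L a₃ z k) := by
  simp only [nfTwo, biConv_conj, map_mul, map_neg, Complex.conj_ofReal]

theorem nfThree_conj : nfThree bc L a₃ a₄ (fun j => (starRingEnd ℂ) (z j)) k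
    = (starRingEnd ℂ) (nfThree bc L a₃ a₄ z k) := by
  simp only [nfThree, triConv_conj, map_mul, map_neg, Complex.conj_ofReal]

variable {bc z}

theorem Admissible.nfTwo (h : Admissible bc z) : Admissible bc (nfTwo bc L a₃ z) := by
  refine ⟨fun k => ?_, fun hb k => ?_⟩
  · rw [← nfTwo_comp_neg, ← nfTwo_conj]; simp only [h.1]
  · rw [← nfTwo_comp_neg]; simp only [h.2 hb]

theorem Admissible.nfThree (h : Admissible bc z) : Admissible bc (nfThree bc L a₃ a₄ z) := by
  refine ⟨fun k => ?_, fun hb k => ?_⟩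
  · rw [← nfThree_comp_neg, ← nfThree_conj]; simp only [h.1]
  · rw [← nfThree_comp_neg]; simp only [h.2 hb]

theorem Admissible.add {x y : ℤ → ℂ} (hx : Admissible bc x) (hy : Admissible bc y) :
    Admissible bc (x + y) := by
  refine ⟨fun k => ?_, fun hb k => ?_⟩
  · simp [hx.1 k, hy.1 k]
  · simp [hx.2 hb k, hy.2 hb k]

theorem nfMap_neg_of_even (h : ∀ k, z (-k) = z k) :
    nfMap bc L a₃ a₄ z (-k) = nfMap bc L a₃ a₄ z k := by
  simp only [nfMap, Pi.add_apply]
  rw [← nfTwo_comp_neg, ← nfThree_comp_neg]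
  simp only [h]

theorem nfMap_neg_of_conj (h : ∀ k, z (-k) = (starRingEnd ℂ) (z k)) :
    nfMap bc L a₃ a₄ z (-k) = (starRingEnd ℂ) (nfMap bc L a₃ a₄ z k) := by
  simp only [nfMap, Pi.add_apply, map_add]
  rw [← nfTwo_comp_neg, ← nfThree_comp_neg, ← nfTwo_conj, ← nfThree_conj]
  simp only [h]

theorem nfMap_im_of_real (h : ∀ k, (z k).im = 0) : (nfMap bc L a₃ a₄ z k).im = 0 := by
  have hz : (fun j => (starRingEnd ℂ) (z j)) = z := funext fun j => Complex.conj_eq_iff_im.2 (h j)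
  rw [← Complex.conj_eq_iff_im]
  simp only [nfMap, Pi.add_apply, map_add, ← nfTwo_conj, ← nfThree_conj, hz]

end Symmetry

/-! ### Size and Jacobian of the transformation. -/

section Bounds

variable {bc : BoundaryCondition} {L a₃ a₄ C s : ℝ} {z : ℤ → ℂ}

/-- The constant in the bound for threefold convolutions on `H^s`. -/
noncomputable def cubeConst (s : ℝ) : ℝ := (1 + ∑' k : ℤ, (1 + (k : ℝ) ^ 2) ^ (-(3 * s))) ^ 2

theorem cubeConst_nonneg (s : ℝ) : 0 ≤ cubeConst s := sq_nonneg _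

/-- The decay in `k` comes only from `mu`; the convolution contributes a bound independent of `k`.
-/
theorem norm_nfTwo_le (hμ : ∀ k, |mu bc L k| ≤ C * rho k) (hs : 1 / 6 < s) (hz : MemH s z)
    (k : ℤ) : ‖nfTwo bc L a₃ z k‖ ≤ C * |a₃| * normH s z ^ 2 * rho k := by
  have hC : 0 ≤ C := nonneg_of_mul_nonneg_left ((abs_nonneg _).trans (hμ 0)) (rho_pos 0)
  rw [nfTwo, norm_mul, norm_neg, Complex.norm_real, Real.norm_eq_abs, abs_mul]
  have h1 := norm_biConv_le abs_kernelTwo_le (hz.tame hs) k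
  rw [one_mul] at h1
  have h2 := h1.trans (hz.tsum_sq_le (by linarith))
  calc _ ≤ |a₃| * (C * rho k) * normH s z ^ 2 :=
        mul_le_mul (mul_le_mul_of_nonneg_left (hμ k) (abs_nonneg _)) h2 (norm_nonneg _)
          (mul_nonneg (abs_nonneg _) (mul_nonneg hC (rho_pos k).le))
    _ = _ := by ring

theorem norm_nfThree_le (hμ : ∀ k, |mu bc L k| ≤ C * rho k) (hs : 1 / 6 < s) (hz : MemH s z)
    (k : ℤ) : ‖nfThree bc L a₃ a₄ z k‖
      ≤ C * (4 * (2 * C + 1) * (a₃ ^ 2 + |a₄|)) * cubeConst s * normH s z ^ 3 * rho k := by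
  have hC : 0 ≤ C := nonneg_of_mul_nonneg_left ((abs_nonneg _).trans (hμ 0)) (rho_pos 0)
  rw [nfThree, norm_mul, norm_neg, Complex.norm_real, Real.norm_eq_abs]
  have h1 := norm_triConv_le (abs_kernelThree_le (a₃ := a₃) (a₄ := a₄) hμ) (hz.tame hs) k
  have h2 := h1.trans (mul_le_mul_of_nonneg_left (hz.sq_tsum_sqrt_cube_le hs) (by positivity))
  calc _ ≤ C * rho k * (4 * (2 * C + 1) * (a₃ ^ 2 + |a₄|) * (cubeConst s * normH s z ^ 3)) :=
        mul_le_mul (hμ k) h2 (norm_nonneg _) (mul_nonneg hC (rho_pos k).le)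
    _ = _ := by ring

theorem exists_norm_nfMap_le (hμ : ∀ k, |mu bc L k| ≤ C * rho k) (hs : 1 / 6 < s) (a₃ a₄ : ℝ) :
    ∃ B > 0, ∀ z : ℤ → ℂ, MemH s z → ∀ k, ‖nfMap bc L a₃ a₄ z k‖
      ≤ B * (normH s z ^ 2 + normH s z ^ 3) * rho k := by
  have hC : 0 ≤ C := nonneg_of_mul_nonneg_left ((abs_nonneg _).trans (hμ 0)) (rho_pos 0)
  have hc := cubeConst_nonneg s
  set B₂ := C * |a₃| with hB₂
  set B₃ := C * (4 * (2 * C + 1) * (a₃ ^ 2 + |a₄|)) * cubeConst s with hB₃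
  have h2 : 0 ≤ B₂ := by positivity
  have h3 : 0 ≤ B₃ := by positivity
  refine ⟨B₂ + B₃ + 1, by positivity, fun z hz k => ?_⟩
  have hN := normH_nonneg s z
  refine (norm_add_le _ _).trans ((add_le_add (norm_nfTwo_le hμ hs hz k)
    (norm_nfThree_le hμ hs hz k)).trans ?_)
  rw [← hB₂, ← hB₃]
  have : (B₂ * normH s z ^ 2 + B₃ * normH s z ^ 3) * rho k
      ≤ (B₂ + B₃ + 1) * (normH s z ^ 2 + normH s z ^ 3) * rho k := by
    refine mul_le_mul_of_nonneg_right ?_ (rho_pos k).le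
    nlinarith [mul_nonneg h3 (pow_nonneg hN 2), mul_nonneg h2 (pow_nonneg hN 3), pow_nonneg hN 2,
      pow_nonneg hN 3]
  linarith

/-- The matrix of partial derivatives of `nfMap`. -/
noncomputable def nfJacobian (bc : BoundaryCondition) (L a₃ a₄ : ℝ) (z : ℤ → ℂ) (k l : ℤ) : ℂ :=
  -((a₃ * mu bc L k : ℝ) : ℂ) *
      (biConv kernelTwo (Pi.single l 1) z k + biConv kernelTwo z (Pi.single l 1) k) +
    -(mu bc L k : ℂ) * (triConv (kernelThree bc L a₃ a₄) (Pi.single l 1) z z k +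
      triConv (kernelThree bc L a₃ a₄) z (Pi.single l 1) z k +
      triConv (kernelThree bc L a₃ a₄) z z (Pi.single l 1) k)

theorem hasJacobianMatrix_nfMap (hμ : ∀ k, |mu bc L k| ≤ C * rho k) (hz : Tame z) :
    HasJacobianMatrix (nfMap bc L a₃ a₄) (nfJacobian bc L a₃ a₄ z) z := by
  intro k l
  have e : (fun w : ℂ => nfMap bc L a₃ a₄ (z + Pi.single l w) k) = fun w : ℂ =>
      nfMap bc L a₃ a₄ (z + w • Pi.single l 1) k := by
    funext w
    rw [← Pi.single_smul, smul_eq_mul, mul_one]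
  rw [e]
  have h1 := hasDerivAt_biConv abs_kernelTwo_le hz (tame_single l) k
  have h2 := hasDerivAt_triConv (abs_kernelThree_le (a₃ := a₃) (a₄ := a₄) hμ) hz (tame_single l) k
  exact (h1.const_mul _).fun_add (h2.const_mul _)

/-- The bound depends on the row only and is summable over rows, as `exists_hasDetOneAdd` requires.
-/
theorem norm_nfJacobian_le (hμ : ∀ k, |mu bc L k| ≤ C * rho k) (hs : 1 / 6 < s) (hz : MemH s z)
    (h1 : |a₃| * normH s z ≤ 1) (k l : ℤ) :
    ‖nfJacobian bc L a₃ a₄ z k l‖ ≤ C * (2 + 12 * (2 * C + 1)) *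
      (|a₃| * normH s z + |a₄| * normH s z ^ 2) * rho k := by
  have hC : 0 ≤ C := nonneg_of_mul_nonneg_left ((abs_nonneg _).trans (hμ 0)) (rho_pos 0)
  have hr := rho_pos k
  have hN := normH_nonneg s z
  have b1 := norm_biConv_single_left_le abs_kernelTwo_le (hz.norm_le (by linarith)) k l
  have b2 := norm_biConv_single_right_le abs_kernelTwo_le (hz.norm_le (by linarith)) k l
  have b3 := norm_triConv_single_le (abs_kernelThree_le (a₃ := a₃) (a₄ := a₄) hμ) (hz.tame hs) k l
  have b4 := b3.trans (mul_le_mul_of_nonneg_left (mul_le_mul_of_nonneg_left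
    (hz.tsum_sq_le (by linarith)) (by positivity)) (by norm_num))
  set N := normH s z
  unfold nfJacobian
  refine (norm_add_le _ _).trans ?_
  rw [norm_mul, norm_mul, norm_neg, norm_neg, Complex.norm_real, Complex.norm_real,
    Real.norm_eq_abs, Real.norm_eq_abs, abs_mul]
  have c1 := mul_le_mul (mul_le_mul_of_nonneg_left (hμ k) (abs_nonneg a₃))
    ((norm_add_le _ _).trans (add_le_add b1 b2)) (norm_nonneg _)
    (mul_nonneg (abs_nonneg _) (mul_nonneg hC hr.le))
  have c2 := mul_le_mul (hμ k) b4 (norm_nonneg _) (mul_nonneg hC hr.le)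
  refine (add_le_add c1 c2).trans ?_
  -- The cubic part contributes `a₃²N²`, which `h1` reduces to the linear quantity in the estimate.
  have h2 : a₃ ^ 2 * N ^ 2 ≤ |a₃| * N := by
    rw [← sq_abs]
    nlinarith [mul_nonneg (abs_nonneg a₃) hN]
  have h3 : 0 ≤ |a₄| * N ^ 2 := by positivity
  calc _ = C * rho k * (2 * (|a₃| * N) + 12 * (2 * C + 1) * (a₃ ^ 2 * N ^ 2 + |a₄| * N ^ 2)) := by
        ring
    _ ≤ C * rho k * ((2 + 12 * (2 * C + 1)) * (|a₃| * N + |a₄| * N ^ 2)) := by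
        refine mul_le_mul_of_nonneg_left ?_ (by positivity)
        nlinarith
    _ = _ := by ring

end Bounds

section Properties

variable {bc : BoundaryCondition} {L : ℝ}

theorem nfMap_size {C s t : ℝ} (hμ : ∀ k, |mu bc L k| ≤ C * rho k) (hs : 1 / 6 < s)
    (ht : t < 3 / 2) (a₃ a₄ : ℝ) :
    ∃ C > 0, ∃ δ > 0, ∀ z : ℤ → ℂ, MemH s z → normH s z ≤ δ →
      MemH t (nfMap bc L a₃ a₄ z) ∧ normH t (nfMap bc L a₃ a₄ z) ≤ C * normH s z ^ 2 := by
  obtain ⟨B, hB, h⟩ := exists_norm_nfMap_le hμ hs a₃ a₄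
  set S := √(∑' k : ℤ, (1 + (k : ℝ) ^ 2) ^ (t - 2)) with hS
  have hS0 : 0 ≤ S := Real.sqrt_nonneg _
  refine ⟨B * 2 * S + 1, by positivity, 1, one_pos, fun z hz hz1 => ?_⟩
  have hN := normH_nonneg s z
  refine ⟨memH_of_norm_le_rho (h z hz) ht, ?_⟩
  refine (normH_le_of_norm_le_rho (by positivity) (h z hz) ht).trans ?_
  rw [← hS]
  have : normH s z ^ 3 ≤ normH s z ^ 2 := pow_le_pow_of_le_one hN hz1 (by norm_num)
  nlinarith [mul_nonneg hB.le hS0, mul_le_mul_of_nonneg_left this (mul_nonneg hB.le hS0),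
    sq_nonneg (normH s z)]

theorem nfMap_det {C s : ℝ} (hC : 0 < C) (hμ : ∀ k, |mu bc L k| ≤ C * rho k) (hs : 1 / 6 < s) :
    ∃ C > 0, ∃ δ > 0, ∀ (a₃ a₄ : ℝ) (z : ℤ → ℂ), MemH s z →
      |a₃| * normH s z ≤ δ → |a₄| * normH s z ^ 2 ≤ δ →
      ∃ (J : ℤ → ℤ → ℂ) (D : ℂ), HasJacobianMatrix (nfMap bc L a₃ a₄) J z ∧
        HasDetOneAdd J D ∧
        ‖D - 1‖ ≤ C * (|a₃| * normH s z + |a₄| * normH s z ^ 2) := by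
  have hS : 0 < ∑' k, rho k := summable_rho.tsum_pos (fun k => (rho_pos k).le) 0 (rho_pos 0)
  set S := ∑' k, rho k with hSdef
  set A := C * (2 + 12 * (2 * C + 1)) with hA
  have hA0 : 0 < A := by positivity
  -- The bound `1` serves `norm_nfJacobian_le`; `1 / (4 A S)`, used for both smallness hypotheses,
  -- makes the sum of the row bounds at most `1/2`.
  refine ⟨2 * (A * S), by positivity, min 1 (1 / (4 * (A * S))), by positivity,
    fun a₃ a₄ z hz h3 h4 => ?_⟩
  set E := |a₃| * normH s z + |a₄| * normH s z ^ 2 with hE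
  have hE2 : E ≤ 2 * (1 / (4 * (A * S))) := by
    have := h3.trans (min_le_right _ _)
    have := h4.trans (min_le_right _ _)
    linarith
  have hsum : ∑' k, A * E * rho k = A * E * S := by rw [tsum_mul_left]
  obtain ⟨D, hD, hD1⟩ := exists_hasDetOneAdd (nfJacobian bc L a₃ a₄ z) (fun k => A * E * rho k)
    (norm_nfJacobian_le hμ hs hz (h3.trans (min_le_left _ _))) (summable_rho.mul_left _) (by
      rw [hsum]
      calc A * E * S = A * S * E := by ring
        _ ≤ A * S * (2 * (1 / (4 * (A * S)))) := mul_le_mul_of_nonneg_left hE2 (by positivity)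
        _ = 1 / 2 := by field_simp; norm_num)
  refine ⟨_, D, hasJacobianMatrix_nfMap hμ (hz.tame hs), hD, hD1.trans (le_of_eq ?_)⟩
  rw [hsum]; ring

end Properties

end NormalForm

/-! ### Fourier modes, products as convolutions, integrals as zeroth coefficients. -/

namespace NormalForm

section Modes

variable (bc : BoundaryCondition) (L : ℝ)

/-- The Fourier modes `exp (i b k π x / L)`. -/
noncomputable def mode (k : ℤ) (x : ℝ) : ℂ :=
  Complex.exp (Complex.I * ((bc.b * k * Real.pi * x / L : ℝ) : ℂ))

/-- The Fourier series with coefficients `z`, without the normalization `1 / √L`. -/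
noncomputable def modeSum (z : ℤ → ℂ) (x : ℝ) : ℂ := ∑' k : ℤ, z k * mode bc L k x

theorem fourierSeries_eq (z : ℤ → ℂ) (x : ℝ) :
    fourierSeries bc L z x = modeSum bc L z x / ((√L : ℝ) : ℂ) := by
  rw [modeSum, ← tsum_div_const]; rfl

theorem mode_add (j k : ℤ) (x : ℝ) : mode bc L (j + k) x = mode bc L j x * mode bc L k x := by
  rw [mode, mode, mode, ← Complex.exp_add]
  congr 1; push_cast; ring

@[simp] theorem mode_zero (x : ℝ) : mode bc L 0 x = 1 := by simp [mode]

@[simp] theorem norm_mode (k : ℤ) (x : ℝ) : ‖mode bc L k x‖ = 1 := by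
  rw [mode, mul_comm]; exact Complex.norm_exp_ofReal_mul_I _

theorem conj_mode (k : ℤ) (x : ℝ) : (starRingEnd ℂ) (mode bc L k x) = mode bc L (-k) x := by
  rw [mode, mode, ← Complex.exp_conj, map_mul, Complex.conj_I, Complex.conj_ofReal]
  congr 1; push_cast; ring

theorem continuous_mode (k : ℤ) : Continuous (mode bc L k) := by
  unfold mode; fun_prop

variable {L}

theorem exp_mode_length (hL : 0 < L) (k : ℤ) :
    mode bc L k L = Complex.exp (Complex.I * (bc.b * k * Real.pi : ℝ)) := by
  rw [mode]; congr 3; field_simp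

theorem integral_mode (hL : 0 < L) {k : ℤ} (hk : k ≠ 0) :
    ∫ x in (0 : ℝ)..L, mode bc L k x
      = (mode bc L k L - 1) / (Complex.I * (bc.b * k * Real.pi / L : ℝ)) := by
  have hc : Complex.I * (bc.b * k * Real.pi / L : ℝ) ≠ 0 := by
    have h1 := (b_pos bc).ne'
    have h2 : (k : ℝ) ≠ 0 := by exact_mod_cast hk
    have h3 := Real.pi_ne_zero
    refine mul_ne_zero Complex.I_ne_zero (Complex.ofReal_ne_zero.2 ?_)
    have := hL.ne'
    positivity
  have e : ∀ x : ℝ, mode bc L k x = Complex.exp (Complex.I * (bc.b * k * Real.pi / L : ℝ) * x) := by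
    intro x; rw [mode]; congr 1; push_cast; ring
  simp_rw [e]
  rw [integral_exp_mul_complex hc]
  simp

/-- In the Neumann case a single exponential with odd `k` has nonzero integral over `[0, L]`. The
modes `k` and `-k` agree at `L`, while the denominators of their integrals have opposite signs, so
the pair cancels. -/
theorem integral_mode_add_neg (hL : 0 < L) {k : ℤ} (hk : k ≠ 0) :
    (∫ x in (0 : ℝ)..L, mode bc L k x) + ∫ x in (0 : ℝ)..L, mode bc L (-k) x = 0 := by
  rw [integral_mode bc hL hk, integral_mode bc hL (neg_ne_zero.2 hk)]
  have h : mode bc L k L = mode bc L (-k) L := by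
    rw [exp_mode_length bc hL, exp_mode_length bc hL, Complex.exp_eq_exp_iff_exists_int]
    cases bc
    · exact ⟨k, by simp only [BoundaryCondition.b]; push_cast; ring⟩
    · exact ⟨2 * k, by simp only [BoundaryCondition.b]; push_cast; ring⟩
  have e : Complex.I * ((bc.b * ((-k : ℤ) : ℝ) * Real.pi / L : ℝ) : ℂ)
      = -(Complex.I * (bc.b * k * Real.pi / L : ℝ)) := by push_cast; ring
  rw [e, h, div_neg, add_neg_cancel]

theorem integral_mode_periodic (hL : 0 < L) {k : ℤ} (hk : k ≠ 0) :
    ∫ x in (0 : ℝ)..L, mode .periodic L k x = 0 := by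
  rw [integral_mode _ hL hk, exp_mode_length _ hL]
  have : Complex.exp (Complex.I * ((BoundaryCondition.periodic.b * k * Real.pi : ℝ) : ℂ)) = 1 :=
    Complex.exp_eq_one_iff.2 ⟨k, by simp only [BoundaryCondition.b]; push_cast; ring⟩
  rw [this, sub_self, zero_div]

end Modes

section Series

variable {bc : BoundaryCondition} {L : ℝ} {x y z w : ℤ → ℂ}

theorem summable_mul_mode (hz : Summable fun k => ‖z k‖) (t : ℝ) :
    Summable fun k => z k * mode bc L k t :=
  Summable.of_norm (by simpa using hz)

theorem norm_modeSum_le (hz : Summable fun k => ‖z k‖) (t : ℝ) :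
    ‖modeSum bc L z t‖ ≤ ∑' k, ‖z k‖ :=
  tsum_of_norm_bounded hz.hasSum fun k => by simp

theorem continuous_modeSum (hz : Summable fun k => ‖z k‖) : Continuous (modeSum bc L z) :=
  continuous_tsum (fun k => continuous_const.mul (continuous_mode bc L k)) hz fun k t => by simp

theorem modeSum_add (hx : Summable fun k => ‖x k‖) (hy : Summable fun k => ‖y k‖) (t : ℝ) :
    modeSum bc L (x + y) t = modeSum bc L x t + modeSum bc L y t := by
  unfold modeSum
  rw [← (summable_mul_mode hx t).tsum_add (summable_mul_mode hy t)]
  exact tsum_congr fun k => by simp [add_mul]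

theorem integral_modeSum_eq_tsum (hz : Summable fun k => ‖z k‖) :
    HasSum (fun k => z k * ∫ t in (0 : ℝ)..L, mode bc L k t)
      (∫ t in (0 : ℝ)..L, modeSum bc L z t) := by
  have h := intervalIntegral.hasSum_integral_of_dominated_convergence
    (μ := MeasureTheory.volume) (a := 0) (b := L) (F := fun k t => z k * mode bc L k t)
    (f := modeSum bc L z) (fun k _ => ‖z k‖)
    (fun k => (continuous_const.mul (continuous_mode bc L k)).aestronglyMeasurable)
    (fun k => Eventually.of_forall fun t _ => by simp)
    (Eventually.of_forall fun t _ => hz) (by simp)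
    (Eventually.of_forall fun t _ => (summable_mul_mode hz t).hasSum)
  simpa using h

theorem integral_modeSum (hL : 0 < L) (hz : Summable fun k => ‖z k‖)
    (heven : bc = .neumann → ∀ k, z (-k) = z k) :
    ∫ t in (0 : ℝ)..L, modeSum bc L z t = L * z 0 := by
  have h := integral_modeSum_eq_tsum (bc := bc) (L := L) hz
  cases bc with
  | periodic =>
    rw [← h.tsum_eq, tsum_eq_single 0 fun k hk => by rw [integral_mode_periodic hL hk, mul_zero]]
    simp [mul_comm]
  | neumann =>
    -- Evenness of `z` permits averaging the series with its reflection, which pairs the modes `k`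
    -- and `-k`.
    have hneg : HasSum (fun k => z k * ∫ t in (0 : ℝ)..L, mode .neumann L (-k) t)
        (∫ t in (0 : ℝ)..L, modeSum .neumann L z t) := by
      refine ((Equiv.neg ℤ).hasSum_iff.2 h).congr_fun ?_ |> id
      intro k
      simp [heven rfl]
    have h2 := (h.add hneg).tsum_eq
    rw [tsum_eq_single 0 fun k hk => by
      rw [← mul_add, integral_mode_add_neg _ hL hk, mul_zero]] at h2
    simp only [mode_zero, neg_zero, intervalIntegral.integral_const, sub_zero,
      Complex.real_smul, mul_one] at h2
    linear_combination -(1 / 2 : ℂ) * h2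

/-- The convolution of two sequences. -/
noncomputable def conv (x y : ℤ → ℂ) (k : ℤ) : ℂ := ∑' j, x j * y (k - j)

/-- The bijection `(k, j) ↦ (j, k - j)`. -/
@[simps]
def shear : ℤ × ℤ ≃ ℤ × ℤ where
  toFun p := (p.2, p.1 - p.2)
  invFun p := (p.1 + p.2, p.1)
  left_inv p := by ext <;> simp
  right_inv p := by ext <;> simp

theorem summable_shear (hx : Summable fun k => ‖x k‖) (hy : Summable fun k => ‖y k‖) :
    Summable fun p : ℤ × ℤ => ‖x p.2‖ * ‖y (p.1 - p.2)‖ := by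
  have h := Summable.mul_of_nonneg hx hy (fun k => norm_nonneg _) (fun k => norm_nonneg _)
  have h' := h.comp_injective shear.injective
  refine h'.congr fun p => ?_
  rfl

theorem summable_norm_conv (hx : Summable fun k => ‖x k‖) (hy : Summable fun k => ‖y k‖) :
    Summable fun k => ‖conv x y k‖ := by
  have h := summable_shear hx hy
  refine Summable.of_nonneg_of_le (fun _ => norm_nonneg _) (fun k => ?_) h.prod
  exact tsum_of_norm_bounded (h.prod_factor k).hasSum fun j => (norm_mul _ _).le

theorem modeSum_mul (hx : Summable fun k => ‖x k‖) (hy : Summable fun k => ‖y k‖) (t : ℝ) :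
    modeSum bc L x t * modeSum bc L y t = modeSum bc L (conv x y) t := by
  have hx' : Summable fun k => ‖x k * mode bc L k t‖ := by simpa using hx
  have hy' : Summable fun k => ‖y k * mode bc L k t‖ := by simpa using hy
  have hs : Summable fun p : ℤ × ℤ => x p.2 * y (p.1 - p.2) * mode bc L p.1 t :=
    Summable.of_norm (by simpa using summable_shear hx hy)
  unfold modeSum
  rw [tsum_mul_tsum_of_summable_norm hx' hy', ← shear.tsum_eq]
  have e : ∀ p : ℤ × ℤ, x (shear p).1 * mode bc L (shear p).1 t *
      (y (shear p).2 * mode bc L (shear p).2 t) = x p.2 * y (p.1 - p.2) * mode bc L p.1 t := by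
    intro p
    have : mode bc L p.1 t = mode bc L p.2 t * mode bc L (p.1 - p.2) t := by
      rw [← mode_add]; congr 1; ring
    rw [this]; simp only [shear_apply]; ring
  simp_rw [e]
  rw [hs.tsum_prod' fun k => hs.prod_factor k]
  exact tsum_congr fun k => by simp only [conv, tsum_mul_right]

theorem conv_neg_of_even (hx : ∀ k, x (-k) = x k) (hy : ∀ k, y (-k) = y k) (k : ℤ) :
    conv x y (-k) = conv x y k := by
  unfold conv
  rw [← (Equiv.neg ℤ).tsum_eq]
  refine tsum_congr fun j => ?_
  have : -k - -j = -(k - j) := by ring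
  simp only [Equiv.neg_apply, this, hx, hy]

theorem modeSum_eq_ofReal (hz : ∀ k, z (-k) = (starRingEnd ℂ) (z k)) (t : ℝ) :
    ((modeSum bc L z t).re : ℂ) = modeSum bc L z t := by
  refine Complex.conj_eq_iff_re.1 ?_
  rw [modeSum, Complex.conj_tsum, ← (Equiv.neg ℤ).tsum_eq]
  exact tsum_congr fun k => by simp [conj_mode, ← hz]

theorem ofReal_fourierFun (hz : Admissible bc z) (t : ℝ) :
    (fourierFun bc L z t : ℂ) = modeSum bc L z t / ((√L : ℝ) : ℂ) := by
  rw [fourierFun, fourierSeries_eq, Complex.div_ofReal_re, Complex.ofReal_div,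
    modeSum_eq_ofReal hz.1]

theorem fourierFun_eq (z : ℤ → ℂ) (t : ℝ) : fourierFun bc L z t = (modeSum bc L z t).re / √L := by
  rw [fourierFun, fourierSeries_eq, Complex.div_ofReal_re]

theorem abs_fourierFun_le (hz : Summable fun k => ‖z k‖) (t : ℝ) :
    |fourierFun bc L z t| ≤ (∑' k, ‖z k‖) / √L := by
  rw [fourierFun_eq, abs_div, abs_of_nonneg (Real.sqrt_nonneg L)]
  exact div_le_div_of_nonneg_right ((Complex.abs_re_le_norm _).trans (norm_modeSum_le hz t))
    (Real.sqrt_nonneg _)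

theorem continuous_fourierFun (hz : Summable fun k => ‖z k‖) : Continuous (fourierFun bc L z) := by
  have : fourierFun bc L z = fun t => (modeSum bc L z t).re / √L := funext (fourierFun_eq z)
  rw [this]
  exact (Complex.continuous_re.comp (continuous_modeSum hz)).div_const _

theorem fourierFun_add (hx : Summable fun k => ‖x k‖) (hy : Summable fun k => ‖y k‖) (t : ℝ) :
    fourierFun bc L (x + y) t = fourierFun bc L x t + fourierFun bc L y t := by
  rw [fourierFun_eq, fourierFun_eq, fourierFun_eq, modeSum_add hx hy, Complex.add_re, add_div]

theorem integral_fourierFun_mul (hL : 0 < L) (hx : Admissible bc x) (hy : Admissible bc y)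
    (hx1 : Summable fun k => ‖x k‖) (hy1 : Summable fun k => ‖y k‖) :
    ((∫ t in (0 : ℝ)..L, fourierFun bc L x t * fourierFun bc L y t : ℝ) : ℂ) = conv x y 0 := by
  have hs : ((√L : ℝ) : ℂ) ^ 2 = L := by rw [← Complex.ofReal_pow, Real.sq_sqrt hL.le]
  have hL' : (L : ℂ) ≠ 0 := Complex.ofReal_ne_zero.2 hL.ne'
  have e : ∀ t : ℝ, ((fourierFun bc L x t * fourierFun bc L y t : ℝ) : ℂ)
      = modeSum bc L (conv x y) t / L := by
    intro t
    rw [Complex.ofReal_mul, ofReal_fourierFun hx, ofReal_fourierFun hy, div_mul_div_comm,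
      modeSum_mul hx1 hy1, ← sq, hs]
  rw [← intervalIntegral.integral_ofReal]
  simp_rw [e]
  rw [intervalIntegral.integral_div, integral_modeSum hL (summable_norm_conv hx1 hy1)
    fun hb => conv_neg_of_even (hx.2 hb) (hy.2 hb)]
  field_simp

/-- The three factors `1/√L` and the length `L` leave `1/√L`, which the `√L` in the cubic Taylor
coefficient of `U` compensates; the factor `L` plays this role in degree four. -/
theorem integral_fourierFun_mul_mul (hL : 0 < L) (hx : Admissible bc x) (hy : Admissible bc y)
    (hw : Admissible bc w) (hx1 : Summable fun k => ‖x k‖) (hy1 : Summable fun k => ‖y k‖)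
    (hw1 : Summable fun k => ‖w k‖) :
    ((√L * ∫ t in (0 : ℝ)..L, fourierFun bc L x t * fourierFun bc L y t * fourierFun bc L w t : ℝ)
      : ℂ) = conv (conv x y) w 0 := by
  have hL' : ((√L : ℝ) : ℂ) ≠ 0 := Complex.ofReal_ne_zero.2 (Real.sqrt_pos.2 hL).ne'
  have hs : (L : ℂ) = ((√L : ℝ) : ℂ) ^ 2 := by rw [← Complex.ofReal_pow, Real.sq_sqrt hL.le]
  have e : ∀ t : ℝ, ((fourierFun bc L x t * fourierFun bc L y t * fourierFun bc L w t : ℝ) : ℂ)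
      = modeSum bc L (conv (conv x y) w) t / ((√L : ℝ) : ℂ) ^ 3 := by
    intro t
    rw [Complex.ofReal_mul, Complex.ofReal_mul, ofReal_fourierFun hx, ofReal_fourierFun hy,
      ofReal_fourierFun hw, ← modeSum_mul (summable_norm_conv hx1 hy1) hw1, ← modeSum_mul hx1 hy1]
    field_simp
  rw [Complex.ofReal_mul, ← intervalIntegral.integral_ofReal]
  simp_rw [e]
  rw [intervalIntegral.integral_div,
    integral_modeSum hL (summable_norm_conv (summable_norm_conv hx1 hy1) hw1)
    fun hb => conv_neg_of_even (conv_neg_of_even (hx.2 hb) (hy.2 hb)) (hw.2 hb), hs]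
  field_simp

theorem integral_fourierFun_pow_four (hL : 0 < L) (hz : Admissible bc z)
    (hz1 : Summable fun k => ‖z k‖) :
    ((L * ∫ t in (0 : ℝ)..L, fourierFun bc L z t ^ 4 : ℝ) : ℂ) = conv (conv z z) (conv z z) 0 := by
  have hL' : ((√L : ℝ) : ℂ) ≠ 0 := Complex.ofReal_ne_zero.2 (Real.sqrt_pos.2 hL).ne'
  have hs : (L : ℂ) = ((√L : ℝ) : ℂ) ^ 2 := by rw [← Complex.ofReal_pow, Real.sq_sqrt hL.le]
  have hc := summable_norm_conv hz1 hz1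
  have e : ∀ t : ℝ, ((fourierFun bc L z t ^ 4 : ℝ) : ℂ)
      = modeSum bc L (conv (conv z z) (conv z z)) t / ((√L : ℝ) : ℂ) ^ 4 := by
    intro t
    rw [Complex.ofReal_pow, ofReal_fourierFun hz, ← modeSum_mul hc hc, ← modeSum_mul hz1 hz1]
    field_simp
  rw [Complex.ofReal_mul, ← intervalIntegral.integral_ofReal]
  simp_rw [e]
  rw [intervalIntegral.integral_div, integral_modeSum hL (summable_norm_conv hc hc)
    fun hb => conv_neg_of_even (conv_neg_of_even (hz.2 hb) (hz.2 hb))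
      (conv_neg_of_even (hz.2 hb) (hz.2 hb)), hs]
  field_simp

end Series

end NormalForm

/-! ### Quartic forms on quadruples of indices with sum zero. -/

namespace NormalForm

section Quartic

variable {z : ℤ → ℂ}

/-- The quartic form with coefficients `t`, a sum over quadruples of integers with sum `0`. -/
noncomputable def quarticForm (t : ℤ → ℤ → ℤ → ℤ → ℝ) (z : ℤ → ℂ) : ℂ :=
  ∑' p : ℤ × ℤ × ℤ, (t p.1 p.2.1 p.2.2 (-(p.1 + p.2.1 + p.2.2)) : ℂ) *
    (z p.1 * z p.2.1 * z p.2.2 * z (-(p.1 + p.2.1 + p.2.2)))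

theorem summable_pair (hz : Summable fun k => ‖z k‖) :
    Summable fun p : ℤ × ℤ => ‖z p.1‖ * ‖z p.2‖ := by
  have h := Summable.mul_of_nonneg hz hz (fun k => norm_nonneg _) (fun k => norm_nonneg _)
  refine h.congr fun p => ?_
  rfl

theorem summable_triple_norm (hz : Summable fun k => ‖z k‖) :
    Summable fun p : ℤ × ℤ × ℤ => ‖z p.1‖ * (‖z p.2.1‖ * ‖z p.2.2‖) := by
  have h := Summable.mul_of_nonneg hz (summable_pair hz) (fun k => norm_nonneg _)
    (fun k => mul_nonneg (norm_nonneg _) (norm_nonneg _))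
  refine h.congr fun p => ?_
  rfl

theorem summable_quartic (hz : Summable fun k => ‖z k‖) {t : ℤ → ℤ → ℤ → ℤ → ℝ} {M : ℝ}
    (ht : ∀ i j k l, |t i j k l| ≤ M) :
    Summable fun p : ℤ × ℤ × ℤ => (t p.1 p.2.1 p.2.2 (-(p.1 + p.2.1 + p.2.2)) : ℂ) *
      (z p.1 * z p.2.1 * z p.2.2 * z (-(p.1 + p.2.1 + p.2.2))) := by
  have hM : 0 ≤ M := (abs_nonneg _).trans (ht 0 0 0 0)
  refine Summable.of_norm_bounded ((summable_triple_norm hz).mul_left (M * ∑' k, ‖z k‖)) fun p => ?_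
  have h1 : ‖z (-(p.1 + p.2.1 + p.2.2))‖ ≤ ∑' k, ‖z k‖ := hz.le_tsum _ fun _ _ => norm_nonneg _
  rw [norm_mul, norm_mul, norm_mul, norm_mul, Complex.norm_real, Real.norm_eq_abs]
  calc _ ≤ M * (‖z p.1‖ * ‖z p.2.1‖ * ‖z p.2.2‖ * ∑' k, ‖z k‖) :=
        mul_le_mul (ht _ _ _ _) (mul_le_mul_of_nonneg_left h1 (by positivity)) (by positivity) hM
    _ = _ := by ring

theorem quarticForm_add (hz : Summable fun k => ‖z k‖) {t u : ℤ → ℤ → ℤ → ℤ → ℝ} {M N : ℝ}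
    (ht : ∀ i j k l, |t i j k l| ≤ M) (hu : ∀ i j k l, |u i j k l| ≤ N) :
    quarticForm (fun i j k l => t i j k l + u i j k l) z = quarticForm t z + quarticForm u z := by
  unfold quarticForm
  rw [← (summable_quartic hz ht).tsum_add (summable_quartic hz hu)]
  exact tsum_congr fun p => by push_cast; ring

theorem quarticForm_mul_left (c : ℝ) (t : ℤ → ℤ → ℤ → ℤ → ℝ) :
    quarticForm (fun i j k l => c * t i j k l) z = c * quarticForm t z := by
  unfold quarticForm
  rw [← tsum_mul_left]
  exact tsum_congr fun p => by push_cast; ring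

/-- The cyclic permutation of the quadruples of integers with sum `0`. -/
@[simps]
def rotThree : ℤ × ℤ × ℤ ≃ ℤ × ℤ × ℤ where
  toFun p := (p.2.1, p.2.2, -(p.1 + p.2.1 + p.2.2))
  invFun p := (-(p.1 + p.2.1 + p.2.2), p.1, p.2.1)
  left_inv p := by ext <;> simp
  right_inv p := by ext <;> simp; ring

/-- The monomial and the constraint are invariant under cyclic relabelling, so only the symmetrized
coefficients matter. -/
theorem quarticForm_rot (t : ℤ → ℤ → ℤ → ℤ → ℝ) :
    quarticForm (fun i j k l => t j k l i) z = quarticForm t z := by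
  unfold quarticForm
  rw [← rotThree.tsum_eq (fun p : ℤ × ℤ × ℤ => (t p.1 p.2.1 p.2.2 (-(p.1 + p.2.1 + p.2.2)) : ℂ) *
    (z p.1 * z p.2.1 * z p.2.2 * z (-(p.1 + p.2.1 + p.2.2))))]
  refine tsum_congr fun p => ?_
  have : -(p.2.1 + p.2.2 + -(p.1 + p.2.1 + p.2.2)) = p.1 := by ring
  simp only [rotThree_apply, this]
  ring

/-- The bijection `(k, i, l) ↦ (i, k - i, l)`. -/
@[simps]
def shearTwo : ℤ × ℤ × ℤ ≃ ℤ × ℤ × ℤ where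
  toFun p := (p.2.1, p.1 - p.2.1, p.2.2)
  invFun p := (p.1 + p.2.1, p.1, p.2.2)
  left_inv p := by ext <;> simp
  right_inv p := by ext <;> simp

/-- The bijection `(k, i, j) ↦ (i, j, k - i - j)`. -/
@[simps]
def shearThree : ℤ × ℤ × ℤ ≃ ℤ × ℤ × ℤ where
  toFun p := (p.2.1, p.2.2, p.1 - p.2.1 - p.2.2)
  invFun p := (p.1 + p.2.1 + p.2.2, p.1, p.2.1)
  left_inv p := by ext <;> simp
  right_inv p := by ext <;> simp; ring

theorem summable_biConv_of_summable {K : ℤ → ℤ → ℝ} {M : ℝ} (hK : ∀ i j, |K i j| ≤ M)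
    (hz : Summable fun k => ‖z k‖) (k : ℤ) :
    Summable fun j => ‖(K j (k - j) : ℂ) * z j * z (k - j)‖ :=
  Summable.of_nonneg_of_le (fun _ => norm_nonneg _) (norm_biConv_term_le hK z z k)
    (((summable_shear hz hz).prod_factor k).mul_left M)

theorem tsum_eq_tsum_tsum {α β γ : Type*} {f : γ → ℂ} (hf : Summable f) (e : α × β ≃ γ) :
    ∑' c, f c = ∑' a, ∑' b, f (e (a, b)) := by
  have hs : Summable fun p => f (e p) := hf.comp_injective e.injective
  rw [← e.tsum_eq f, hs.tsum_prod' fun a => hs.prod_factor a]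

/-- The outer index is the sum of the first pair and minus the sum of the second; `shearTwo` trades
it for a free index of the quadruple. -/
theorem tsum_biConv_mul_biConv (hz : Summable fun k => ‖z k‖) {m : ℤ → ℝ} {K K' : ℤ → ℤ → ℝ}
    {M N N' : ℝ} (hm : ∀ k, |m k| ≤ M) (hK : ∀ i j, |K i j| ≤ N) (hK' : ∀ i j, |K' i j| ≤ N') :
    ∑' k, (m k : ℂ) * biConv K z z k * biConv K' z z (-k)
      = quarticForm (fun i j k l => m (i + j) * (K i j * K' k l)) z := by
  have hM : 0 ≤ M := (abs_nonneg _).trans (hm 0)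
  have hN : 0 ≤ N := (abs_nonneg _).trans (hK 0 0)
  have hs := summable_quartic (t := fun i j k l => m (i + j) * (K i j * K' k l))
    (M := M * (N * N')) hz fun i j k l => by
      rw [abs_mul, abs_mul]
      exact mul_le_mul (hm _) (mul_le_mul (hK _ _) (hK' _ _) (abs_nonneg _) hN) (by positivity) hM
  refine (tsum_congr fun k => ?_).trans (tsum_eq_tsum_tsum hs shearTwo).symm
  rw [mul_assoc, biConv, biConv, tsum_mul_tsum_of_summable_norm
    (summable_biConv_of_summable hK hz k) (summable_biConv_of_summable hK' hz (-k)),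
    ← tsum_mul_left]
  refine tsum_congr fun p => ?_
  have e1 : p.1 + (k - p.1) = k := by ring
  have e2 : -(k + p.2) = -k - p.2 := by ring
  simp only [shearTwo_apply, e1, e2]
  push_cast; ring

theorem tsum_triConv_mul (hz : Summable fun k => ‖z k‖) {m : ℤ → ℝ} {T : ℤ → ℤ → ℤ → ℝ}
    {M N : ℝ} (hm : ∀ k, |m k| ≤ M) (hT : ∀ i j k, |T i j k| ≤ N) :
    ∑' k, (m k : ℂ) * triConv T z z z k * z (-k)
      = quarticForm (fun i j k l => m (-l) * T i j k) z := by
  have hM : 0 ≤ M := (abs_nonneg _).trans (hm 0)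
  have hs := summable_quartic (t := fun i j k l => m (-l) * T i j k)
    (M := M * N) hz fun i j k l => by
      rw [abs_mul]
      exact mul_le_mul (hm _) (hT _ _ _) (by positivity) hM
  refine (tsum_congr fun k => ?_).trans (tsum_eq_tsum_tsum hs shearThree).symm
  rw [triConv, ← tsum_mul_left, ← tsum_mul_right]
  refine tsum_congr fun p => ?_
  have e1 : p.1 + p.2 + (k - p.1 - p.2) = k := by ring
  simp only [shearThree_apply, e1, neg_neg]
  push_cast; ring

theorem tsum_biConv_mul (hz : Summable fun k => ‖z k‖) {m : ℤ → ℝ} {K : ℤ → ℤ → ℝ}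
    {M N : ℝ} (hm : ∀ k, |m k| ≤ M) (hK : ∀ i j, |K i j| ≤ N) :
    (Summable fun p : ℤ × ℤ => ((m (p.1 + p.2) * K p.1 p.2 : ℝ) : ℂ) *
      (z p.1 * z p.2 * z (-(p.1 + p.2)))) ∧
    ∑' k, (m k : ℂ) * biConv K z z k * z (-k)
      = ∑' p : ℤ × ℤ, ((m (p.1 + p.2) * K p.1 p.2 : ℝ) : ℂ) *
        (z p.1 * z p.2 * z (-(p.1 + p.2))) := by
  have hM : 0 ≤ M := (abs_nonneg _).trans (hm 0)
  have hs : Summable fun p : ℤ × ℤ => ((m (p.1 + p.2) * K p.1 p.2 : ℝ) : ℂ) *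
      (z p.1 * z p.2 * z (-(p.1 + p.2))) := by
    refine Summable.of_norm_bounded ((summable_pair hz).mul_left (M * N * ∑' k, ‖z k‖)) fun p => ?_
    have h1 : ‖z (-(p.1 + p.2))‖ ≤ ∑' k, ‖z k‖ := hz.le_tsum _ fun _ _ => norm_nonneg _
    rw [norm_mul, norm_mul, norm_mul, Complex.norm_real, Real.norm_eq_abs, abs_mul]
    calc _ ≤ M * N * (‖z p.1‖ * ‖z p.2‖ * ∑' k, ‖z k‖) :=
          mul_le_mul (mul_le_mul (hm _) (hK _ _) (abs_nonneg _) hM)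
            (mul_le_mul_of_nonneg_left h1 (by positivity)) (by positivity)
            (mul_nonneg hM ((abs_nonneg _).trans (hK 0 0)))
      _ = _ := by ring
  refine ⟨hs, ?_⟩
  refine (tsum_congr fun k => ?_).trans (tsum_eq_tsum_tsum hs shear).symm
  rw [biConv, ← tsum_mul_left, ← tsum_mul_right]
  refine tsum_congr fun p => ?_
  have e1 : p + (k - p) = k := by ring
  simp only [shear_apply, e1]
  push_cast; ring

theorem conv_eq_biConv (x y : ℤ → ℂ) : conv x y = biConv (fun _ _ => 1) x y := by
  funext k
  simp [conv, biConv]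

end Quartic

/-! ### Cancellation of the cubic part and of the nonresonant quartic part. -/

section Identities

variable {bc : BoundaryCondition} {L a₃ a₄ C : ℝ} {z : ℤ → ℂ}

/-- Since `mu` vanishes at `±1`, this stays true when `λ_{±1} = 0`. -/
theorem lam_mul_mu (hlam : ∀ k : ℤ, k ≠ 1 → k ≠ -1 → lam bc L k ≠ 0) (k : ℤ) :
    lam bc L k * mu bc L k = nres k := by
  unfold mu nres
  split_ifs with h
  · simp
  · push Not at h
    exact mul_one_div_cancel (hlam k h.1 h.2)

theorem lam_mul_mu_mul_mu (hlam : ∀ k : ℤ, k ≠ 1 → k ≠ -1 → lam bc L k ≠ 0) (k : ℤ) :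
    lam bc L k * mu bc L k * mu bc L k = mu bc L k := by
  rw [lam_mul_mu hlam, mu, ← mul_div_assoc, nres_mul_self]

theorem lam_mul_nfTwo (hlam : ∀ k : ℤ, k ≠ 1 → k ≠ -1 → lam bc L k ≠ 0) (k : ℤ) :
    (lam bc L k : ℂ) * nfTwo bc L a₃ z k = -(a₃ : ℂ) * ((nres k : ℂ) * biConv kernelTwo z z k) := by
  rw [nfTwo, ← lam_mul_mu hlam]; push_cast; ring

theorem lam_mul_nfThree (hlam : ∀ k : ℤ, k ≠ 1 → k ≠ -1 → lam bc L k ≠ 0) (k : ℤ) :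
    (lam bc L k : ℂ) * nfThree bc L a₃ a₄ z k
      = -((nres k : ℂ) * triConv (kernelThree bc L a₃ a₄) z z z k) := by
  rw [nfThree, ← lam_mul_mu hlam]; push_cast; ring

theorem abs_nres_le (k : ℤ) : |nres k| ≤ 1 := by
  rcases nres_zero_or_one k with h | h <;> simp [h]

/-- A sum of three numbers `±1` is odd, hence not zero, so the denominator does not vanish: there is
no cubic resonance. -/
theorem cThree_mul_sum {i j k : ℤ} (h : i + j + k = 0) :
    cThree i j k * (nres i + nres j + nres k) = 1 := by
  have h0 : nres i + nres j + nres k ≠ 0 := by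
    intro h0
    have hi := nres_nonneg i
    have hj := nres_nonneg j
    have hk := nres_nonneg k
    have e : ∀ n : ℤ, nres n = 0 → n = 1 ∨ n = -1 := fun n hn => by
      by_contra hc
      simp [nres, hc] at hn
    have := e i (by linarith)
    have := e j (by linarith)
    have := e k (by linarith)
    omega
  rw [cThree, one_div, inv_mul_cancel₀ h0]

/-- The quadratic part of the transformation removes the cubic part of the potential. -/
theorem cubic_identity (hlam : ∀ k : ℤ, k ≠ 1 → k ≠ -1 → lam bc L k ≠ 0)
    (hz : Summable fun k => ‖z k‖) :
    (a₃ : ℂ) / 3 * conv (conv z z) z 0 + ∑' k, (lam bc L k : ℂ) * nfTwo bc L a₃ z k * z (-k) = 0 := by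
  obtain ⟨hs, e1⟩ := tsum_biConv_mul hz abs_nres_le abs_kernelTwo_le
  obtain ⟨-, e2⟩ := tsum_biConv_mul (m := fun _ => 1) (K := fun _ _ => 1) (M := 1) (N := 1) hz
    (by simp) (by simp)
  have h2 : conv (conv z z) z 0 = ∑' p : ℤ × ℤ, z p.1 * z p.2 * z (-(p.1 + p.2)) := by
    rw [conv, conv_eq_biConv z z]
    simpa using e2
  have h1 : ∑' k, (lam bc L k : ℂ) * nfTwo bc L a₃ z k * z (-k) =
      -(a₃ : ℂ) * ∑' k, (nres k : ℂ) * biConv kernelTwo z z k * z (-k) := by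
    rw [← tsum_mul_left]
    exact tsum_congr fun k => by rw [lam_mul_nfTwo hlam]; ring
  rw [h1, e1]
  set f : ℤ × ℤ → ℂ := fun p => ((nres (p.1 + p.2) * kernelTwo p.1 p.2 : ℝ) : ℂ) *
        (z p.1 * z p.2 * z (-(p.1 + p.2))) with hf
  have hs1 : Summable fun p => f (rotTwo 0 p) := hs.comp_injective (rotTwo 0).injective
  have hs2 : Summable fun p => f (((rotTwo 0).trans (rotTwo 0)) p) :=
    hs.comp_injective ((rotTwo 0).trans (rotTwo 0)).injective
  -- The three rotations put `nres` on each index in turn while the weight is symmetric, so the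
  -- coefficients add up to `cThree_mul_sum`, that is, to `1`.
  have h3 : 3 * ∑' p, f p = ∑' p : ℤ × ℤ, z p.1 * z p.2 * z (-(p.1 + p.2)) := by
    calc 3 * ∑' p, f p = ∑' p, f p + ∑' p, f (rotTwo 0 p) +
          ∑' p, f ((rotTwo 0).trans (rotTwo 0) p) := by
            rw [Equiv.tsum_eq (rotTwo 0) f, Equiv.tsum_eq ((rotTwo 0).trans (rotTwo 0)) f]; ring
      _ = ∑' p, (f p + f (rotTwo 0 p) + f ((rotTwo 0).trans (rotTwo 0) p)) := by
            rw [Summable.tsum_add (hs.add hs1) hs2, Summable.tsum_add hs hs1]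
      _ = _ := by
            refine tsum_congr fun p => ?_
            have a1 : 0 - p.1 - p.2 = -(p.1 + p.2) := by ring
            have a2 : p.2 + -(p.1 + p.2) = -p.1 := by ring
            have a3 : 0 - p.2 - -(p.1 + p.2) = p.1 := by ring
            have a4 : -(p.1 + p.2) + p.1 = -p.2 := by ring
            have key := cThree_mul_sum (i := p.1) (j := p.2) (k := -(p.1 + p.2)) (by ring)
            simp only [hf, Equiv.trans_apply, rotTwo_apply, a1, a2, a3, a4, nres_neg, kernelTwo,
              neg_neg, cThree] at key ⊢
            have b1 : nres p.2 + nres (p.1 + p.2) + nres p.1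
              = nres p.1 + nres p.2 + nres (p.1 + p.2) := by ring
            have b2 : nres (p.1 + p.2) + nres p.1 + nres p.2
              = nres p.1 + nres p.2 + nres (p.1 + p.2) := by ring
            rw [b1, b2]
            have key' := congrArg (fun r : ℝ => (r : ℂ)) key
            push_cast at key' ⊢
            linear_combination (z p.1 * z p.2 * z (-(p.1 + p.2))) * key'
  rw [h2, ← h3]; ring

theorem cFour_rot (i j k l : ℤ) : cFour j k l i = cFour i j k l := by
  unfold cFour; congr 1; ring

/-- Rotation invariance moves the cyclic symmetrization from `t` onto the factor `nres`; the weight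
`cFour` is itself invariant. -/
theorem quarticForm_kernelThree (hz : Summable fun k => ‖z k‖) {t : ℤ → ℤ → ℤ → ℤ → ℝ} {M : ℝ}
    (ht : ∀ i j k l, |t i j k l| ≤ M) :
    quarticForm (fun i j k l => nres l * (cFour i j k l *
      (t i j k l + t j k l i + t k l i j + t l i j k))) z
      = quarticForm (fun i j k l => cFour i j k l * (nres i + nres j + nres k + nres l) *
        t i j k l) z := by
  have hb : ∀ (n : ℤ → ℤ → ℤ → ℤ → ℤ) (u : ℤ → ℤ → ℤ → ℤ → ℝ), (∀ i j k l, |u i j k l| ≤ M) →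
      ∀ i j k l, |nres (n i j k l) * (cFour i j k l * u i j k l)| ≤ M := by
    intro n u hu i j k l
    rw [abs_mul, abs_mul]
    refine (mul_le_of_le_one_left (by positivity) (abs_nres_le _)).trans ?_
    exact (mul_le_of_le_one_left (by positivity) (abs_cFour_le _ _ _ _)).trans (hu i j k l)
  set n : ℤ → ℤ → ℤ → ℤ → ℤ := fun _ _ _ l => l
  have b1 := hb n t ht
  have b2 := hb n (fun i j k l => t j k l i) fun i j k l => ht _ _ _ _
  have b3 := hb n (fun i j k l => t k l i j) fun i j k l => ht _ _ _ _
  have b4 := hb n (fun i j k l => t l i j k) fun i j k l => ht _ _ _ _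
  have c2 := hb (fun _ _ k _ => k) t ht
  have c3 := hb (fun _ j _ _ => j) t ht
  have c4 := hb (fun i _ _ _ => i) t ht
  have b12 := fun i j k l => (abs_add_le _ _).trans (add_le_add (b1 i j k l) (b2 i j k l))
  have b123 := fun i j k l => (abs_add_le _ _).trans (add_le_add (b12 i j k l) (b3 i j k l))
  have c12 := fun i j k l => (abs_add_le _ _).trans (add_le_add (b1 i j k l) (c2 i j k l))
  have c123 := fun i j k l => (abs_add_le _ _).trans (add_le_add (c12 i j k l) (c3 i j k l))
  have e1 := quarticForm_add hz b123 b4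
  have e2 := quarticForm_add hz b12 b3
  have e3 := quarticForm_add hz b1 b2
  have f1 := quarticForm_add hz c123 c4
  have f2 := quarticForm_add hz c12 c3
  have f3 := quarticForm_add hz b1 c2
  have r2 := quarticForm_rot (z := z) (fun i j k l => nres k * (cFour i j k l * t i j k l))
  have r3 := quarticForm_rot (z := z) (fun i j k l => nres j * (cFour i j k l * t i j k l))
  have r3' := quarticForm_rot (z := z) (fun i j k l => nres k * (cFour j k l i * t j k l i))
  have r4 := quarticForm_rot (z := z) (fun i j k l => nres i * (cFour i j k l * t i j k l))
  have r4' := quarticForm_rot (z := z) (fun i j k l => nres j * (cFour j k l i * t j k l i))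
  have r4'' := quarticForm_rot (z := z) (fun i j k l => nres k * (cFour k l i j * t k l i j))
  simp only [cFour_rot] at r2 r3 r3' r4 r4' r4''
  have g1 : (fun i j k l => nres l * (cFour i j k l *
      (t i j k l + t j k l i + t k l i j + t l i j k))) = fun i j k l =>
      nres (n i j k l) * (cFour i j k l * t i j k l) +
      nres (n i j k l) * (cFour i j k l * t j k l i) +
      nres (n i j k l) * (cFour i j k l * t k l i j) +
      nres (n i j k l) * (cFour i j k l * t l i j k) := by
    funext i j k l; simp only [n]; ring
  have g2 : (fun i j k l => cFour i j k l * (nres i + nres j + nres k + nres l) *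
        t i j k l) = fun i j k l =>
      nres (n i j k l) * (cFour i j k l * t i j k l) +
      nres k * (cFour i j k l * t i j k l) +
      nres j * (cFour i j k l * t i j k l) +
      nres i * (cFour i j k l * t i j k l) := by
    funext i j k l; simp only [n]; ring
  rw [g1, g2, e1, e2, e3, f1, f2, f3]
  simp only [n]
  rw [r2, r3', r3, r4'', r4', r4]

/-- Both sides are the indicator of all four indices being `±1`, the only case in which the weight
times the count is `0` and not `1`. -/
theorem one_sub_cFour_mul_sum (i j k l : ℤ) :
    1 - cFour i j k l * (nres i + nres j + nres k + nres l)
      = (1 - nres i) * (1 - nres j) * (1 - nres k) * (1 - nres l) := by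
  unfold cFour
  rcases nres_zero_or_one i with h | h <;> rcases nres_zero_or_one j with h' | h' <;>
    rcases nres_zero_or_one k with h'' | h'' <;> rcases nres_zero_or_one l with h₃ | h₃ <;>
    rw [h, h', h'', h₃] <;> norm_num

/-- Of the eight choices of three signs, two force the fourth index to be `±3` and vanish. Two of
the other six begin with equal signs and give `-a₃²/(2λ₂) + a₄/4` each; four begin with opposite
signs and give `a₃²/2 + a₄/4` each, because `λ₀ = -1`. -/
theorem quarticForm_resonant (a₃ a₄ : ℝ) (z : ℤ → ℂ) :
    quarticForm (fun i j k l => (1 - nres i) * (1 - nres j) * (1 - nres k) * (1 - nres l) *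
      quarticCoeff bc L a₃ a₄ i j k l) z = (coeffFour bc L a₃ a₄ : ℂ) * z 1 ^ 2 * z (-1) ^ 2 := by
  have n1 : nres 1 = 0 := by simp [nres]
  have n0 : nres 0 = 1 := by simp [nres]
  have n2 : nres 2 = 1 := by simp [nres]
  have n3 : nres 3 = 1 := by simp [nres]
  have hne : ∀ k : ℤ, k ∉ ({1, -1} : Finset ℤ) → nres k = 1 := fun k hk => by
    have : ¬(k = 1 ∨ k = -1) := by simpa using hk
    simp [nres, this]
  unfold quarticForm
  rw [tsum_eq_sum (s := ({1, -1} : Finset ℤ) ×ˢ (({1, -1} : Finset ℤ) ×ˢ ({1, -1} : Finset ℤ)))]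
  · have hl0 : lam bc L 0 = -1 := by simp [lam, nu]
    have m0 : mu bc L 0 = -1 := by rw [mu, n0, hl0]; norm_num
    have m2 : mu bc L 2 = 1 / lam bc L 2 := by rw [mu, n2]
    have hne' : (1 : ℤ) ∉ ({-1} : Finset ℤ) := by decide
    simp only [Finset.sum_product, Finset.sum_insert hne', Finset.sum_singleton]
    norm_num only [nres_neg, n1, n0, n2, n3]
    simp only [quarticCoeff, kernelTwo, cThree]
    norm_num only [nres_neg, n1, n0, n2, n3, mu_neg, m0, m2, coeffFour, hl0]
    push_cast
    ring
  · rintro ⟨i, j, k⟩ hp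
    simp only [Finset.mem_product, not_and_or] at hp
    rcases hp with h | h | h <;> simp [hne _ h]

theorem abs_mu_le (hμ : ∀ k, |mu bc L k| ≤ C * rho k) (k : ℤ) : |mu bc L k| ≤ C :=
  (hμ k).trans (mul_le_of_le_one_right
    (nonneg_of_mul_nonneg_left ((abs_nonneg _).trans (hμ 0)) (rho_pos 0)) (rho_le_one _))

/-- The three terms come from the quadratic form at `g₂`, from the cubic term with one factor
replaced by `g₂`, and from the quartic term of `U`. -/
theorem quarticForm_quarticCoeff (hμ : ∀ k, |mu bc L k| ≤ C) (hz : Summable fun k => ‖z k‖) :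
    quarticForm (quarticCoeff bc L a₃ a₄) z =
      a₃ ^ 2 / 2 * quarticForm (fun i j k l => mu bc L (i + j) * (kernelTwo i j * kernelTwo k l)) z
      - a₃ ^ 2 * quarticForm (fun i j _ _ => mu bc L (i + j) * (kernelTwo i j * 1)) z
      + a₄ / 4 * quarticForm (fun _ _ _ _ => 1 * (1 * 1)) z := by
  have hC : 0 ≤ C := (abs_nonneg _).trans (hμ 0)
  have b1 : ∀ i j k l, |a₃ ^ 2 / 2 * (mu bc L (i + j) * (kernelTwo i j * kernelTwo k l))|
      ≤ |a₃ ^ 2 / 2| * (C * (1 * 1)) := fun i j k l => by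
    rw [abs_mul, abs_mul, abs_mul]
    exact mul_le_mul_of_nonneg_left (mul_le_mul (hμ _) (mul_le_mul (abs_kernelTwo_le _ _)
      (abs_kernelTwo_le _ _) (abs_nonneg _) zero_le_one) (by positivity) hC) (abs_nonneg _)
  have b2 : ∀ i j k l : ℤ, |-a₃ ^ 2 * (mu bc L (i + j) * (kernelTwo i j * 1))|
      ≤ |-a₃ ^ 2| * (C * (1 * 1)) := fun i j k l => by
    rw [abs_mul, abs_mul, abs_mul]
    exact mul_le_mul_of_nonneg_left (mul_le_mul (hμ _) (mul_le_mul (abs_kernelTwo_le _ _)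
      (by simp) (abs_nonneg _) zero_le_one) (by positivity) hC) (abs_nonneg _)
  have b3 : ∀ i j k l : ℤ, |a₄ / 4 * (1 * (1 * 1) : ℝ)| ≤ |a₄ / 4| := fun i j k l => by simp
  have b12 := fun i j k l => (abs_add_le _ _).trans (add_le_add (b1 i j k l) (b2 i j k l))
  have e : quarticCoeff bc L a₃ a₄ = fun i j k l =>
      a₃ ^ 2 / 2 * (mu bc L (i + j) * (kernelTwo i j * kernelTwo k l)) +
      -a₃ ^ 2 * (mu bc L (i + j) * (kernelTwo i j * 1)) + a₄ / 4 * (1 * (1 * 1)) := by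
    funext i j k l; unfold quarticCoeff; ring
  rw [e, quarticForm_add hz b12 b3, quarticForm_add hz b1 b2, quarticForm_mul_left,
    quarticForm_mul_left, quarticForm_mul_left]
  push_cast; ring

/-- The transformation removes all nonresonant terms of the quartic part of the potential. -/
theorem quartic_identity (hlam : ∀ k : ℤ, k ≠ 1 → k ≠ -1 → lam bc L k ≠ 0)
    (hμ : ∀ k, |mu bc L k| ≤ C * rho k) (hz : Summable fun k => ‖z k‖) :
    1 / 2 * ∑' k, (lam bc L k : ℂ) * nfTwo bc L a₃ z k * nfTwo bc L a₃ z (-k)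
      + a₃ * conv (conv z z) (nfTwo bc L a₃ z) 0 + a₄ / 4 * conv (conv z z) (conv z z) 0
      + ∑' k, (lam bc L k : ℂ) * nfThree bc L a₃ a₄ z k * z (-k)
      = (coeffFour bc L a₃ a₄ : ℂ) * z 1 ^ 2 * z (-1) ^ 2 := by
  have hμ' := abs_mu_le hμ
  have one_bd : ∀ i j : ℤ, |(1 : ℝ)| ≤ 1 := by simp
  have eA : ∑' k, (lam bc L k : ℂ) * nfTwo bc L a₃ z k * nfTwo bc L a₃ z (-k) =
      a₃ ^ 2 * quarticForm (fun i j k l => mu bc L (i + j) * (kernelTwo i j * kernelTwo k l)) z := by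
    rw [← tsum_biConv_mul_biConv hz hμ' abs_kernelTwo_le abs_kernelTwo_le, ← tsum_mul_left]
    refine tsum_congr fun k => ?_
    simp only [nfTwo, mu_neg]
    -- Each `g₂` carries a factor `mu`, and `λ_k` cancels one of the two.
    have h := congrArg (fun r : ℝ => (r : ℂ)) (lam_mul_mu_mul_mu hlam k)
    push_cast at h ⊢
    linear_combination (a₃ ^ 2 * biConv kernelTwo z z k * biConv kernelTwo z z (-k)) * h
  have eB : conv (conv z z) (nfTwo bc L a₃ z) 0 =
      -a₃ * quarticForm (fun i j _ _ => mu bc L (i + j) * (kernelTwo i j * 1)) z := by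
    rw [← tsum_biConv_mul_biConv hz hμ' abs_kernelTwo_le one_bd, ← tsum_mul_left,
      ← conv_eq_biConv, conv, ← (Equiv.neg ℤ).tsum_eq]
    refine tsum_congr fun k => ?_
    simp only [nfTwo, Equiv.neg_apply, zero_sub, neg_neg]
    push_cast; ring
  have eC : conv (conv z z) (conv z z) 0 = quarticForm (fun _ _ _ _ => 1 * (1 * 1)) z := by
    rw [← tsum_biConv_mul_biConv (m := fun _ => 1) (M := 1) hz (by simp) one_bd one_bd,
      ← conv_eq_biConv, conv]
    refine tsum_congr fun k => ?_
    simp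
  have ht := abs_quarticCoeff_le (a₃ := a₃) (a₄ := a₄) hμ
  have eE : ∑' k, (lam bc L k : ℂ) * nfThree bc L a₃ a₄ z k * z (-k) =
      -quarticForm (fun i j k l => cFour i j k l * (nres i + nres j + nres k + nres l) *
        quarticCoeff bc L a₃ a₄ i j k l) z := by
    rw [← quarticForm_kernelThree hz ht]
    have := tsum_triConv_mul hz abs_nres_le (abs_kernelThree_le (a₃ := a₃) (a₄ := a₄) hμ)
    have h2 : quarticForm (fun i j k l => nres (-l) * kernelThree bc L a₃ a₄ i j k) z =
        quarticForm (fun i j k l => nres l * (cFour i j k l * (quarticCoeff bc L a₃ a₄ i j k l +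
          quarticCoeff bc L a₃ a₄ j k l i + quarticCoeff bc L a₃ a₄ k l i j +
          quarticCoeff bc L a₃ a₄ l i j k))) z := by
      unfold quarticForm
      exact tsum_congr fun p => by simp only [kernelThree, quarticSum, nres_neg]
    rw [← h2, ← this, ← tsum_neg]
    exact tsum_congr fun k => by rw [lam_mul_nfThree hlam]; ring
  have eF : quarticForm (quarticCoeff bc L a₃ a₄) z =
      quarticForm (fun i j k l => cFour i j k l * (nres i + nres j + nres k + nres l) *
        quarticCoeff bc L a₃ a₄ i j k l) z + (coeffFour bc L a₃ a₄ : ℂ) * z 1 ^ 2 * z (-1) ^ 2 := by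
    set D := (2 * C + 1) / 4 * (4 * (a₃ ^ 2 + |a₄|))
    have hn : ∀ i, 0 ≤ 1 - nres i ∧ 1 - nres i ≤ 1 := fun i => by
      rcases nres_zero_or_one i with h | h <;> rw [h] <;> norm_num
    have hw : ∀ i j k l, 0 ≤ (1 - nres i) * (1 - nres j) * (1 - nres k) * (1 - nres l) ∧
        (1 - nres i) * (1 - nres j) * (1 - nres k) * (1 - nres l) ≤ 1 := fun i j k l =>
      ⟨mul_nonneg (mul_nonneg (mul_nonneg (hn i).1 (hn j).1) (hn k).1) (hn l).1,
        mul_le_one₀ (mul_le_one₀ (mul_le_one₀ (hn i).2 (hn j).1 (hn j).2) (hn k).1 (hn k).2)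
          (hn l).1 (hn l).2⟩
    have b2 : ∀ i j k l, |(1 - nres i) * (1 - nres j) * (1 - nres k) * (1 - nres l) *
        quarticCoeff bc L a₃ a₄ i j k l| ≤ D := fun i j k l => by
      rw [abs_mul, abs_of_nonneg (hw i j k l).1]
      exact (mul_le_of_le_one_left (abs_nonneg _) (hw i j k l).2).trans (ht i j k l)
    have b1 : ∀ i j k l, |cFour i j k l * (nres i + nres j + nres k + nres l) *
        quarticCoeff bc L a₃ a₄ i j k l| ≤ D := fun i j k l => by
      have h1 := one_sub_cFour_mul_sum i j k l
      have h2 := hw i j k l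
      rw [abs_mul]
      refine (mul_le_of_le_one_left (abs_nonneg _) ?_).trans (ht i j k l)
      rw [abs_le]; constructor <;> linarith [h2.1, h2.2]
    rw [← quarticForm_resonant, ← quarticForm_add hz b1 b2]
    congr 1
    funext i j k l
    rw [← one_sub_cFour_mul_sum]; ring
  rw [quarticForm_quarticCoeff hμ' hz] at eF
  rw [eA, eB, eC, eE]
  linear_combination eF

end Identities

end NormalForm

/-! ### Sobolev embedding of `H^s` into `L^q` by dyadic blocks. -/

namespace NormalForm

section Embedding

variable {bc : BoundaryCondition} {L s q : ℝ} {z : ℤ → ℂ}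

theorem Admissible.mul_neg (hz : Admissible bc z) (k : ℤ) :
    z k * z (-k) = ((‖z k‖ ^ 2 : ℝ) : ℂ) := by
  rw [hz.1, Complex.mul_conj']; push_cast; rfl

theorem integral_fourierFun_sq (hL : 0 < L) (hz : Admissible bc z)
    (hz1 : Summable fun k => ‖z k‖) :
    ∫ t in (0 : ℝ)..L, fourierFun bc L z t ^ 2 = ∑' k, ‖z k‖ ^ 2 := by
  have h := integral_fourierFun_mul hL hz hz hz1 hz1
  simp_rw [← sq] at h
  rw [← Complex.ofReal_inj, h, conv, Complex.ofReal_tsum]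
  exact tsum_congr fun k => by rw [zero_sub, hz.mul_neg]

/-- The dyadic block of a mode. -/
def dyadic (k : ℤ) : ℕ := Nat.log 2 (k.natAbs + 1)

/-- The restriction of a sequence to a dyadic block. -/
noncomputable def block (z : ℤ → ℂ) (j : ℕ) (k : ℤ) : ℂ := if dyadic k = j then z k else 0

theorem Admissible.block (hz : Admissible bc z) (j : ℕ) : Admissible bc (block z j) := by
  have hd : ∀ k, dyadic (-k) = dyadic k := fun k => by simp [dyadic]
  refine ⟨fun k => ?_, fun hb k => ?_⟩
  · simp only [NormalForm.block, hd, hz.1]; split_ifs <;> simp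
  · simp only [NormalForm.block, hd, hz.2 hb]

theorem block_eq_zero (z : ℤ → ℂ) {j : ℕ} {k : ℤ}
    (hk : k ∉ Finset.Icc (-(2 ^ (j + 1) : ℤ)) (2 ^ (j + 1))) : block z j k = 0 := by
  unfold block
  rw [if_neg]
  intro h
  apply hk
  have h1 : k.natAbs + 1 < 2 ^ (j + 1) := by
    rw [← h]; exact Nat.lt_pow_succ_log_self (by norm_num) _
  have h2 : (k.natAbs : ℤ) < 2 ^ (j + 1) := by
    have : k.natAbs < 2 ^ (j + 1) := by omega
    exact_mod_cast this
  rw [Finset.mem_Icc]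
  rw [Int.natCast_natAbs] at h2
  exact ⟨by linarith [neg_abs_le k], by linarith [le_abs_self k]⟩

/-- On block `j` one has `2^j ≤ |k| + 1`, hence `4^j ≤ 2 (1 + k²)`; raising this to the power `s ≤
1` costs at most the factor `2`. -/
theorem norm_sq_block_le (hs : 0 ≤ s) (hs1 : s ≤ 1) (z : ℤ → ℂ) (j : ℕ) (k : ℤ) :
    ‖block z j k‖ ^ 2 ≤ 2 * ((4 : ℝ) ^ (j * s))⁻¹ * ((1 + (k : ℝ) ^ 2) ^ s * ‖z k‖ ^ 2) := by
  unfold block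
  split_ifs with h
  · have h1 : 2 ^ j ≤ k.natAbs + 1 := by
      rw [← h]; exact Nat.pow_log_le_self 2 (by omega)
    have h2 : (2 : ℝ) ^ j ≤ |(k : ℝ)| + 1 := by
      have : ((2 ^ j : ℕ) : ℝ) ≤ ((k.natAbs + 1 : ℕ) : ℝ) := by exact_mod_cast h1
      push_cast at this
      rwa [Nat.cast_natAbs, Int.cast_abs] at this
    have h3 : (4 : ℝ) ^ j ≤ 2 * (1 + (k : ℝ) ^ 2) := by
      have e : (4 : ℝ) ^ j = (2 ^ j) ^ 2 := by rw [← pow_mul, mul_comm, pow_mul]; norm_num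
      rw [e, ← sq_abs (k : ℝ)]
      have : (0 : ℝ) < 2 ^ j := by positivity
      nlinarith [sq_nonneg (|(k : ℝ)| - 1)]
    have h4 : (4 : ℝ) ^ (j * s) ≤ 2 * (1 + (k : ℝ) ^ 2) ^ s := by
      rw [Real.rpow_mul (by norm_num), Real.rpow_natCast]
      refine (Real.rpow_le_rpow (by positivity) h3 hs).trans ?_
      rw [Real.mul_rpow (by norm_num) (one_add_sq_pos k).le]
      have : (2 : ℝ) ^ s ≤ 2 ^ (1 : ℝ) := Real.rpow_le_rpow_of_exponent_le (by norm_num) hs1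
      rw [Real.rpow_one] at this
      exact mul_le_mul_of_nonneg_right this (Real.rpow_nonneg (one_add_sq_pos k).le _)
    have h5 : (0 : ℝ) < 4 ^ (j * s) := Real.rpow_pos_of_pos (by norm_num) _
    have h6 : 1 ≤ 2 * ((4 : ℝ) ^ (j * s))⁻¹ * (1 + (k : ℝ) ^ 2) ^ s := by
      have : 2 * ((4 : ℝ) ^ (j * s))⁻¹ * (1 + (k : ℝ) ^ 2) ^ s
        = 2 * (1 + (k : ℝ) ^ 2) ^ s / 4 ^ (j * s) := by field_simp
      rw [this, one_le_div h5]; exact h4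
    calc ‖z k‖ ^ 2 = 1 * ‖z k‖ ^ 2 := by ring
      _ ≤ 2 * ((4 : ℝ) ^ (j * s))⁻¹ * (1 + (k : ℝ) ^ 2) ^ s * ‖z k‖ ^ 2 :=
          mul_le_mul_of_nonneg_right h6 (sq_nonneg _)
      _ = _ := by ring
  · have := weight_nonneg s z k
    simp only [norm_zero, ne_eq, OfNat.ofNat_ne_zero, not_false_eq_true, zero_pow]
    exact mul_nonneg (by positivity) this

theorem tsum_norm_sq_block_le (hs : 0 ≤ s) (hs1 : s ≤ 1) (hz : MemH s z) (j : ℕ) :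
    ∑' k, ‖block z j k‖ ^ 2 ≤ 2 * ((4 : ℝ) ^ (j * s))⁻¹ * normH s z ^ 2 := by
  rw [normH_sq, ← tsum_mul_left]
  exact Summable.tsum_le_tsum (norm_sq_block_le hs hs1 z j)
    (Summable.of_nonneg_of_le (fun _ => sq_nonneg _) (norm_sq_block_le hs hs1 z j)
      (hz.mul_left _)) (hz.mul_left _)

theorem summable_block (z : ℤ → ℂ) (j : ℕ) : Summable fun k => ‖block z j k‖ :=
  summable_of_ne_finset_zero fun k hk => by rw [block_eq_zero z hk, norm_zero]

/-- Bernstein's inequality: Cauchy-Schwarz over at most `8 * 2^j` modes, with `4² = 8 * 2`. -/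
theorem tsum_norm_block_le (hs : 0 ≤ s) (hs1 : s ≤ 1) (hz : MemH s z) (j : ℕ) :
    ∑' k, ‖block z j k‖ ≤ 4 * 2 ^ (j * (1 / 2 - s)) * normH s z := by
  set F := Finset.Icc (-(2 ^ (j + 1) : ℤ)) (2 ^ (j + 1)) with hF
  have h0 : 0 ≤ (4 : ℝ) * 2 ^ (j * (1 / 2 - s)) * normH s z :=
    mul_nonneg (by positivity) (normH_nonneg _ _)
  have hcard : (F.card : ℝ) ≤ 8 * 2 ^ j := by
    have h1 : F.card = 2 * 2 ^ (j + 1) + 1 := by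
      rw [hF, Int.card_Icc]
      have : (2 ^ (j + 1) + 1 - -2 ^ (j + 1) : ℤ) = ((2 * 2 ^ (j + 1) + 1 : ℕ) : ℤ) := by
        push_cast; ring
      rw [this, Int.toNat_natCast]
    rw [h1]; push_cast
    have : (1 : ℝ) ≤ 2 ^ j := one_le_pow₀ (by norm_num)
    rw [pow_succ]; linarith
  rw [tsum_eq_sum (s := F) fun k hk => by rw [block_eq_zero z hk, norm_zero]]
  refine (sq_le_sq₀ (Finset.sum_nonneg fun _ _ => norm_nonneg _) h0).1 ?_
  refine sq_sum_le_card_mul_sum_sq.trans ?_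
  have h2 : ∑ k ∈ F, ‖block z j k‖ ^ 2 ≤ 2 * ((4 : ℝ) ^ (j * s))⁻¹ * normH s z ^ 2 := by
    refine le_trans ?_ (tsum_norm_sq_block_le hs hs1 hz j)
    rw [tsum_eq_sum (s := F) fun k hk => by rw [block_eq_zero z hk]; simp]
  have e : ((2 : ℝ) ^ (j * (1 / 2 - s))) ^ 2 = 2 ^ j * ((4 : ℝ) ^ (j * s))⁻¹ := by
    have e4 : (4 : ℝ) = 2 ^ (2 : ℝ) := by norm_num
    rw [e4, ← Real.rpow_mul (by norm_num), ← Real.rpow_neg (by norm_num), ← Real.rpow_natCast,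
      ← Real.rpow_natCast, ← Real.rpow_mul (by norm_num), ← Real.rpow_add (by norm_num)]
    congr 1; push_cast; ring
  calc _ ≤ 8 * 2 ^ j * (2 * ((4 : ℝ) ^ (j * s))⁻¹ * normH s z ^ 2) :=
        mul_le_mul hcard h2 (Finset.sum_nonneg fun _ _ => sq_nonneg _) (by positivity)
    _ = (4 * 2 ^ (j * (1 / 2 - s)) * normH s z) ^ 2 := by
        rw [mul_pow, mul_pow, e]; ring

/-- Interpolation of `L^q` between the supremum bound on the block and Parseval in `L²`. The powers
of `2` combine to a geometric factor, which decays precisely for `s > 1/2 - 1/q`. -/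
theorem integral_block_rpow_le (hL : 0 < L) (hq : 2 ≤ q) (hs : 0 ≤ s) (hs1 : s ≤ 1)
    (hadm : Admissible bc z) (hz : MemH s z) (j : ℕ) :
    ∫ t in (0 : ℝ)..L, |fourierFun bc L (block z j) t| ^ q
      ≤ (4 / √L) ^ (q - 2) * 2 * normH s z ^ q * (((2 : ℝ) ^ (-(s - (1 / 2 - 1 / q)))) ^ j) ^ q := by
  have hb := summable_block z j
  have hN := normH_nonneg s z
  have hc := continuous_fourierFun (bc := bc) (L := L) hb
  set A := 4 / √L * (2 ^ (j * (1 / 2 - s)) * normH s z) with hA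
  have hA0 : 0 ≤ A := mul_nonneg (by positivity) (mul_nonneg (by positivity) hN)
  have hpt : ∀ t, |fourierFun bc L (block z j) t| ^ q
      ≤ A ^ (q - 2) * fourierFun bc L (block z j) t ^ 2 := fun t => by
    have h1 : |fourierFun bc L (block z j) t| ≤ A := by
      refine (abs_fourierFun_le hb t).trans ?_
      rw [hA]
      calc _ ≤ 4 * 2 ^ (j * (1 / 2 - s)) * normH s z / √L :=
            div_le_div_of_nonneg_right (tsum_norm_block_le hs hs1 hz j) (Real.sqrt_nonneg _)
        _ = _ := by ring
    have e : q = (q - 2) + 2 := by ring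
    rw [← sq_abs (fourierFun bc L (block z j) t)]
    nth_rewrite 1 [e]
    rw [Real.rpow_add_of_nonneg (abs_nonneg _) (by linarith) (by norm_num), Real.rpow_two]
    exact mul_le_mul_of_nonneg_right (Real.rpow_le_rpow (abs_nonneg _) h1 (by linarith))
      (sq_nonneg _)
  have hi : ∫ t in (0 : ℝ)..L, |fourierFun bc L (block z j) t| ^ q
      ≤ A ^ (q - 2) * ∑' k, ‖block z j k‖ ^ 2 := by
    rw [← integral_fourierFun_sq hL (hadm.block j) hb, ← intervalIntegral.integral_const_mul]
    refine intervalIntegral.integral_mono hL.le ?_ ?_ hpt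
    · exact (hc.abs.rpow_const fun _ => Or.inr (by linarith)).intervalIntegrable _ _
    · exact (continuous_const.mul (hc.pow 2)).intervalIntegrable _ _
  refine hi.trans ((mul_le_mul_of_nonneg_left (tsum_norm_sq_block_le hs hs1 hz j)
    (Real.rpow_nonneg hA0 _)).trans (le_of_eq ?_))
  have hq0 : q ≠ 0 := by linarith
  have e1 : (((2 : ℝ) ^ (j * (1 / 2 - s))) ^ (q - 2)) * ((4 : ℝ) ^ (j * s))⁻¹
      = (((2 : ℝ) ^ (-(s - (1 / 2 - 1 / q)))) ^ j) ^ q := by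
    have e4 : (4 : ℝ) = 2 ^ (2 : ℝ) := by norm_num
    rw [e4, ← Real.rpow_mul (by positivity), ← Real.rpow_mul (by positivity),
      ← Real.rpow_neg (by positivity), ← Real.rpow_natCast, ← Real.rpow_mul (by positivity),
      ← Real.rpow_mul (by positivity), ← Real.rpow_add (by positivity)]
    congr 1; field_simp; ring
  have e2 : normH s z ^ q = normH s z ^ (q - 2) * normH s z ^ 2 := by
    rw [← Real.rpow_two, ← Real.rpow_add_of_nonneg hN (by linarith) (by norm_num)]
    congr 1; ring
  rw [hA, Real.mul_rpow (by positivity) (mul_nonneg (by positivity) hN),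
    Real.mul_rpow (by positivity) hN, ← e1, e2]
  ring

/-- A substitute for Minkowski's inequality: Jensen for `x ↦ x^q` with weights proportional to
`θ^j`, chosen so that the decay of the blocks balances them. -/
theorem integral_sum_rpow_le {f : ℕ → ℝ → ℝ} (hf : ∀ j, Continuous (f j)) (hL : 0 < L)
    (hq : 1 ≤ q) {B θ : ℝ} (hθ : 0 < θ) (hθ1 : θ < 1) (hB : 0 ≤ B)
    (h : ∀ j, ∫ t in (0 : ℝ)..L, |f j t| ^ q ≤ B * (θ ^ j) ^ q) (n : ℕ) :
    ∫ t in (0 : ℝ)..L, |∑ j ∈ Finset.range n, f j t| ^ q ≤ B * (1 / (1 - θ)) ^ q := by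
  rcases Nat.eq_zero_or_pos n with rfl | hn
  · simp only [Finset.range_zero, Finset.sum_empty, abs_zero]
    rw [Real.zero_rpow (by linarith)]
    simp only [intervalIntegral.integral_zero]
    exact mul_nonneg hB (Real.rpow_nonneg (one_div_nonneg.2 (by linarith)) _)
  set P := ∑ j ∈ Finset.range n, θ ^ j with hP
  have hP0 : 0 < P := Finset.sum_pos (fun j _ => pow_pos hθ j) ⟨0, Finset.mem_range.2 hn⟩
  have hP1 : P ≤ 1 / (1 - θ) := by
    rw [one_div, ← tsum_geometric_of_lt_one hθ.le hθ1]
    exact (summable_geometric_of_lt_one hθ.le hθ1).sum_le_tsum _ fun j _ => (pow_pos hθ j).le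
  have hw : ∑ j ∈ Finset.range n, θ ^ j / P = 1 := by
    rw [← Finset.sum_div, div_self hP0.ne']
  have hpt : ∀ t, |∑ j ∈ Finset.range n, f j t| ^ q
      ≤ ∑ j ∈ Finset.range n, θ ^ j / P * ((P / θ ^ j) ^ q * |f j t| ^ q) := fun t => by
    have h1 := Real.rpow_arith_mean_le_arith_mean_rpow (Finset.range n) (fun j => θ ^ j / P)
      (fun j => P / θ ^ j * |f j t|) (fun j _ => by positivity) hw (fun j _ => by positivity) hq
    have h2 : ∑ j ∈ Finset.range n, θ ^ j / P * (P / θ ^ j * |f j t|)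
        = ∑ j ∈ Finset.range n, |f j t| := by
      refine Finset.sum_congr rfl fun j _ => ?_
      have := (pow_pos hθ j).ne'
      field_simp
    rw [h2] at h1
    refine (Real.rpow_le_rpow (abs_nonneg _) (Finset.abs_sum_le_sum_abs _ _) (by linarith)).trans
      (h1.trans (le_of_eq (Finset.sum_congr rfl fun j _ => ?_)))
    rw [Real.mul_rpow (by positivity) (abs_nonneg _)]
  have hcq : ∀ j, Continuous fun t => |f j t| ^ q := fun j =>
    (hf j).abs.rpow_const fun _ => Or.inr (by linarith)
  have hct : ∀ j, Continuous fun t => θ ^ j / P * ((P / θ ^ j) ^ q * |f j t| ^ q) := fun j =>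
    continuous_const.mul (continuous_const.mul (hcq j))
  have hi : ∫ t in (0 : ℝ)..L, |∑ j ∈ Finset.range n, f j t| ^ q
      ≤ ∑ j ∈ Finset.range n, ∫ t in (0 : ℝ)..L, θ ^ j / P * ((P / θ ^ j) ^ q * |f j t| ^ q) := by
    rw [← intervalIntegral.integral_finsetSum fun j _ => (hct j).intervalIntegrable _ _]
    refine intervalIntegral.integral_mono hL.le ?_ ?_ hpt
    · exact ((continuous_finsetSum _ fun j _ => hf j).abs.rpow_const
        fun _ => Or.inr (by linarith)).intervalIntegrable _ _
    · exact (continuous_finsetSum _ fun j _ => hct j).intervalIntegrable _ _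
  refine hi.trans ?_
  have hterm : ∀ j ∈ Finset.range n,
      ∫ t in (0 : ℝ)..L, θ ^ j / P * ((P / θ ^ j) ^ q * |f j t| ^ q) ≤ θ ^ j / P * (B * P ^ q) := by
    intro j _
    rw [intervalIntegral.integral_const_mul, intervalIntegral.integral_const_mul]
    refine mul_le_mul_of_nonneg_left ?_ (by positivity)
    calc _ ≤ (P / θ ^ j) ^ q * (B * (θ ^ j) ^ q) := mul_le_mul_of_nonneg_left (h j) (by positivity)
      _ = B * P ^ q := by
        have := (pow_pos hθ j)
        rw [Real.div_rpow hP0.le this.le]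
        field_simp
  refine (Finset.sum_le_sum hterm).trans ?_
  rw [← Finset.sum_mul, hw, one_mul]
  exact mul_le_mul_of_nonneg_left (Real.rpow_le_rpow hP0.le hP1 (by linarith)) hB

theorem fourierFun_sum_block (z : ℤ → ℂ) (n : ℕ) (t : ℝ) :
    fourierFun bc L (fun k => if dyadic k < n then z k else 0) t
      = ∑ j ∈ Finset.range n, fourierFun bc L (block z j) t := by
  have key : ∀ n : ℕ, (Summable fun k => ‖if dyadic k < n then z k else 0‖) ∧
      fourierFun bc L (fun k => if dyadic k < n then z k else 0) t
      = ∑ j ∈ Finset.range n, fourierFun bc L (block z j) t := by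
    intro n
    induction n with
    | zero => simp [fourierFun_eq, modeSum, summable_zero]
    | succ n ih =>
      have e : (fun k => if dyadic k < n + 1 then z k else 0)
          = (fun k => if dyadic k < n then z k else 0) + block z n := by
        funext k
        simp only [Pi.add_apply, block]
        rcases lt_trichotomy (dyadic k) n with h | h | h
        · rw [if_pos (by omega), if_pos h, if_neg (by omega), add_zero]
        · rw [if_pos (by omega), if_neg (by omega), if_pos h, zero_add]
        · rw [if_neg (by omega), if_neg (by omega), if_neg (by omega), add_zero]
      constructor
      · refine Summable.of_nonneg_of_le (fun _ => norm_nonneg _) (fun k => ?_)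
          (ih.1.add (summable_block z n))
        have := congrFun e k
        rw [this]
        exact norm_add_le _ _
      · rw [e, fourierFun_add ih.1 (summable_block z n), ih.2, Finset.sum_range_succ]
  exact (key n).2

theorem tendsto_fourierFun_truncation (hz : Summable fun k => ‖z k‖) (t : ℝ) :
    Tendsto (fun n : ℕ => fourierFun bc L (fun k => if dyadic k < n then z k else 0) t) atTop
      (𝓝 (fourierFun bc L z t)) := by
  have h : Tendsto (fun n : ℕ => modeSum bc L (fun k => if dyadic k < n then z k else 0) t) atTop
      (𝓝 (modeSum bc L z t)) := by
    refine tendsto_tsum_of_dominated_convergence hz (fun k => ?_)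
      (Eventually.of_forall fun n k => ?_)
    · refine Tendsto.congr' ?_ tendsto_const_nhds
      filter_upwards [eventually_gt_atTop (dyadic k)] with n hn
      rw [if_pos hn]
    · simp only [norm_mul, norm_mode, mul_one]
      split_ifs <;> simp
  simp_rw [fourierFun_eq]
  exact ((Complex.continuous_re.tendsto _).comp h).div_const _

/-- The Sobolev embedding of `H^s` into `L^q` for `s > 1/2 - 1/q`, on sequences with absolutely
convergent Fourier series. -/
theorem exists_integral_rpow_le (hL : 0 < L) (hq : 2 ≤ q) (hs1 : s ≤ 1)
    (hsq : 1 / 2 - 1 / q < s) :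
    ∃ C > 0, ∀ z : ℤ → ℂ, Admissible bc z → (Summable fun k => ‖z k‖) → MemH s z →
      ∫ t in (0 : ℝ)..L, |fourierFun bc L z t| ^ q ≤ C * normH s z ^ q := by
  have hs : 0 ≤ s := by
    have : 1 / q ≤ 1 / 2 := one_div_le_one_div_of_le (by norm_num) hq
    linarith
  set θ := (2 : ℝ) ^ (-(s - (1 / 2 - 1 / q))) with hθdef
  have hθ : 0 < θ := Real.rpow_pos_of_pos (by norm_num) _
  have hθ1 : θ < 1 := Real.rpow_lt_one_of_one_lt_of_neg (by norm_num) (by linarith)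
  have hsqL : 0 < √L := Real.sqrt_pos.2 hL
  have h1θ : 0 < 1 / (1 - θ) := one_div_pos.2 (by linarith)
  refine ⟨(4 / √L) ^ (q - 2) * 2 * (1 / (1 - θ)) ^ q, by positivity, fun z hadm hz1 hz => ?_⟩
  have hN := normH_nonneg s z
  have hb := fun n => integral_sum_rpow_le (f := fun j t => fourierFun bc L (block z j) t)
    (q := q) (fun j => continuous_fourierFun (summable_block z j)) hL (by linarith) hθ hθ1
    (B := (4 / √L) ^ (q - 2) * 2 * normH s z ^ q) (by positivity)
    (integral_block_rpow_le hL hq hs hs1 hadm hz) n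
  simp_rw [← fourierFun_sum_block] at hb
  have htr : ∀ n : ℕ, ∀ k, ‖if dyadic k < n then z k else 0‖ ≤ ‖z k‖ := fun n k => by
    split_ifs <;> simp
  have hsum : ∀ n : ℕ, Summable fun k => ‖if dyadic k < n then z k else 0‖ := fun n =>
    Summable.of_nonneg_of_le (fun _ => norm_nonneg _) (htr n) hz1
  -- The bound is uniform in the number of blocks; absolute convergence of the Fourier series
  -- provides the dominating constant.
  have hlim := intervalIntegral.tendsto_integral_filter_of_dominated_convergence
    (μ := MeasureTheory.volume) (a := 0) (b := L) (l := atTop)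
    (F := fun (n : ℕ) t => |fourierFun bc L (fun k => if dyadic k < n then z k else 0) t| ^ q)
    (f := fun t => |fourierFun bc L z t| ^ q) (fun _ => ((∑' k, ‖z k‖) / √L) ^ q)
    (Eventually.of_forall fun n => ((continuous_fourierFun (hsum n)).abs.rpow_const
      fun _ => Or.inr (by linarith)).aestronglyMeasurable)
    (Eventually.of_forall fun n => Eventually.of_forall fun t _ => by
      rw [Real.norm_of_nonneg (Real.rpow_nonneg (abs_nonneg _) _)]
      refine Real.rpow_le_rpow (abs_nonneg _) ((abs_fourierFun_le (hsum n) t).trans ?_)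
        (by linarith)
      exact div_le_div_of_nonneg_right ((hsum n).tsum_le_tsum (htr n) hz1) (Real.sqrt_nonneg _))
    (by simp)
    (Eventually.of_forall fun t _ =>
      ((tendsto_fourierFun_truncation hz1 t).abs.rpow_const (Or.inr (by linarith))))
  refine (le_of_tendsto' hlim hb).trans (le_of_eq ?_)
  ring

end Embedding

end NormalForm

/-! ### The quadratic form of the potential. -/

namespace NormalForm

section ContinuousIntegrals

variable {f g : ℝ → ℝ}

theorem integral_add_of_continuous (hf : Continuous f) (hg : Continuous g) (a b : ℝ) :
    ∫ t in a..b, (f t + g t) = (∫ t in a..b, f t) + ∫ t in a..b, g t :=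
  intervalIntegral.integral_add (hf.intervalIntegrable _ _) (hg.intervalIntegrable _ _)

theorem integral_sub_of_continuous (hf : Continuous f) (hg : Continuous g) (a b : ℝ) :
    ∫ t in a..b, (f t - g t) = (∫ t in a..b, f t) - ∫ t in a..b, g t :=
  intervalIntegral.integral_sub (hf.intervalIntegrable _ _) (hg.intervalIntegrable _ _)

theorem integral_mono_of_continuous (hf : Continuous f) (hg : Continuous g) {a b : ℝ}
    (hab : a ≤ b) (h : ∀ t, f t ≤ g t) : ∫ t in a..b, f t ≤ ∫ t in a..b, g t :=
  intervalIntegral.integral_mono hab (hf.intervalIntegrable _ _) (hg.intervalIntegrable _ _) h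

end ContinuousIntegrals

section LamForm

variable {bc : BoundaryCondition} {L : ℝ} {x y w z : ℤ → ℂ}

/-- The bilinear form with coefficients `λ_k`. -/
noncomputable def lamForm (bc : BoundaryCondition) (L : ℝ) (x y : ℤ → ℂ) : ℂ :=
  ∑' k : ℤ, (lam bc L k : ℂ) * x k * y (-k)

theorem exists_abs_lam_le (bc : BoundaryCondition) (L : ℝ) :
    ∃ Λ > 0, ∀ k, |lam bc L k| ≤ Λ * (1 + (k : ℝ) ^ 2) := by
  refine ⟨(bc.b * Real.pi / L) ^ 2 + 1, by positivity, fun k => ?_⟩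
  have h : lam bc L k = (bc.b * Real.pi / L) ^ 2 * (k : ℝ) ^ 2 - 1 := by rw [lam, nu]; ring
  have h1 : 0 ≤ (bc.b * Real.pi / L) ^ 2 := sq_nonneg _
  have h2 : 0 ≤ (k : ℝ) ^ 2 := sq_nonneg _
  rw [h, abs_le]
  constructor <;> nlinarith [mul_nonneg h1 h2]

theorem memH_one_iff : MemH 1 z ↔ Summable fun k : ℤ => (1 + (k : ℝ) ^ 2) * ‖z k‖ ^ 2 := by
  simp only [MemH, Real.rpow_one]

theorem MemH.add_one (hx : MemH 1 x) (hy : MemH 1 y) : MemH 1 (x + y) := by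
  rw [memH_one_iff] at *
  refine Summable.of_nonneg_of_le (fun k => by positivity) (fun k => ?_)
    ((hx.mul_left 2).add (hy.mul_left 2))
  have h1 : ‖(x + y) k‖ ^ 2 ≤ 2 * ‖x k‖ ^ 2 + 2 * ‖y k‖ ^ 2 := by
    have := pow_le_pow_left₀ (norm_nonneg _) (norm_add_le (x k) (y k)) 2
    simp only [Pi.add_apply]
    nlinarith [sq_nonneg (‖x k‖ - ‖y k‖)]
  have := mul_le_mul_of_nonneg_left h1 (one_add_sq_pos k).le
  linarith

theorem summable_lamForm (hx : MemH 1 x) (hy : MemH 1 y) :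
    Summable fun k : ℤ => (lam bc L k : ℂ) * x k * y (-k) := by
  obtain ⟨Λ, hΛ, h⟩ := exists_abs_lam_le bc L
  rw [memH_one_iff] at hx hy
  have hy' : Summable fun k : ℤ => (1 + (k : ℝ) ^ 2) * ‖y (-k)‖ ^ 2 :=
    (hy.comp_injective (Equiv.neg ℤ).injective).congr fun k => by simp
  refine Summable.of_norm_bounded ((hx.add hy').mul_left Λ) fun k => ?_
  rw [norm_mul, norm_mul, Complex.norm_real, Real.norm_eq_abs]
  have h1 : ‖x k‖ * ‖y (-k)‖ ≤ ‖x k‖ ^ 2 + ‖y (-k)‖ ^ 2 := by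
    nlinarith [sq_nonneg (‖x k‖ - ‖y (-k)‖), sq_nonneg (‖x k‖), sq_nonneg ‖y (-k)‖]
  calc |lam bc L k| * ‖x k‖ * ‖y (-k)‖ = |lam bc L k| * (‖x k‖ * ‖y (-k)‖) := by ring
    _ ≤ Λ * (1 + (k : ℝ) ^ 2) * (‖x k‖ ^ 2 + ‖y (-k)‖ ^ 2) :=
        mul_le_mul (h k) h1 (by positivity) (by positivity)
    _ = _ := by ring

theorem lamForm_comm (x y : ℤ → ℂ) : lamForm bc L x y = lamForm bc L y x := by
  unfold lamForm
  rw [← (Equiv.neg ℤ).tsum_eq]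
  exact tsum_congr fun k => by simp only [Equiv.neg_apply, lam_neg, neg_neg]; ring

theorem lamForm_add_left (hx : MemH 1 x) (hy : MemH 1 y) (hw : MemH 1 w) :
    lamForm bc L (x + y) w = lamForm bc L x w + lamForm bc L y w := by
  unfold lamForm
  rw [← (summable_lamForm hx hw).tsum_add (summable_lamForm hy hw)]
  exact tsum_congr fun k => by simp only [Pi.add_apply]; ring

theorem lamForm_add_self (hx : MemH 1 x) (hy : MemH 1 y) :
    lamForm bc L (x + y) (x + y)
      = lamForm bc L x x + 2 * lamForm bc L y x + lamForm bc L y y := by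
  rw [lamForm_add_left hx hy (hx.add_one hy), lamForm_comm x, lamForm_comm y,
    lamForm_add_left hx hy hx, lamForm_add_left hx hy hy, lamForm_comm x y]
  ring

/-- One factor `rho` absorbs the growth of `λ_k`, the other makes the sum converge. -/
theorem norm_lamForm_le {Λ X Y : ℝ} (hΛ : ∀ k, |lam bc L k| ≤ Λ * (1 + (k : ℝ) ^ 2))
    (hX : ∀ k, ‖x k‖ ≤ X * rho k) (hY : ∀ k, ‖y k‖ ≤ Y * rho k) :
    ‖lamForm bc L x y‖ ≤ Λ * X * Y * ∑' k, rho k := by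
  rw [← tsum_mul_left]
  refine tsum_of_norm_bounded (summable_rho.mul_left _).hasSum fun k => ?_
  rw [norm_mul, norm_mul, Complex.norm_real, Real.norm_eq_abs]
  have e : rho (-k) = rho k := by simp [rho]
  have h1 := hY (-k)
  rw [e] at h1
  have h2 : (1 + (k : ℝ) ^ 2) * rho k = 1 := mul_inv_cancel₀ (one_add_sq_pos k).ne'
  have h3 : |lam bc L k| * ‖x k‖ ≤ Λ * (1 + (k : ℝ) ^ 2) * (X * rho k) :=
    mul_le_mul (hΛ k) (hX k) (norm_nonneg _) ((abs_nonneg _).trans (hΛ k))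
  calc _ ≤ Λ * (1 + (k : ℝ) ^ 2) * (X * rho k) * (Y * rho k) :=
        mul_le_mul h3 h1 (norm_nonneg _)
          ((mul_nonneg (abs_nonneg _) (norm_nonneg _)).trans h3)
    _ = Λ * X * Y * rho k * ((1 + (k : ℝ) ^ 2) * rho k) := by ring
    _ = _ := by rw [h2, mul_one]

theorem potentialTwo_eq (z : ℤ → ℂ) : potentialTwo bc L z = 1 / 2 * lamForm bc L z z := rfl

/-- Writing `ν_k = λ_k + 1`, the extra `½ ∑ ‖z k‖²` is `½ ∫ u²` by Parseval and offsets the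
quadratic Taylor term of `U`. -/
theorem potential_eq (hL : 0 < L) {U : ℝ → ℝ} (hU : Continuous U) (hz : Admissible bc z)
    (hz1 : MemH 1 z) :
    (potential bc L U z : ℂ) = potentialTwo bc L z +
      ((∫ t in (0 : ℝ)..L, (U (fourierFun bc L z t) + 1 / 2 * fourierFun bc L z t ^ 2) : ℝ) : ℂ)
      := by
  have hs := hz1.summable_norm (by norm_num)
  have hc := continuous_fourierFun (bc := bc) (L := L) hs
  have hsq := hz1.summable_sq zero_le_one
  have e : ∀ k, (lam bc L k : ℂ) * z k * z (-k) = ((lam bc L k * ‖z k‖ ^ 2 : ℝ) : ℂ) := fun k => by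
    rw [mul_assoc, hz.mul_neg]; push_cast; ring
  have hlam : Summable fun k => lam bc L k * ‖z k‖ ^ 2 := by
    have := summable_lamForm (bc := bc) (L := L) hz1 hz1
    simp_rw [e] at this
    exact Complex.summable_ofReal.1 this
  have h1 : ∑' k, nu bc L k * ‖z k‖ ^ 2 = ∑' k, lam bc L k * ‖z k‖ ^ 2 + ∑' k, ‖z k‖ ^ 2 := by
    rw [← hlam.tsum_add hsq]
    exact tsum_congr fun k => by rw [lam]; ring
  have h2 : potentialTwo bc L z = ((1 / 2 * ∑' k, lam bc L k * ‖z k‖ ^ 2 : ℝ) : ℂ) := by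
    rw [potentialTwo]
    simp_rw [e]
    rw [← Complex.ofReal_tsum]; push_cast; ring
  rw [h2, ← Complex.ofReal_add, Complex.ofReal_inj, potential, h1,
    integral_add_of_continuous (by fun_prop : Continuous fun t => U (fourierFun bc L z t))
      (by fun_prop : Continuous fun t => 1 / 2 * fourierFun bc L z t ^ 2),
    intervalIntegral.integral_const_mul, integral_fourierFun_sq hL hz hs]
  ring

end LamForm

/-! ### Pointwise and integrated bounds for the cubic and quartic expansions. -/

section RealEstimates

/-- The right side is arranged to become `O(N⁵)` on integration, since `∫ u² = O(N²)`. Odd powers of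
`|u|` are removed by `N |u| ≤ (N² + u²) / 2`. -/
theorem abs_cube_expansion_le {u v w V N : ℝ} (hV : 0 ≤ V) (hN : 0 ≤ N) (hN1 : N ≤ 1)
    (hv : |v| ≤ V * N ^ 2) (hw : |w| ≤ V * N ^ 3) :
    |(u + v + w) ^ 3 - u ^ 3 - 3 * (u * u * v)|
      ≤ (3 * V + 6 * V ^ 2 + 8 * V ^ 3) * (N ^ 3 * (u ^ 2 + N ^ 2)) := by
  have hN32 : N ^ 3 ≤ N ^ 2 := pow_le_pow_of_le_one hN hN1 (by norm_num)
  have hN65 : N ^ 6 ≤ N ^ 5 := pow_le_pow_of_le_one hN hN1 (by norm_num)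
  have hW : |v + w| ≤ 2 * V * N ^ 2 := by
    have := abs_add_le v w
    nlinarith
  set d := v + w with hd
  have e : (u + v + w) ^ 3 - u ^ 3 - 3 * (u * u * v) = 3 * (u ^ 2 * w) + 3 * (u * d ^ 2) + d ^ 3 := by
    rw [hd]; ring
  rw [e]
  have h1 : |3 * (u ^ 2 * w)| ≤ 3 * V * (N ^ 3 * u ^ 2) := by
    rw [abs_mul, abs_mul, abs_of_nonneg (sq_nonneg u), abs_of_pos (by norm_num : (0 : ℝ) < 3)]
    have := mul_le_mul_of_nonneg_left hw (sq_nonneg u)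
    linarith
  have hd2 : d ^ 2 ≤ (2 * V * N ^ 2) ^ 2 := by
    rw [← sq_abs d]; exact pow_le_pow_left₀ (abs_nonneg _) hW 2
  have hNu : N * |u| ≤ (N ^ 2 + u ^ 2) / 2 := by
    rw [← sq_abs u]; nlinarith [sq_nonneg (N - |u|)]
  have h2 : |3 * (u * d ^ 2)| ≤ 6 * V ^ 2 * (N ^ 3 * (u ^ 2 + N ^ 2)) := by
    rw [abs_mul, abs_mul, abs_of_nonneg (sq_nonneg d), abs_of_pos (by norm_num : (0 : ℝ) < 3)]
    calc 3 * (|u| * d ^ 2) ≤ 3 * (|u| * (2 * V * N ^ 2) ^ 2) := by gcongr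
      _ = 12 * V ^ 2 * N ^ 3 * (N * |u|) := by ring
      _ ≤ 12 * V ^ 2 * N ^ 3 * ((N ^ 2 + u ^ 2) / 2) := by gcongr
      _ = _ := by ring
  have h3 : |d ^ 3| ≤ 8 * V ^ 3 * N ^ 5 := by
    rw [abs_pow]
    calc |d| ^ 3 ≤ (2 * V * N ^ 2) ^ 3 := pow_le_pow_left₀ (abs_nonneg _) hW 3
      _ = 8 * V ^ 3 * N ^ 6 := by ring
      _ ≤ _ := by gcongr
  have hu : 0 ≤ N ^ 3 * u ^ 2 := by positivity
  have hN5 : 0 ≤ N ^ 5 := by positivity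
  refine (abs_add_three _ _ _).trans ?_
  nlinarith [mul_nonneg hV hN5, mul_nonneg (pow_nonneg hV 3) hu]

theorem abs_four_expansion_le {u d W N : ℝ} (hW : 0 ≤ W) (hN : 0 ≤ N) (hN1 : N ≤ 1)
    (hd : |d| ≤ W * N ^ 2) :
    |(u + d) ^ 4 - u ^ 4|
      ≤ (2 * W + 6 * W ^ 2 + 2 * W ^ 3 + W ^ 4) * (N * u ^ 4 + 2 * (N ^ 3 * u ^ 2) + N ^ 5) := by
  have e : (u + d) ^ 4 - u ^ 4 = 4 * (u ^ 3 * d) + 6 * (u ^ 2 * d ^ 2) + 4 * (u * d ^ 3) + d ^ 4 := by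
    ring
  have hNu : N * |u| ≤ (N ^ 2 + u ^ 2) / 2 := by
    rw [← sq_abs u]; nlinarith [sq_nonneg (N - |u|)]
  have hN43 : N ^ 4 ≤ N ^ 3 := pow_le_pow_of_le_one hN hN1 (by norm_num)
  have hN53 : N ^ 5 ≤ N ^ 3 := pow_le_pow_of_le_one hN hN1 (by norm_num)
  have hN85 : N ^ 8 ≤ N ^ 5 := pow_le_pow_of_le_one hN hN1 (by norm_num)
  have h1 : |4 * (u ^ 3 * d)| ≤ 2 * W * (N * u ^ 4 + N ^ 3 * u ^ 2) := by
    rw [abs_mul, abs_mul, abs_pow, abs_of_pos (by norm_num : (0 : ℝ) < 4)]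
    calc 4 * (|u| ^ 3 * |d|) ≤ 4 * (|u| ^ 3 * (W * N ^ 2)) := by gcongr
      _ = 4 * W * N * |u| ^ 2 * (N * |u|) := by ring
      _ ≤ 4 * W * N * |u| ^ 2 * ((N ^ 2 + u ^ 2) / 2) := by gcongr
      _ = _ := by rw [sq_abs]; ring
  have hd2 : d ^ 2 ≤ (W * N ^ 2) ^ 2 := by
    rw [← sq_abs d]; exact pow_le_pow_left₀ (abs_nonneg _) hd 2
  have h2 : |6 * (u ^ 2 * d ^ 2)| ≤ 6 * W ^ 2 * (N ^ 3 * u ^ 2) := by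
    rw [abs_of_nonneg (by positivity)]
    calc 6 * (u ^ 2 * d ^ 2) ≤ 6 * (u ^ 2 * (W * N ^ 2) ^ 2) := by gcongr
      _ = 6 * W ^ 2 * (N ^ 4 * u ^ 2) := by ring
      _ ≤ _ := by gcongr
  have h3 : |4 * (u * d ^ 3)| ≤ 2 * W ^ 3 * (N ^ 3 * u ^ 2 + N ^ 5) := by
    rw [abs_mul, abs_mul, abs_pow, abs_of_pos (by norm_num : (0 : ℝ) < 4)]
    calc 4 * (|u| * |d| ^ 3) ≤ 4 * (|u| * (W * N ^ 2) ^ 3) := by gcongr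
      _ = 4 * W ^ 3 * N ^ 5 * (N * |u|) := by ring
      _ ≤ 4 * W ^ 3 * N ^ 3 * ((N ^ 2 + u ^ 2) / 2) := by gcongr
      _ = _ := by ring
  have h4 : |d ^ 4| ≤ W ^ 4 * N ^ 5 := by
    rw [abs_pow]
    calc |d| ^ 4 ≤ (W * N ^ 2) ^ 4 := pow_le_pow_left₀ (abs_nonneg _) hd 4
      _ = W ^ 4 * N ^ 8 := by ring
      _ ≤ _ := by gcongr
  have p1 : 0 ≤ N * u ^ 4 := by positivity
  have p2 : 0 ≤ N ^ 3 * u ^ 2 := by positivity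
  have p3 : 0 ≤ N ^ 5 := by positivity
  have q2 : 0 ≤ W ^ 2 := by positivity
  have q3 : 0 ≤ W ^ 3 := by positivity
  have q4 : 0 ≤ W ^ 4 := by positivity
  rw [e]
  refine (abs_add_le _ _).trans ((add_le_add (abs_add_three _ _ _) le_rfl).trans ?_)
  nlinarith [mul_nonneg hW p2, mul_nonneg hW p3, mul_nonneg q2 p1, mul_nonneg q2 p2,
    mul_nonneg q2 p3, mul_nonneg q3 p1, mul_nonneg q3 p2, mul_nonneg q3 p3, mul_nonneg q4 p1,
    mul_nonneg q4 p2]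

theorem add_rpow_le {a b q : ℝ} (ha : 0 ≤ a) (hb : 0 ≤ b) (hq : 0 ≤ q) :
    (a + b) ^ q ≤ 2 ^ q * (a ^ q + b ^ q) := by
  have key : ∀ a b : ℝ, 0 ≤ a → 0 ≤ b → a ≤ b → (a + b) ^ q ≤ 2 ^ q * (a ^ q + b ^ q) := by
    intro a b ha hb hab
    calc (a + b) ^ q ≤ (2 * b) ^ q := Real.rpow_le_rpow (by positivity) (by linarith) hq
      _ = 2 ^ q * b ^ q := Real.mul_rpow (by norm_num) hb
      _ ≤ _ := by
        have := Real.rpow_nonneg ha q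
        gcongr; linarith
  rcases le_total a b with h | h
  · exact key a b ha hb h
  · rw [add_comm a b, add_comm (a ^ q)]; exact key b a hb ha h

theorem rpow_le_pow_five {N q : ℝ} (hN : 0 ≤ N) (hN1 : N ≤ 1) (hq : 5 ≤ q) : N ^ q ≤ N ^ 5 := by
  have := Real.rpow_le_rpow_of_exponent_ge' hN hN1 (by norm_num) hq
  rwa [show (5 : ℝ) = ((5 : ℕ) : ℝ) by norm_num, Real.rpow_natCast] at this

variable {L : ℝ} {u v w : ℝ → ℝ}

theorem integral_add_rpow_le (hL : 0 < L) (hu : Continuous u) (hv : Continuous v) {W K N q : ℝ}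
    (hN : 0 ≤ N) (hN1 : N ≤ 1) (hW : 0 ≤ W) (hK : 0 ≤ K) (hq : 5 ≤ q)
    (hb : ∀ t, |v t| ≤ W * N ^ 2) (hi : ∫ t in (0 : ℝ)..L, |u t| ^ q ≤ K * N ^ q) :
    ∫ t in (0 : ℝ)..L, |u t + v t| ^ q ≤ 2 ^ q * (K + W ^ q * L) * N ^ 5 := by
  have hc : ∀ {f : ℝ → ℝ}, Continuous f → Continuous fun t => |f t| ^ q := fun hf =>
    hf.abs.rpow_const fun _ => Or.inr (by linarith)
  have hpt : ∀ t, |u t + v t| ^ q ≤ 2 ^ q * (|u t| ^ q + W ^ q * N ^ 5) := fun t => by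
    have h1 : |v t| ^ q ≤ W ^ q * N ^ 5 := by
      -- One power of `N` is given up: `(W N)^q` already suffices because `q ≥ 5`.
      have h2 : |v t| ≤ W * N := (hb t).trans (by gcongr; nlinarith)
      refine (Real.rpow_le_rpow (abs_nonneg _) h2 (by linarith)).trans ?_
      rw [Real.mul_rpow hW hN]
      exact mul_le_mul_of_nonneg_left (rpow_le_pow_five hN hN1 hq) (Real.rpow_nonneg hW _)
    refine (Real.rpow_le_rpow (abs_nonneg _) (abs_add_le _ _) (by linarith)).trans ?_
    refine (add_rpow_le (abs_nonneg _) (abs_nonneg _) (by linarith)).trans ?_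
    gcongr
  have hcu := hc hu
  have hcuv := hc (hu.add hv)
  have h := integral_mono_of_continuous hcuv (by fun_prop) hL.le hpt
  rw [intervalIntegral.integral_const_mul,
    integral_add_of_continuous (hc hu) continuous_const] at h
  simp only [intervalIntegral.integral_const, sub_zero, smul_eq_mul] at h
  refine h.trans ?_
  have h5 := hi.trans (mul_le_mul_of_nonneg_left (rpow_le_pow_five hN hN1 hq) hK)
  calc _ ≤ (2 : ℝ) ^ q * (K * N ^ 5 + L * (W ^ q * N ^ 5)) := by gcongr
    _ = _ := by ring

theorem abs_integral_cube_le (hL : 0 < L) (hu : Continuous u) (hv : Continuous v)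
    (hw : Continuous w) {V K N : ℝ} (hV : 0 ≤ V) (hN : 0 ≤ N) (hN1 : N ≤ 1)
    (hbv : ∀ t, |v t| ≤ V * N ^ 2) (hbw : ∀ t, |w t| ≤ V * N ^ 3)
    (hi : ∫ t in (0 : ℝ)..L, u t ^ 2 ≤ K * N ^ 2) :
    |(∫ t in (0 : ℝ)..L, (u t + v t + w t) ^ 3) - (∫ t in (0 : ℝ)..L, u t * u t * u t) -
      3 * ∫ t in (0 : ℝ)..L, u t * u t * v t|
      ≤ (3 * V + 6 * V ^ 2 + 8 * V ^ 3) * (K + L) * N ^ 5 := by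
  have c1 : Continuous fun t => (u t + v t + w t) ^ 3 := ((hu.add hv).add hw).pow 3
  have c2 : Continuous fun t => u t * u t * u t := (hu.mul hu).mul hu
  have c3 : Continuous fun t => u t * u t * v t := (hu.mul hu).mul hv
  have c4 : Continuous fun t => 3 * (u t * u t * v t) := continuous_const.mul c3
  rw [← intervalIntegral.integral_const_mul, ← integral_sub_of_continuous c1 c2,
    ← integral_sub_of_continuous (by fun_prop : Continuous fun t =>
      (u t + v t + w t) ^ 3 - u t * u t * u t) c4]
  refine (intervalIntegral.abs_integral_le_integral_abs hL.le).trans ?_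
  have hpt : ∀ t, |(u t + v t + w t) ^ 3 - u t * u t * u t - 3 * (u t * u t * v t)|
      ≤ (3 * V + 6 * V ^ 2 + 8 * V ^ 3) * (N ^ 3 * (u t ^ 2 + N ^ 2)) := fun t => by
    have := abs_cube_expansion_le (u := u t) hV hN hN1 (hbv t) (hbw t)
    rwa [show u t ^ 3 = u t * u t * u t by ring] at this
  have h := integral_mono_of_continuous (by fun_prop) (by fun_prop) hL.le hpt
  refine h.trans ?_
  rw [intervalIntegral.integral_const_mul, intervalIntegral.integral_const_mul,
    integral_add_of_continuous (by fun_prop : Continuous fun t => u t ^ 2) continuous_const]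
  simp only [intervalIntegral.integral_const, sub_zero, smul_eq_mul]
  calc _ ≤ (3 * V + 6 * V ^ 2 + 8 * V ^ 3) * (N ^ 3 * (K * N ^ 2 + L * N ^ 2)) := by gcongr
    _ = _ := by ring

theorem abs_integral_four_le (hL : 0 < L) (hu : Continuous u) (hv : Continuous v) {W K N : ℝ}
    (hW : 0 ≤ W) (hN : 0 ≤ N) (hN1 : N ≤ 1) (hb : ∀ t, |v t| ≤ W * N ^ 2)
    (hi : ∫ t in (0 : ℝ)..L, u t ^ 2 ≤ K * N ^ 2) (hi4 : ∫ t in (0 : ℝ)..L, u t ^ 4 ≤ K * N ^ 4) :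
    |(∫ t in (0 : ℝ)..L, (u t + v t) ^ 4) - ∫ t in (0 : ℝ)..L, u t ^ 4|
      ≤ (2 * W + 6 * W ^ 2 + 2 * W ^ 3 + W ^ 4) * (3 * K + L) * N ^ 5 := by
  have c1 : Continuous fun t => (u t + v t) ^ 4 := (hu.add hv).pow 4
  have c2 : Continuous fun t => u t ^ 4 := hu.pow 4
  have c3 : Continuous fun t => u t ^ 2 := hu.pow 2
  rw [← integral_sub_of_continuous c1 c2]
  refine (intervalIntegral.abs_integral_le_integral_abs hL.le).trans ?_
  have d1 : Continuous fun t => N * u t ^ 4 := continuous_const.mul c2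
  have d2 : Continuous fun t => 2 * (N ^ 3 * u t ^ 2) :=
    continuous_const.mul (continuous_const.mul c3)
  have h := integral_mono_of_continuous (by fun_prop) (by fun_prop) hL.le
    fun t => abs_four_expansion_le (u := u t) hW hN hN1 (hb t)
  refine h.trans ?_
  rw [intervalIntegral.integral_const_mul, integral_add_of_continuous
    (by fun_prop : Continuous fun t => N * u t ^ 4 + 2 * (N ^ 3 * u t ^ 2)) continuous_const,
    integral_add_of_continuous d1 d2, intervalIntegral.integral_const_mul,
    intervalIntegral.integral_const_mul, intervalIntegral.integral_const_mul]
  simp only [intervalIntegral.integral_const, sub_zero, smul_eq_mul]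
  calc _ ≤ (2 * W + 6 * W ^ 2 + 2 * W ^ 3 + W ^ 4) *
        (N * (K * N ^ 4) + 2 * (N ^ 3 * (K * N ^ 2)) + L * N ^ 5) := by gcongr
    _ = _ := by ring

end RealEstimates

/-! ### The Taylor remainder of `U`. -/

section Remainder

/-- The remainder of `U` after its Taylor polynomial of degree four. -/
noncomputable def taylorRem (U : ℝ → ℝ) (L a₃ a₄ u : ℝ) : ℝ :=
  U u - (-(1 / 2) * u ^ 2 + a₃ * √L / 3 * u ^ 3 + a₄ * L / 4 * u ^ 4)

variable {U : ℝ → ℝ} {L a₃ a₄ : ℝ}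

theorem continuous_taylorRem (hU : Continuous U) : Continuous (taylorRem U L a₃ a₄) := by
  unfold taylorRem; fun_prop

theorem exists_taylorRem_near (h : taylorRem U L a₃ a₄ =O[𝓝 0] fun u : ℝ => u ^ 5) :
    ∃ c > 0, ∃ η > 0, η ≤ 1 ∧ ∀ u : ℝ, |u| < η → |taylorRem U L a₃ a₄ u| ≤ c * |u| ^ 5 := by
  obtain ⟨c, hc, h⟩ := h.exists_pos
  obtain ⟨η, hη, h⟩ := Metric.eventually_nhds_iff.1 h.bound
  refine ⟨c, hc, min η 1, by positivity, min_le_right _ _, fun u hu => ?_⟩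
  have := h (y := u) (by rw [Real.dist_eq, sub_zero]; exact hu.trans_le (min_le_left _ _))
  simpa using this

/-- The Taylor bound holds for `|u| < η`; beyond, the remainder is bounded by compactness and `|u|⁵
/ η⁵ ≥ 1`. -/
theorem exists_taylorRem_le_of_bounded (hU : Continuous U)
    (h : taylorRem U L a₃ a₄ =O[𝓝 0] fun u : ℝ => u ^ 5) (M : ℝ) :
    ∃ c > 0, ∀ u : ℝ, |u| ≤ M → |taylorRem U L a₃ a₄ u| ≤ c * |u| ^ 5 := by
  obtain ⟨c, hc, η, hη, -, h⟩ := exists_taylorRem_near h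
  obtain ⟨D, hD⟩ := (isCompact_Icc (a := -M) (b := M)).exists_bound_of_continuousOn
    (continuous_taylorRem (L := L) (a₃ := a₃) (a₄ := a₄) hU).continuousOn
  refine ⟨c + |D| / η ^ 5, by positivity, fun u hu => ?_⟩
  have p : 0 ≤ |u| ^ 5 := by positivity
  have p' : 0 ≤ |D| / η ^ 5 := by positivity
  rcases lt_or_ge |u| η with h1 | h1
  · refine (h u h1).trans ?_
    nlinarith
  · have h2 : |taylorRem U L a₃ a₄ u| ≤ |D| := (hD u (abs_le.1 hu)).trans (le_abs_self D)
    have h3 : |D| ≤ |D| / η ^ 5 * |u| ^ 5 := by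
      rw [div_mul_eq_mul_div, le_div_iff₀ (by positivity)]
      gcongr
    nlinarith

theorem exists_taylorRem_le_of_growth {M₀ p₀ Q : ℝ} (hp : 0 ≤ p₀) (hQ : 5 ≤ Q) (hpQ : 2 * p₀ ≤ Q)
    (h : taylorRem U L a₃ a₄ =O[𝓝 0] fun u : ℝ => u ^ 5)
    (hU : ∀ u : ℝ, |U u| ≤ M₀ * (1 + |u| ^ (2 * p₀))) :
    ∃ c > 0, ∀ u : ℝ, |taylorRem U L a₃ a₄ u| ≤ c * (|u| ^ 5 + |u| ^ Q) := by
  obtain ⟨c, hc, η, hη, hη1, h⟩ := exists_taylorRem_near h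
  have hM : 0 ≤ M₀ := by
    have h1 := (abs_nonneg _).trans (hU 0)
    have h2 : 0 < 1 + |(0 : ℝ)| ^ (2 * p₀) := by
      have := Real.rpow_nonneg (abs_nonneg (0 : ℝ)) (2 * p₀); linarith
    exact nonneg_of_mul_nonneg_left h1 h2
  set E := 2 * M₀ + 1 / 2 + |a₃ * √L / 3| + |a₄ * L / 4| with hE
  have hE0 : 0 ≤ E := by positivity
  have hηQ : 0 < η ^ Q := Real.rpow_pos_of_pos hη Q
  refine ⟨c + E / η ^ Q, by positivity, fun u => ?_⟩
  have p5 : 0 ≤ |u| ^ 5 := by positivity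
  have pQ : 0 ≤ |u| ^ Q := by positivity
  have pE : 0 ≤ E / η ^ Q := by positivity
  rcases lt_or_ge |u| η with h1 | h1
  · refine (h u h1).trans ?_
    nlinarith [mul_nonneg hc.le pQ, mul_nonneg pE p5, mul_nonneg pE pQ]
  -- Away from zero every power of `|u|` with exponent at most `Q` is below `T`, because `η ≤ 1 ≤
  -- |u| / η`; the constant `E` collects the coefficients.
  · set T := (|u| / η) ^ Q with hT
    have ht : 1 ≤ |u| / η := (one_le_div hη).2 h1
    have hut : |u| ≤ |u| / η := by
      rw [le_div_iff₀ hη]; nlinarith [abs_nonneg u]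
    have hpow : ∀ m : ℝ, 0 ≤ m → m ≤ Q → |u| ^ m ≤ T := fun m hm hmQ =>
      (Real.rpow_le_rpow (abs_nonneg _) hut hm).trans (Real.rpow_le_rpow_of_exponent_le ht hmQ)
    have hpow' : ∀ m : ℕ, (m : ℝ) ≤ 5 → |u| ^ m ≤ T := fun m hm => by
      have := hpow m (by positivity) (hm.trans hQ)
      rwa [Real.rpow_natCast] at this
    have e0 : 1 ≤ T := by simpa using hpow' 0 (by norm_num)
    have e2 := hpow' 2 (by norm_num)
    have e3 := hpow' 3 (by norm_num)
    have e4 := hpow' 4 (by norm_num)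
    have ep := hpow (2 * p₀) (by linarith) hpQ
    have hTe : E * T = E / η ^ Q * |u| ^ Q := by
      rw [hT, Real.div_rpow (abs_nonneg _) hη.le]; ring
    have hr : |taylorRem U L a₃ a₄ u| ≤ E * T := by
      have b1 : |U u| ≤ M₀ * (2 * T) := (hU u).trans (by gcongr; linarith)
      have b2 : |(1 / 2) * u ^ 2| ≤ 1 / 2 * T := by
        rw [abs_mul, abs_pow, abs_of_pos (by norm_num : (0 : ℝ) < 1 / 2)]; gcongr
      have b3 : |a₃ * √L / 3 * u ^ 3| ≤ |a₃ * √L / 3| * T := by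
        rw [abs_mul, abs_pow]; gcongr
      have b4 : |a₄ * L / 4 * u ^ 4| ≤ |a₄ * L / 4| * T := by
        rw [abs_mul, abs_pow]; gcongr
      have : taylorRem U L a₃ a₄ u = U u + 1 / 2 * u ^ 2 - a₃ * √L / 3 * u ^ 3
          - a₄ * L / 4 * u ^ 4 := by unfold taylorRem; ring
      rw [this]
      rw [abs_le] at b1 b2 b3 b4 ⊢
      constructor <;> rw [hE] <;> linarith [b1.1, b1.2, b2.1, b2.2, b3.1, b3.2, b4.1, b4.2]
    rw [hTe] at hr
    nlinarith [mul_nonneg hc.le pQ, mul_nonneg hc.le p5, mul_nonneg pE p5]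

end Remainder

end NormalForm

/-! ### The fifth-order bound for the remainder of the normal form. -/

namespace NormalForm

section NormalFormBound

variable {bc : BoundaryCondition} {L a₃ a₄ C s : ℝ} {U : ℝ → ℝ}

theorem abs_fourierFun_le_of_norm_le_rho {x : ℤ → ℂ} {B : ℝ} (hx : ∀ k, ‖x k‖ ≤ B * rho k)
    (t : ℝ) : |fourierFun bc L x t| ≤ B * ((∑' k, rho k) / √L) := by
  have hs : Summable fun k => ‖x k‖ :=
    Summable.of_nonneg_of_le (fun _ => norm_nonneg _) hx (summable_rho.mul_left B)
  refine (abs_fourierFun_le hs t).trans ?_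
  rw [← mul_div_assoc, ← tsum_mul_left]
  exact div_le_div_of_nonneg_right (hs.tsum_le_tsum hx (summable_rho.mul_left B))
    (Real.sqrt_nonneg _)

theorem abs_integral_le_of_abs_le_rpow (hL : 0 < L) {r y : ℝ → ℝ} (hr : Continuous r)
    (hy : Continuous y) {c Q D E : ℝ} (hQ : 0 ≤ Q) (hc : 0 ≤ c)
    (h : ∀ t ∈ Set.Icc 0 L, |r t| ≤ c * (|y t| ^ 5 + |y t| ^ Q))
    (h5 : ∫ t in (0 : ℝ)..L, |y t| ^ (5 : ℝ) ≤ D) (hQi : ∫ t in (0 : ℝ)..L, |y t| ^ Q ≤ E) :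
    |∫ t in (0 : ℝ)..L, r t| ≤ c * (D + E) := by
  have hcQ : Continuous fun t => |y t| ^ Q := hy.abs.rpow_const fun _ => Or.inr hQ
  simp only [Real.rpow_ofNat] at h5
  refine (intervalIntegral.abs_integral_le_integral_abs hL.le).trans ?_
  have hg : Continuous fun t => c * (|y t| ^ 5 + |y t| ^ Q) := by fun_prop
  refine (intervalIntegral.integral_mono_on hL.le (hr.abs.intervalIntegrable _ _)
    (hg.intervalIntegrable _ _) h).trans ?_
  rw [intervalIntegral.integral_const_mul,
    integral_add_of_continuous (by fun_prop : Continuous fun t => |y t| ^ 5) hcQ]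
  exact mul_le_mul_of_nonneg_left (add_le_add h5 hQi) hc

theorem integral_taylor (hU : Continuous U) {y : ℝ → ℝ} (hy : Continuous y) :
    ∫ t in (0 : ℝ)..L, (U (y t) + 1 / 2 * y t ^ 2)
      = a₃ * √L / 3 * (∫ t in (0 : ℝ)..L, y t ^ 3) + a₄ * L / 4 * (∫ t in (0 : ℝ)..L, y t ^ 4)
        + ∫ t in (0 : ℝ)..L, taylorRem U L a₃ a₄ (y t) := by
  have hr : Continuous fun t => taylorRem U L a₃ a₄ (y t) := (continuous_taylorRem hU).comp hy
  have h3 : Continuous fun t => a₃ * √L / 3 * y t ^ 3 := by fun_prop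
  have h4 : Continuous fun t => a₄ * L / 4 * y t ^ 4 := by fun_prop
  rw [← intervalIntegral.integral_const_mul, ← intervalIntegral.integral_const_mul,
    ← integral_add_of_continuous h3 h4, ← integral_add_of_continuous (by fun_prop) hr]
  refine intervalIntegral.integral_congr fun t _ => ?_
  simp only [taylorRem]; ring

/-- The exact expression for the remainder of the normal form. -/
theorem potential_sub_normalForm (hL : 0 < L)
    (hlam : ∀ k : ℤ, k ≠ 1 → k ≠ -1 → lam bc L k ≠ 0) (hμ : ∀ k, |mu bc L k| ≤ C * rho k)
    (hU : Continuous U) {z : ℤ → ℂ} (hz : Admissible bc z) (hz1 : MemH 1 z)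
    (ha1 : MemH 1 (nfTwo bc L a₃ z)) (hb1 : MemH 1 (nfThree bc L a₃ a₄ z))
    {u v w : ℝ → ℝ} (hu : u = fourierFun bc L z) (hv : v = fourierFun bc L (nfTwo bc L a₃ z))
    (hw : w = fourierFun bc L (nfThree bc L a₃ a₄ z)) :
    (potential bc L U (z + nfMap bc L a₃ a₄ z) : ℂ) -
        (potentialTwo bc L z + (coeffFour bc L a₃ a₄ : ℂ) * z 1 ^ 2 * z (-1) ^ 2)
      = lamForm bc L (nfThree bc L a₃ a₄ z) (nfTwo bc L a₃ z)
        + 1 / 2 * lamForm bc L (nfThree bc L a₃ a₄ z) (nfThree bc L a₃ a₄ z)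
        + ((a₃ * √L / 3 * ((∫ t in (0 : ℝ)..L, (u t + v t + w t) ^ 3) -
            (∫ t in (0 : ℝ)..L, u t * u t * u t) - 3 * ∫ t in (0 : ℝ)..L, u t * u t * v t)
          + a₄ * L / 4 * ((∫ t in (0 : ℝ)..L, (u t + (v t + w t)) ^ 4) -
            ∫ t in (0 : ℝ)..L, u t ^ 4)
          + ∫ t in (0 : ℝ)..L, taylorRem U L a₃ a₄ (u t + v t + w t) : ℝ) : ℂ) := by
  have hs := hz1.summable_norm (by norm_num)
  have has := ha1.summable_norm (by norm_num)
  have hbs := hb1.summable_norm (by norm_num)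
  have hadm_a := hz.nfTwo L a₃
  have hadm_b := hz.nfThree L a₃ a₄
  have hI3 := integral_fourierFun_mul_mul hL hz hz hz hs hs hs
  have hI3' := integral_fourierFun_mul_mul hL hz hz hadm_a hs hs has
  have hI4 := integral_fourierFun_pow_four hL hz hs
  have hcub := cubic_identity (a₃ := a₃) hlam hs
  have hquart := quartic_identity (a₃ := a₃) (a₄ := a₄) hlam hμ hs
  have hmap : nfMap bc L a₃ a₄ z = nfTwo bc L a₃ z + nfThree bc L a₃ a₄ z := rfl
  rw [hmap]
  set a := nfTwo bc L a₃ z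
  set b := nfThree bc L a₃ a₄ z
  have hsum : fourierFun bc L (z + (a + b)) = fun t => u t + v t + w t := by
    funext t
    have hab : Summable fun k => ‖(a + b) k‖ := (ha1.add_one hb1).summable_norm (by norm_num)
    rw [fourierFun_add hs hab, fourierFun_add has hbs, hu, hv, hw, add_assoc]
  have cu : Continuous u := hu ▸ continuous_fourierFun hs
  have cv : Continuous v := hv ▸ continuous_fourierFun has
  have cw : Continuous w := hw ▸ continuous_fourierFun hbs
  have e1 : ∑' k, (lam bc L k : ℂ) * a k * z (-k) = lamForm bc L a z := rfl
  have e2 : ∑' k, (lam bc L k : ℂ) * b k * z (-k) = lamForm bc L b z := rfl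
  have e3 : ∑' k, (lam bc L k : ℂ) * a k * a (-k) = lamForm bc L a a := rfl
  rw [e1, ← hI3] at hcub
  rw [e2, e3, ← hI3', ← hI4] at hquart
  rw [potential_eq hL hU (hz.add (hadm_a.add hadm_b)) (hz1.add_one (ha1.add_one hb1)), hsum,
    integral_taylor (a₃ := a₃) (a₄ := a₄) hU (by fun_prop), potentialTwo_eq, potentialTwo_eq,
    lamForm_add_self hz1 (ha1.add_one hb1), lamForm_add_left ha1 hb1 hz1,
    lamForm_add_self ha1 hb1]
  simp only [← hu, ← hv] at hcub hquart
  simp only [← add_assoc]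
  push_cast at hcub hquart ⊢
  -- The degree three and four parts cancel by the two identities; all other terms match exactly.
  linear_combination hcub + hquart

set_option maxHeartbeats 1000000 in
/-- The remainder of the normal form is of fifth order when the Taylor remainder of `U` is
dominated by a sum of powers which are integrable on `H^s`. -/
theorem normalForm_remainder_le (hL : 0 < L)
    (hlam : ∀ k : ℤ, k ≠ 1 → k ≠ -1 → lam bc L k ≠ 0) (hμ : ∀ k, |mu bc L k| ≤ C * rho k)
    (hU : Continuous U) (a₃ a₄ : ℝ) (hs : 5 / 12 < s) (hs1 : s ≤ 1) {c Q : ℝ} (hc : 0 ≤ c)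
    (hQ : 5 ≤ Q) (hsQ : 1 / 2 - 1 / Q < s) :
    ∃ D > 0, ∀ z : ℤ → ℂ, Admissible bc z → MemH 1 z → normH s z ≤ 1 →
      (∀ t ∈ Set.Icc 0 L, |taylorRem U L a₃ a₄ (fourierFun bc L (z + nfMap bc L a₃ a₄ z) t)|
        ≤ c * (|fourierFun bc L (z + nfMap bc L a₃ a₄ z) t| ^ 5 +
          |fourierFun bc L (z + nfMap bc L a₃ a₄ z) t| ^ Q)) →
      ‖(potential bc L U (z + nfMap bc L a₃ a₄ z) : ℂ) -
          (potentialTwo bc L z + (coeffFour bc L a₃ a₄ : ℂ) * z 1 ^ 2 * z (-1) ^ 2)‖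
        ≤ D * normH s z ^ 5 := by
  have hC : 0 ≤ C := nonneg_of_mul_nonneg_left ((abs_nonneg _).trans (hμ 0)) (rho_pos 0)
  have hcc := cubeConst_nonneg s
  obtain ⟨Λ, hΛ, hlamb⟩ := exists_abs_lam_le bc L
  obtain ⟨K₂, hK₂, h₂⟩ := exists_integral_rpow_le (bc := bc) (q := 2) hL le_rfl hs1
    (by linarith)
  obtain ⟨K₄, hK₄, h₄⟩ := exists_integral_rpow_le (bc := bc) (q := 4) hL (by norm_num) hs1
    (by linarith)
  obtain ⟨K₅, hK₅, h₅⟩ := exists_integral_rpow_le (bc := bc) (q := 5) hL (by norm_num) hs1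
    (by linarith)
  obtain ⟨KQ, hKQ, hQi⟩ := exists_integral_rpow_le (bc := bc) (q := Q) hL (by linarith) hs1 hsQ
  set S := ∑' k, rho k with hS
  have hS0 : 0 ≤ S := tsum_nonneg fun k => (rho_pos k).le
  set A₂ := C * |a₃| with hA₂
  set A₃ := C * (4 * (2 * C + 1) * (a₃ ^ 2 + |a₄|)) * cubeConst s with hA₃
  have hA₂0 : 0 ≤ A₂ := by positivity
  have hA₃0 : 0 ≤ A₃ := by positivity
  set V := (A₂ + A₃) * (S / √L) with hV
  have hV0 : 0 ≤ V := by positivity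
  set W := 2 * V with hW
  set K := K₂ + K₄ with hK
  set D := Λ * A₃ * A₂ * S + 1 / 2 * (Λ * A₃ * A₃ * S)
    + |a₃ * √L / 3| * ((3 * V + 6 * V ^ 2 + 8 * V ^ 3) * (K + L))
    + |a₄ * L / 4| * ((2 * W + 6 * W ^ 2 + 2 * W ^ 3 + W ^ 4) * (3 * K + L))
    + c * (2 ^ (5 : ℝ) * (K₅ + W ^ (5 : ℝ) * L) + 2 ^ Q * (KQ + W ^ Q * L)) with hD
  refine ⟨D + 1, by positivity, fun z hz hz1 hN1 hr => ?_⟩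
  have hzs : MemH s z := hz1.mono hs1
  have hsum := hz1.summable_norm (by norm_num)
  have hN := normH_nonneg s z
  have ha := norm_nfTwo_le (a₃ := a₃) hμ (by linarith) hzs
  have hb := norm_nfThree_le (a₃ := a₃) (a₄ := a₄) hμ (by linarith) hzs
  rw [← hA₂] at ha
  rw [← hA₃] at hb
  have i₂ := h₂ z hz hsum hzs
  have i₄ := h₄ z hz hsum hzs
  have i₅ := h₅ z hz hsum hzs
  have iQ := hQi z hz hsum hzs
  set N := normH s z with hNdef
  have ha1 : MemH 1 (nfTwo bc L a₃ z) := memH_of_norm_le_rho ha (by norm_num)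
  have hb1 : MemH 1 (nfThree bc L a₃ a₄ z) := memH_of_norm_le_rho hb (by norm_num)
  have has := ha1.summable_norm (by norm_num)
  have hbs := hb1.summable_norm (by norm_num)
  obtain ⟨u, hu⟩ : ∃ u, u = fourierFun bc L z := ⟨_, rfl⟩
  obtain ⟨v, hv⟩ : ∃ v, v = fourierFun bc L (nfTwo bc L a₃ z) := ⟨_, rfl⟩
  obtain ⟨w, hw⟩ : ∃ w, w = fourierFun bc L (nfThree bc L a₃ a₄ z) := ⟨_, rfl⟩
  have cu : Continuous u := hu ▸ continuous_fourierFun hsum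
  have cv : Continuous v := hv ▸ continuous_fourierFun has
  have cw : Continuous w := hw ▸ continuous_fourierFun hbs
  have hSL : 0 ≤ S / √L := by positivity
  have bv : ∀ t, |v t| ≤ V * N ^ 2 := fun t => by
    rw [hv]
    refine (abs_fourierFun_le_of_norm_le_rho ha t).trans ?_
    have : 0 ≤ A₃ * N ^ 2 * (S / √L) := by positivity
    rw [hV]; linarith
  have bw : ∀ t, |w t| ≤ V * N ^ 3 := fun t => by
    rw [hw]
    refine (abs_fourierFun_le_of_norm_le_rho hb t).trans ?_
    have : 0 ≤ A₂ * N ^ 3 * (S / √L) := by positivity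
    rw [hV]; linarith
  have hN32 : N ^ 3 ≤ N ^ 2 := pow_le_pow_of_le_one hN hN1 (by norm_num)
  have hN65 : N ^ 6 ≤ N ^ 5 := pow_le_pow_of_le_one hN hN1 (by norm_num)
  have bd : ∀ t, |v t + w t| ≤ W * N ^ 2 := fun t => by
    have h1 := abs_add_le (v t) (w t)
    have h2 := bv t
    have h3 := (bw t).trans (mul_le_mul_of_nonneg_left hN32 hV0)
    rw [hW]; linarith
  rw [← hu] at i₂ i₄ i₅ iQ
  simp only [Real.rpow_ofNat, sq_abs, Even.pow_abs (by decide : Even 4)] at i₂ i₄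
  have j₂ : ∫ t in (0 : ℝ)..L, u t ^ 2 ≤ K * N ^ 2 := i₂.trans (by gcongr; linarith)
  have j₄ : ∫ t in (0 : ℝ)..L, u t ^ 4 ≤ K * N ^ 4 := i₄.trans (by gcongr; linarith)
  have k₅ := integral_add_rpow_le hL cu (cv.add cw) hN hN1 (by positivity : 0 ≤ W) hK₅.le le_rfl
    bd i₅
  have kQ := integral_add_rpow_le hL cu (cv.add cw) hN hN1 (by positivity : 0 ≤ W) hKQ.le hQ
    bd iQ
  have hy : ∀ t, fourierFun bc L (z + nfMap bc L a₃ a₄ z) t = u t + v t + w t := fun t => by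
    have hab : Summable fun k => ‖(nfTwo bc L a₃ z + nfThree bc L a₃ a₄ z) k‖ :=
      (ha1.add_one hb1).summable_norm (by norm_num)
    rw [nfMap, fourierFun_add hsum hab, fourierFun_add has hbs, hu, hv, hw, add_assoc]
  simp only [hy] at hr
  simp only [Pi.add_apply, ← add_assoc] at k₅ kQ
  have l₃ := abs_integral_cube_le hL cu cv cw hV0 hN hN1 bv bw j₂
  have l₄ := abs_integral_four_le hL cu (cv.add cw) (by positivity : 0 ≤ W) hN hN1 bd j₂ j₄
  simp only [Pi.add_apply] at l₄
  have l₅ := abs_integral_le_of_abs_le_rpow hL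
    ((continuous_taylorRem (L := L) (a₃ := a₃) (a₄ := a₄) hU).comp ((cu.add cv).add cw))
    ((cu.add cv).add cw) (by linarith) hc hr k₅ kQ
  simp only [Function.comp_apply, Pi.add_apply] at l₅
  have m₁ := norm_lamForm_le hlamb hb ha
  have m₂ := norm_lamForm_le hlamb hb hb
  rw [potential_sub_normalForm hL hlam hμ hU hz hz1 ha1 hb1 hu hv hw]
  refine (norm_add₃_le).trans ?_
  rw [Complex.norm_real, Real.norm_eq_abs, norm_mul]
  have n₃ := (abs_add_three _ _ _).trans (add_le_add (add_le_add
    ((abs_mul _ _).le.trans (mul_le_mul_of_nonneg_left l₃ (abs_nonneg (a₃ * √L / 3))))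
    ((abs_mul _ _).le.trans (mul_le_mul_of_nonneg_left l₄ (abs_nonneg (a₄ * L / 4))))) l₅)
  have hhalf : ‖(1 / 2 : ℂ)‖ = 1 / 2 := by norm_num
  rw [hhalf]
  -- The form at `(g₃, g₃)` has degree six, the one at `(g₃, g₂)` exactly five.
  have m₂' : Λ * (A₃ * N ^ 3) * (A₃ * N ^ 3) * S ≤ Λ * A₃ * A₃ * S * N ^ 5 := by
    calc _ = Λ * A₃ * A₃ * S * N ^ 6 := by ring
      _ ≤ _ := by gcongr
  have hN5 : 0 ≤ N ^ 5 := by positivity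
  refine (add_le_add (add_le_add m₁
    (mul_le_mul_of_nonneg_left (m₂.trans m₂') (by norm_num : (0 : ℝ) ≤ 1 / 2))) n₃).trans ?_
  clear_value A₂ A₃ V W K S N
  refine le_trans (le_of_eq ?_) (mul_le_mul_of_nonneg_right (le_add_of_nonneg_right zero_le_one :
    D ≤ D + 1) hN5)
  rw [hD, ← hS]
  ring

end NormalFormBound

end NormalForm

/-! ### Assembly of the four properties. -/

theorem mainTheorem7 (bc : NormalForm.BoundaryCondition) (L : ℝ) (hL : 0 < L)
    (hlam : ∃ c > 0, ∀ k : ℤ, k ≠ 1 → k ≠ -1 → c ≤ |NormalForm.lam bc L k|) :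
    ∃ g : ℝ → ℝ → (ℤ → ℂ) → (ℤ → ℂ),
      -- `g a₃ a₄` acts on real sequences, preserves both boundary conditions, and preserves `H^1`
      (∀ (a₃ a₄ s : ℝ) (z : ℤ → ℂ), 5 / 12 < s → s < 1 / 2 → NormalForm.MemH s z →
        ((∀ k, (z k).im = 0) → ∀ k, (g a₃ a₄ z k).im = 0) ∧
        ((∀ k, z (-k) = z k) → ∀ k, g a₃ a₄ z (-k) = g a₃ a₄ z k) ∧
        ((∀ k, z (-k) = (starRingEnd ℂ) (z k)) →
          ∀ k, g a₃ a₄ z (-k) = (starRingEnd ℂ) (g a₃ a₄ z k)) ∧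
        (NormalForm.MemH 1 z → NormalForm.MemH 1 (g a₃ a₄ z))) ∧
      -- the normal form
      (∀ (U : ℝ → ℝ) (a₃ a₄ s : ℝ), ContDiff ℝ 5 U →
        (fun u : ℝ => U u - (-(1 / 2) * u ^ 2 + a₃ * Real.sqrt L / 3 * u ^ 3
            + a₄ * L / 4 * u ^ 4)) =O[𝓝 0] (fun u : ℝ => u ^ 5) →
        5 / 12 < s → s < 1 / 2 →
        (∀ M : ℝ, NormalForm.NormalFormOn bc L U a₃ a₄ s (g a₃ a₄)
          (fun z => ∀ x ∈ Set.Icc 0 L, |NormalForm.fourierFun bc L z x| ≤ M)) ∧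
        (∀ M₀ p₀ : ℝ, 2 ≤ p₀ → (∀ u : ℝ, |U u| ≤ M₀ * (1 + |u| ^ (2 * p₀))) →
          1 / 2 - 1 / (2 * p₀) < s →
          NormalForm.NormalFormOn bc L U a₃ a₄ s (g a₃ a₄) (fun _ => True))) ∧
      -- the size of `g`
      (∀ a₃ a₄ s t : ℝ, 5 / 12 < s → s < 1 / 2 → t < 2 * s - 1 / 2 →
        ∃ C > 0, ∃ δ > 0, ∀ z : ℤ → ℂ, NormalForm.MemH s z → NormalForm.normH s z ≤ δ →
          NormalForm.MemH t (g a₃ a₄ z) ∧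
          NormalForm.normH t (g a₃ a₄ z) ≤ C * NormalForm.normH s z ^ 2) ∧
      -- the Jacobian, with constants that do not depend on `a₃` and `a₄`
      (∀ s : ℝ, 5 / 12 < s → s < 1 / 2 →
        ∃ C > 0, ∃ δ > 0, ∀ (a₃ a₄ : ℝ) (z : ℤ → ℂ), NormalForm.MemH s z →
          |a₃| * NormalForm.normH s z ≤ δ → |a₄| * NormalForm.normH s z ^ 2 ≤ δ →
          ∃ (J : ℤ → ℤ → ℂ) (D : ℂ), NormalForm.HasJacobianMatrix (g a₃ a₄) J z ∧
            NormalForm.HasDetOneAdd J D ∧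
            ‖D - 1‖ ≤ C * (|a₃| * NormalForm.normH s z + |a₄| * NormalForm.normH s z ^ 2)) := by
  obtain ⟨C, hC, hμ⟩ := NormalForm.exists_abs_mu_le hL hlam
  have hlam0 : ∀ k : ℤ, k ≠ 1 → k ≠ -1 → NormalForm.lam bc L k ≠ 0 := by
    obtain ⟨c, hc, h⟩ := hlam
    exact fun k h1 h2 => abs_pos.1 (hc.trans_le (h k h1 h2))
  refine ⟨NormalForm.nfMap bc L, ?_, ?_, ?_, ?_⟩
  · intro a₃ a₄ s z hs _ hz
    refine ⟨fun h k => NormalForm.nfMap_im_of_real L a₃ a₄ k h,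
      fun h k => NormalForm.nfMap_neg_of_even L a₃ a₄ k h,
      fun h k => NormalForm.nfMap_neg_of_conj L a₃ a₄ k h, fun _ => ?_⟩
    obtain ⟨B, -, hB⟩ := NormalForm.exists_norm_nfMap_le hμ (by linarith : 1 / 6 < s) a₃ a₄
    exact NormalForm.memH_of_norm_le_rho (hB z hz) (by norm_num)
  · intro U a₃ a₄ s hU hO hs hs'
    have hUc := hU.continuous
    constructor
    · intro M
      obtain ⟨B, hB0, hB⟩ := NormalForm.exists_norm_nfMap_le hμ (by linarith : 1 / 6 < s) a₃ a₄
      -- For `‖z‖_{H^s} ≤ 1` the function of `g z` is bounded by the added term, as `N² + N³ ≤ 2`;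
      -- so the transformed function stays in a fixed compact interval.
      obtain ⟨c, hc, hcb⟩ := NormalForm.exists_taylorRem_le_of_bounded hUc hO
        (M + B * 2 * ((∑' k, NormalForm.rho k) / √L))
      obtain ⟨D, hD, h⟩ := NormalForm.normalForm_remainder_le hL hlam0 hμ hUc a₃ a₄ hs
        (by linarith) hc.le le_rfl (by linarith)
      refine ⟨D, hD, 1, one_pos, fun z hz hz1 hN hM => h z hz hz1 hN fun t ht => ?_⟩
      have hg : ∀ k, ‖NormalForm.nfMap bc L a₃ a₄ z k‖ ≤ B * 2 * NormalForm.rho k := fun k => by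
        refine (hB z (hz1.mono (by linarith)) k).trans
          (mul_le_mul_of_nonneg_right ?_ (NormalForm.rho_pos k).le)
        have h0 := NormalForm.normH_nonneg s z
        have h2 := pow_le_one₀ (n := 2) h0 hN
        have h3 := pow_le_one₀ (n := 3) h0 hN
        exact mul_le_mul_of_nonneg_left (by linarith) hB0.le
      have hgs : Summable fun k => ‖NormalForm.nfMap bc L a₃ a₄ z k‖ :=
        Summable.of_nonneg_of_le (fun _ => norm_nonneg _) hg
          (NormalForm.summable_rho.mul_left _)
      have hy : |NormalForm.fourierFun bc L (z + NormalForm.nfMap bc L a₃ a₄ z) t|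
          ≤ M + B * 2 * ((∑' k, NormalForm.rho k) / √L) := by
        rw [NormalForm.fourierFun_add (hz1.summable_norm (by norm_num)) hgs]
        exact (abs_add_le _ _).trans (add_le_add (hM t ht)
          (NormalForm.abs_fourierFun_le_of_norm_le_rho hg t))
      refine (hcb _ hy).trans (mul_le_mul_of_nonneg_left ?_ hc.le)
      exact le_add_of_nonneg_right (Real.rpow_nonneg (abs_nonneg _) _)
    · intro M₀ p₀ hp hg hsp
      -- This `Q` is at least `5` and dominates the growth of `U`. The embedding into `L^Q` needs `s
      -- > 3/10` if `Q = 5`, and otherwise the hypothesis on `p₀`.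
      obtain ⟨c, hc, hcb⟩ := NormalForm.exists_taylorRem_le_of_growth (Q := max 5 (2 * p₀))
        (by linarith) (le_max_left _ _) (le_max_right _ _) hO hg
      have hsQ : 1 / 2 - 1 / max 5 (2 * p₀) < s := by
        rcases max_choice 5 (2 * p₀) with h | h <;> rw [h] <;> linarith
      obtain ⟨D, hD, h⟩ := NormalForm.normalForm_remainder_le hL hlam0 hμ hUc a₃ a₄ hs
        (by linarith) hc.le (le_max_left 5 (2 * p₀)) hsQ
      exact ⟨D, hD, 1, one_pos, fun z hz hz1 hN _ => h z hz hz1 hN fun t _ => hcb _⟩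
  · intro a₃ a₄ s t hs hs' ht
    -- Here `t < 2s - 1/2 < 1/2`, well below the threshold `3/2`.
    exact NormalForm.nfMap_size hμ (by linarith) (by linarith) a₃ a₄
  · intro s hs _
    exact NormalForm.nfMap_det hC hμ (by linarith)
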